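/- For $K\subseteq\mathbb{R}^n$ and $\delta>0$ put $B_2(K,\delta)=\{x : \exists y\in K,\ \|x-y\|_2\le\delta\}$ and $B_2(K,-\delta)=\{x : B_2(x,\delta)\subseteq K\}$, where $B_2(x,\delta)$ is the closed Euclidean ball. A membership oracle for $K$ with error $\delta$ is a function $m:\mathbb{R}^n\to\{0,1\}$ such that $m(x)=1$ implies $x\in B_2(K,\delta)$ and $m(x)=0$ implies $x\notin B_2(K,-\delta)$; a quantum query to it is the unitary $|x\rangle|z\rangle\mapsto|x\rangle|z\oplus m(x)\rangle$, where $x$ is held in $n$ registers in fixed-point (two's-complement) notation. A quantum circuit consists of such queries and of elementary gates (arbitrary one-qubit unitaries, CNOT and Toffoli gates), and ends with a measurement in the computational basis. Its output is a flag bit and a vector $g\in\mathbb{Z}^n$; an output with the flag set asserts $p\in B_2(K,\eta)$, and an output with the flag not set and $g\neq0$ stands for the unit vector $\hat c=g/\|g\|_2$. The circuit is a separation oracle for $K$ with error $\eta$ if for every point $p\in\mathbb{R}^n$, with probability at least $1-\eta$, it either correctly asserts $p\in B_2(K,\eta)$, or outputs a unit vector $\hat c$ such that $\hat c^{T}p\le\hat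 c^{T}y+\eta$ for all $y\in B_2(K,-\eta)$. The circuit receives $p$ in fixed-point notation with $b$ bits per coordinate, $f$ of them after the binary point, as any such approximation of $p$ with Euclidean error at most the error $\delta$ of the membership oracle (so in particular exactly, if $p$ is representable). **Theorem.** For every $a\in\mathbb{N}$ there are constants $C,k\in\mathbb{N}$ such that the following holds for all integers $n\ge1$ and all reals $0<r<R$ and $\eta>0$ with $R\le a n^{a}$ and $\kappa:=R/r\le a n^{a}$ (that is, $R$, $r$, $\kappa$ are at most $\mathrm{poly}(n)$). There is $\delta>0$ with $1/\delta\le C(2+n/\eta)^{k}$ such that for all $b,f\in\mathbb{N}$ there is a quantum circuit, depending only on $n,r,R,\eta,\delta,b,f$, that makes at most $C\log^{k}(2+n/\eta)$ queries, uses at most $C\,n\,(\log(2+n/\eta)+b)^{k}$ elementary gates, and that, for every convex set $K\subseteq\mathbb{R}^n$ with $B_2(0,r)\subseteq K\subseteq B_2(0,R)$ and every membership oracle for $K$ with error $\delta$, is a separation oracle for $K$ with error $\eta$ when run with that membership oracle. In particular, a separation oracle for $K$ with error $\eta$ can be implemented using $\tilde O(1)$ quantum membership queries and $\tilde O(n)$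 gates, where $\tilde O$ suppresses factors polylogarithmic in $n$ and $1/\eta$ and polynomial in the number $b$ of bits per input coordinate. -/

import Mathlib

noncomputable section

namespace QuantumSeparation

/-! ### Convex geometry: neighbourhoods, interiors, membership oracles -/

/-- The `δ`-neighbourhood `B₂(K, δ)` of a set `K`. -/
def neighborhood {n : ℕ} (K : Set (EuclideanSpace ℝ (Fin n))) (δ : ℝ) :
    Set (EuclideanSpace ℝ (Fin n)) :=
  {x | ∃ y ∈ K, ‖x - y‖ ≤ δ}

/-- The `δ`-interior `B₂(K, -δ)` of a set `K`. -/
def deepInterior {n : ℕ} (K : Set (EuclideanSpace ℝ (Fin n))) (δ : ℝ) :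
    Set (EuclideanSpace ℝ (Fin n)) :=
  {x | Metric.closedBall x δ ⊆ K}

/-- `m` is the answer function of a membership oracle for `K` with error `δ`: the answer `true`
asserts `x ∈ B₂(K, δ)`, the answer `false` asserts `x ∉ B₂(K, -δ)`, and every assertion is
correct. (Between the two sets either answer is allowed.) -/
def IsMembershipOracle {n : ℕ} (K : Set (EuclideanSpace ℝ (Fin n))) (δ : ℝ)
    (m : EuclideanSpace ℝ (Fin n) → Bool) : Prop :=
  ∀ x, (m x = true → x ∈ neighborhood K δ) ∧ (m x = false → x ∉ deepInterior K δ)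

/-- The unit vector `c` is a legal answer of a separation oracle with error `η` at `p`. -/
def IsSeparatingDirection {n : ℕ} (K : Set (EuclideanSpace ℝ (Fin n))) (η : ℝ)
    (p c : EuclideanSpace ℝ (Fin n)) : Prop :=
  ‖c‖ = 1 ∧ ∀ y ∈ deepInterior K η, inner ℝ c p ≤ inner ℝ c y + η

/-! ### Binary representation of points -/

/-- The integer with the `b`-bit two's-complement representation `v`
(bit `j` has weight `2 ^ j`, the top bit has weight `-2 ^ (b - 1)`). -/
def twosComplement {b : ℕ} (v : Fin b → Bool) : ℤ :=
  ∑ j : Fin b, if v j then (if (j : ℕ) + 1 = b then -2 ^ (j : ℕ) else 2 ^ (j : ℕ)) else 0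

/-- The point of `ℝⁿ` whose coordinates are given in fixed-point two's-complement notation,
with `b` bits in all, `f` of them after the binary point. -/
def fixedPoint {n b : ℕ} (f : ℕ) (v : Fin n × Fin b → Bool) : EuclideanSpace ℝ (Fin n) :=
  WithLp.toLp 2 fun i => (twosComplement (fun j => v (i, j)) : ℝ) / 2 ^ f

/-! ### Quantum circuits with membership queries -/

/-- One step of a quantum circuit on `w` qubits: an elementary gate (an arbitrary one-qubit
unitary, a controlled-not, or a Toffoli gate), or a query to the oracle. A query acts on
`n` registers of `q` qubits, which hold the point that is queried, and on a target qubit. -/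
inductive Gate (n q w : ℕ) : Type
  | single (U : Matrix.unitaryGroup Bool ℂ) (i : Fin w) : Gate n q w
  | cnot (i t : Fin w) (hit : i ≠ t) : Gate n q w
  | toffoli (i j t : Fin w) (hij : i ≠ j) (hit : i ≠ t) (hjt : j ≠ t) : Gate n q w
  | query (x : Fin n × Fin q ↪ Fin w) (t : Fin w) (ht : t ∉ Set.range x) : Gate n q w

/-- Whether a step is an oracle query. -/
def Gate.isQuery {n q w : ℕ} : Gate n q w → Bool
  | .query _ _ _ => true
  | _ => false

/-- Amplitudes, in the computational basis, of a state of `w` qubits. -/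
abbrev QState (w : ℕ) : Type := (Fin w → Bool) → ℂ

/-- The linear map that sends the basis state `|s⟩` to `|s with s t replaced by s t ⊕ g s⟩`. It is
used only where `g s` does not depend on `s t`, so that this map of basis states is an
involution. -/
def xorInto {w : ℕ} (t : Fin w) (g : (Fin w → Bool) → Bool) (ψ : QState w) : QState w :=
  fun s => ψ (Function.update s t (xor (s t) (g s)))

/-- The action of one step on a state. Queried points have `fq` bits after the binary point, and a
query acts as `|x⟩|z⟩ ↦ |x⟩|z ⊕ m(x)⟩`. -/
def Gate.apply {n q w : ℕ} (fq : ℕ) (m : EuclideanSpace ℝ (Fin n) → Bool) :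
    Gate n q w → QState w → QState w
  | .single U i, ψ => fun s => ∑ c : Bool, (U : Matrix Bool Bool ℂ) (s i) c *
      ψ (Function.update s i c)
  | .cnot i t _, ψ => xorInto t (fun s => s i) ψ
  | .toffoli i j t _ _ _, ψ => xorInto t (fun s => s i && s j) ψ
  | .query x t _, ψ => xorInto t (fun s => m (fixedPoint fq fun k => s (x k))) ψ

/-- A quantum query circuit that takes a point of `ℝⁿ` with `b` bits per coordinate and returns
a flag bit and a vector of `n` integers of `outBits` bits each. -/
structure SeparationCircuit (n b : ℕ) where
  /-- number of qubits -/
  width : ℕ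
  /-- number of bits per coordinate of a queried point -/
  queryBits : ℕ
  /-- number of those bits after the binary point -/
  queryFrac : ℕ
  /-- number of bits per coordinate of the output vector -/
  outBits : ℕ
  /-- the qubits that hold the input; all others start in `|0⟩` -/
  input : Fin n × Fin b ↪ Fin width
  /-- the qubit that holds the output flag -/
  flag : Fin width
  /-- the qubits that hold the output vector -/
  output : Fin n × Fin outBits ↪ Fin width
  /-- the steps, in order of execution -/
  gates : List (Gate n queryBits width)

namespace SeparationCircuit

variable {n b : ℕ} (𝒞 : SeparationCircuit n b)

/-- The number of oracle queries. -/
def queryCount : ℕ := 𝒞.gates.countP fun g => g.isQuery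

/-- The number of elementary gates (queries are not counted). -/
def gateCount : ℕ := 𝒞.gates.countP fun g => !g.isQuery

/-- The basis state in which the circuit starts on input `u`. -/
def initial (u : Fin n × Fin b → Bool) : Fin 𝒞.width → Bool :=
  Function.extend 𝒞.input u fun _ => false

/-- The state at the end of the circuit, on input `u` and with the oracle `m`. -/
def final (m : EuclideanSpace ℝ (Fin n) → Bool) (u : Fin n × Fin b → Bool) : QState 𝒞.width :=
  𝒞.gates.foldl (fun ψ g => g.apply 𝒞.queryFrac m ψ) (Pi.single (𝒞.initial u) 1)

/-- The probability that measuring all qubits of the final state, in the computational basis,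
gives an outcome in `S`. -/
def prob (m : EuclideanSpace ℝ (Fin n) → Bool) (u : Fin n × Fin b → Bool)
    (S : Set (Fin 𝒞.width → Bool)) : ℝ :=
  ∑ s, S.indicator (fun s => ‖𝒞.final m u s‖ ^ 2) s

/-- The output vector read from the measurement outcome `s`. It stands for the unit vector in its
direction. -/
def outVector (s : Fin 𝒞.width → Bool) : EuclideanSpace ℝ (Fin n) :=
  fixedPoint 0 fun k => s (𝒞.output k)

/-- The measurement outcomes that are correct answers of a separation oracle for `K` with error
`η` at the point `p`: either the flag is set, which asserts `p ∈ B₂(K, η)`, and this is true; or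
the flag is not set, the output vector is nonzero, and its normalization is a separating
direction. -/
def correct (K : Set (EuclideanSpace ℝ (Fin n))) (η : ℝ) (p : EuclideanSpace ℝ (Fin n)) :
    Set (Fin 𝒞.width → Bool) :=
  {s | (s 𝒞.flag = true ∧ p ∈ neighborhood K η) ∨
    (s 𝒞.flag = false ∧ 𝒞.outVector s ≠ 0 ∧
      IsSeparatingDirection K η p (‖𝒞.outVector s‖⁻¹ • 𝒞.outVector s))}

/-- The circuit, run with the membership oracle `m`, is a separation oracle for `K` with error `η`:
at every point `p` of `ℝⁿ`, the answer is correct for `p` with probability at least `1 - η`, when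
the circuit is given any fixed-point approximation of `p` (`b` bits per coordinate, `f` of them
after the binary point) that is accurate within `τ`; in particular this holds at every point that
is exactly representable. -/
def ImplementsSeparation (f : ℕ) (τ : ℝ) (K : Set (EuclideanSpace ℝ (Fin n))) (η : ℝ)
    (m : EuclideanSpace ℝ (Fin n) → Bool) : Prop :=
  ∀ (p : EuclideanSpace ℝ (Fin n)) (u : Fin n × Fin b → Bool), ‖p - fixedPoint f u‖ ≤ τ →
    1 - η ≤ 𝒞.prob m u (𝒞.correct K η p)

end SeparationCircuit

end QuantumSeparation

end

/-! Write γ for the gauge of K. Since K contains the ball of radius r, γ is sublinear and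
(1/r)-Lipschitz, and γ ≤ 1 on K. If the oracle rejects the truncated input, then γ is at least
nearly 1 there and at all points nearby. A subgradient f of γ at such a point x satisfies f(x) =
γ(x) and f ≤ γ everywhere, so f(y) ≤ 1 for y in K while f(p) is at least 1 up to a small error.
Hence every vector close enough to a negative multiple of f is a separating direction
(`IsSupporting.isSeparatingDirection`), and the task is to find a subgradient with few queries. This
is done by quantum gradient estimation, applied to 1/γ.

Values. The number 1/γ(x) is where the ray through x leaves K. Bisection along the ray with
membership queries finds it up to 2δ/r + 2·2^(-T) wherever γ ≥ 1/2 (`abs_search_sub_inv_gauge_le`).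
The bisection is a reversible straight-line program made of ripple-carry additions. It is run, its
answers are turned into a phase, and it is run backwards. As the oracle is a fixed function, the net
effect is exactly multiplication of the basis state of x by exp(2πi A(x)), where A is a multiple of
the estimate of 1/γ.

Smoothness. The gauge need not be differentiable. On a box x + [0, D]ⁿ it exceeds its linearization
at x by at most D ∑ᵢ (gᵢ(eᵢ) - f(eᵢ)), with gᵢ a subgradient at x + nD eᵢ
(`IsSupporting.gauge_sub_le`). Averaged over the position of the box in a coarse grid of Mⁿ boxes,
the i-th difference telescopes along direction i and is at most 2n/(rM) (`sum_shift_sub_le`). The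
position is held in a register that is in superposition, only controls later steps and is never
transformed, so it acts as a uniformly random offset. Then A has nearly constant increments ω = -α f
on a typical box, where α is the scale of the phase per grid step divided by γ².

Frequencies. The amplitudes need no individual analysis. For Φ = exp(2πi A), the transform of Φ(x +
eᵢ) - exp(2πi ωᵢ) Φ(x) is the transform of Φ multiplied by exp(2πi yᵢ/N) - exp(2πi ωᵢ). By Parseval,
the mean square distance of the measured frequency from ω is the mean square of these increments,
which is small except on the slice where the cyclic shift wraps around (`sum_dft_phase_le`).
Markov's inequality concludes (`Params.one_sub_le_prob_circuit`).

The other cases are elementary. An accepted truncation lets the flag assert nearness to K. An input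
with a very large coordinate is separated by minus itself. If η > R, the deep interior is empty and
any direction will do. If η ≥ 1, nothing has to be shown. All parameters are powers of one g =
2^(-l) with 1/g polynomial in n/η, so that l is logarithmic. The gate count is linear in n because
the Fourier transform couples only digits of the same coordinate. -/

noncomputable section

namespace QuantumSeparation

/-! ### Circuits on an arbitrary finite type of wires -/

/-- One step of a quantum circuit whose qubits are indexed by an arbitrary type `W`. -/
inductive WGate (n q : ℕ) (W : Type) : Type
  | single (U : Matrix.unitaryGroup Bool ℂ) (i : W) : WGate n q W
  | cnot (i t : W) (hit : i ≠ t) : WGate n q W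
  | toffoli (i j t : W) (hij : i ≠ j) (hit : i ≠ t) (hjt : j ≠ t) : WGate n q W
  | query (x : Fin n × Fin q ↪ W) (t : W) (ht : t ∉ Set.range x) : WGate n q W

namespace WGate

variable {n q w : ℕ} {W : Type}

/-- Transport along an enumeration of the wires. -/
def toGate (e : W ≃ Fin w) : WGate n q W → Gate n q w
  | single U i => .single U (e i)
  | cnot i t h => .cnot (e i) (e t) (e.injective.ne h)
  | toffoli i j t hij hit hjt =>
      .toffoli (e i) (e j) (e t) (e.injective.ne hij) (e.injective.ne hit) (e.injective.ne hjt)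
  | query x t ht => .query (x.trans e.toEmbedding) (e t) (by
      rintro ⟨k, hk⟩
      exact ht ⟨k, e.injective hk⟩)

/-- Whether a step is an oracle query. -/
def isQuery : WGate n q W → Bool
  | query _ _ _ => true
  | _ => false

@[simp] theorem isQuery_toGate (e : W ≃ Fin w) (g : WGate n q W) :
    (g.toGate e).isQuery = g.isQuery := by
  cases g <;> rfl

variable [DecidableEq W]

/-- The action of one step on a state. -/
def apply (fq : ℕ) (m : EuclideanSpace ℝ (Fin n) → Bool) :
    WGate n q W → ((W → Bool) → ℂ) → ((W → Bool) → ℂ)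
  | single U i, ψ => fun s => ∑ c : Bool, (U : Matrix Bool Bool ℂ) (s i) c *
      ψ (Function.update s i c)
  | cnot i t _, ψ => fun s => ψ (Function.update s t (xor (s t) (s i)))
  | toffoli i j t _ _ _, ψ => fun s => ψ (Function.update s t (xor (s t) (s i && s j)))
  | query x t _, ψ => fun s =>
      ψ (Function.update s t (xor (s t) (m (fixedPoint fq fun k => s (x k)))))

theorem apply_toGate (e : W ≃ Fin w) (fq : ℕ) (m : EuclideanSpace ℝ (Fin n) → Bool)
    (g : WGate n q W) (ψ : QState w) (s : W → Bool) :
    (g.toGate e).apply fq m ψ (s ∘ e.symm) = g.apply fq m (fun t => ψ (t ∘ e.symm)) s := by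
  have h : ∀ (i : W) (c : Bool),
      Function.update (s ∘ e.symm) (e i) c = Function.update s i c ∘ e.symm := by
    intro i c
    rw [Function.update_comp_equiv]
    simp
  cases g <;> simp [toGate, Gate.apply, apply, xorInto, h]

end WGate

variable {n q w : ℕ} {W : Type} [DecidableEq W]

/-- The action of a list of steps. -/
def runGates (fq : ℕ) (m : EuclideanSpace ℝ (Fin n) → Bool) (Γ : List (WGate n q W))
    (ψ : (W → Bool) → ℂ) : (W → Bool) → ℂ :=
  Γ.foldl (fun ψ g => g.apply fq m ψ) ψ

@[simp] theorem runGates_nil (fq : ℕ) (m : EuclideanSpace ℝ (Fin n) → Bool)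
    (ψ : (W → Bool) → ℂ) : runGates (q := q) fq m [] ψ = ψ := rfl

@[simp] theorem runGates_cons (fq : ℕ) (m : EuclideanSpace ℝ (Fin n) → Bool) (g : WGate n q W)
    (Γ : List (WGate n q W)) (ψ : (W → Bool) → ℂ) :
    runGates fq m (g :: Γ) ψ = runGates fq m Γ (g.apply fq m ψ) := rfl

@[simp] theorem runGates_append (fq : ℕ) (m : EuclideanSpace ℝ (Fin n) → Bool)
    (Γ Δ : List (WGate n q W)) (ψ : (W → Bool) → ℂ) :
    runGates fq m (Γ ++ Δ) ψ = runGates fq m Δ (runGates fq m Γ ψ) := by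
  simp [runGates]

theorem foldl_apply_toGate (e : W ≃ Fin w) (fq : ℕ) (m : EuclideanSpace ℝ (Fin n) → Bool)
    (Γ : List (WGate n q W)) (ψ : QState w) (s : W → Bool) :
    (Γ.map (WGate.toGate e)).foldl (fun ψ g => g.apply fq m ψ) ψ (s ∘ e.symm) =
      runGates fq m Γ (fun t => ψ (t ∘ e.symm)) s := by
  induction Γ generalizing ψ with
  | nil => rfl
  | cons g Γ ih =>
    rw [List.map_cons, List.foldl_cons, ih, runGates_cons]
    congr 1
    funext t
    exact g.apply_toGate e fq m ψ t

/-- A separation circuit presented with an arbitrary finite type of wires. -/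
def circuitOfWires [Fintype W] {b : ℕ} (qf ob : ℕ) (input : Fin n × Fin b ↪ W) (flag : W)
    (output : Fin n × Fin ob ↪ W) (Γ : List (WGate n q W)) : SeparationCircuit n b where
  width := Fintype.card W
  queryBits := q
  queryFrac := qf
  outBits := ob
  input := input.trans (Fintype.equivFin W).toEmbedding
  flag := Fintype.equivFin W flag
  output := output.trans (Fintype.equivFin W).toEmbedding
  gates := Γ.map (WGate.toGate (Fintype.equivFin W))

/-- The initial basis state on input `u`. -/
def initialState {b : ℕ} (input : Fin n × Fin b ↪ W) (u : Fin n × Fin b → Bool) : W → Bool :=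
  Function.extend input u fun _ => false

/-- The basis state with all amplitude on `s₀`. -/
def basisState (s₀ : W → Bool) : (W → Bool) → ℂ :=
  open Classical in fun s => if s = s₀ then 1 else 0

/-- The answer with flag `c` and vector `v` is correct at `p`. -/
def CorrectAnswer (K : Set (EuclideanSpace ℝ (Fin n))) (η : ℝ) (p : EuclideanSpace ℝ (Fin n))
    (c : Bool) (v : EuclideanSpace ℝ (Fin n)) : Prop :=
  (c = true ∧ p ∈ neighborhood K η) ∨
    (c = false ∧ v ≠ 0 ∧ IsSeparatingDirection K η p (‖v‖⁻¹ • v))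

theorem SeparationCircuit.mem_correct {b : ℕ} (𝒞 : SeparationCircuit n b)
    (K : Set (EuclideanSpace ℝ (Fin n))) (η : ℝ) (p : EuclideanSpace ℝ (Fin n))
    (s : Fin 𝒞.width → Bool) :
    s ∈ 𝒞.correct K η p ↔ CorrectAnswer K η p (s 𝒞.flag) (𝒞.outVector s) := Iff.rfl

section circuitOfWires

variable [Fintype W] {b : ℕ} (qf ob : ℕ) (input : Fin n × Fin b ↪ W) (flag : W)
    (output : Fin n × Fin ob ↪ W) (Γ : List (WGate n q W))

omit [DecidableEq W] in
theorem circuitOfWires_queryCount :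
    (circuitOfWires qf ob input flag output Γ).queryCount = Γ.countP fun g => g.isQuery := by
  simp [SeparationCircuit.queryCount, circuitOfWires, List.countP_map, Function.comp_def]

omit [DecidableEq W] in
theorem circuitOfWires_gateCount :
    (circuitOfWires qf ob input flag output Γ).gateCount = Γ.countP fun g => !g.isQuery := by
  simp [SeparationCircuit.gateCount, circuitOfWires, List.countP_map, Function.comp_def]

theorem circuitOfWires_final (m : EuclideanSpace ℝ (Fin n) → Bool) (u : Fin n × Fin b → Bool)
    (s : W → Bool) :
    (circuitOfWires qf ob input flag output Γ).final m u (s ∘ (Fintype.equivFin W).symm) =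
      runGates qf m Γ (basisState (initialState input u)) s := by
  unfold SeparationCircuit.final
  refine (foldl_apply_toGate (Fintype.equivFin W) qf m Γ _ s).trans ?_
  congr 1
  funext t
  have h : (circuitOfWires qf ob input flag output Γ).initial u =
      initialState input u ∘ (Fintype.equivFin W).symm := by
    funext i
    obtain ⟨x, rfl⟩ := (Fintype.equivFin W).surjective i
    simp only [SeparationCircuit.initial, circuitOfWires, initialState, Function.comp_apply,
      Equiv.symm_apply_apply]
    by_cases hx : ∃ k, input k = x
    · obtain ⟨k, rfl⟩ := hx
      rw [input.injective.extend_apply]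
      exact (input.trans (Fintype.equivFin W).toEmbedding).injective.extend_apply _ _ k
    · rw [Function.extend_apply' _ _ _ hx, Function.extend_apply']
      rintro ⟨k, hk⟩
      exact hx ⟨k, (Fintype.equivFin W).injective hk⟩
  have hs : ∀ x y : Fin (Fintype.card W) → Bool,
      (Pi.single x 1 : QState (Fintype.card W)) y = if y = x then 1 else 0 := fun x y =>
    Pi.single_apply x 1 y
  rw [h]
  refine (hs _ _).trans ?_
  unfold basisState
  have ht := (Fintype.equivFin W).symm.surjective.injective_comp_right.eq_iff (a := t)
    (b := initialState input u)
  by_cases h' : t = initialState input u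
  · rw [if_pos (ht.2 h'), if_pos h']
  · rw [if_neg (fun h => h' (ht.1 h)), if_neg h']

open Classical in
theorem circuitOfWires_prob (m : EuclideanSpace ℝ (Fin n) → Bool) (u : Fin n × Fin b → Bool)
    (K : Set (EuclideanSpace ℝ (Fin n))) (η : ℝ) (p : EuclideanSpace ℝ (Fin n)) :
    (circuitOfWires qf ob input flag output Γ).prob m u
        ((circuitOfWires qf ob input flag output Γ).correct K η p) =
      ∑ s : W → Bool, if CorrectAnswer K η p (s flag) (fixedPoint 0 fun k => s (output k)) then
        ‖runGates qf m Γ (basisState (initialState input u)) s‖ ^ 2 else 0 := by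
  unfold SeparationCircuit.prob
  symm
  refine Fintype.sum_equiv ((Fintype.equivFin W).arrowCongr (Equiv.refl Bool)) _ _ ?_
  intro s
  change _ = Set.indicator _ _ (s ∘ (Fintype.equivFin W).symm)
  have h2 := circuitOfWires_final qf ob input flag output Γ m u s
  have h4 : ∀ x : W, (s ∘ (Fintype.equivFin W).symm) (Fintype.equivFin W x) = s x := by simp
  have h5 : (circuitOfWires qf ob input flag output Γ).outVector
      (s ∘ (Fintype.equivFin W).symm) = fixedPoint 0 fun k => s (output k) := by
    unfold SeparationCircuit.outVector
    congr 1
    funext k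
    exact h4 (output k)
  have h6 : (s ∘ (Fintype.equivFin W).symm)
      (circuitOfWires qf ob input flag output Γ).flag = s flag := h4 flag
  have h3 := ((circuitOfWires qf ob input flag output Γ).mem_correct K η p
    (s ∘ (Fintype.equivFin W).symm)).trans (iff_of_eq (congrArg₂ (CorrectAnswer K η p) h6 h5))
  by_cases hs : CorrectAnswer K η p (s flag) (fixedPoint 0 fun k => s (output k))
  · rw [if_pos hs, ← h2]
    exact (Set.indicator_of_mem (h3.2 hs) fun s =>
      ‖(circuitOfWires qf ob input flag output Γ).final m u s‖ ^ 2).symm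
  · rw [if_neg hs]
    exact (Set.indicator_of_notMem (fun h => hs (h3.1 h)) fun s =>
      ‖(circuitOfWires qf ob input flag output Γ).final m u s‖ ^ 2).symm

theorem prob_nonneg {n b : ℕ} (𝒞 : SeparationCircuit n b)
    (m : EuclideanSpace ℝ (Fin n) → Bool) (u : Fin n × Fin b → Bool)
    (S : Set (Fin 𝒞.width → Bool)) : 0 ≤ 𝒞.prob m u S :=
  Finset.sum_nonneg fun s _ => Set.indicator_nonneg (fun _ _ => by positivity) s

end circuitOfWires

/-! ### Straight-line reversible programs -/

/-- A term that a classical step may add (modulo two) to a target wire. -/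
inductive Term (n q : ℕ) (W : Type) : Type
  | one : Term n q W
  | var (i : W) : Term n q W
  | and (i j : W) (hij : i ≠ j) : Term n q W
  | query (x : Fin n × Fin q ↪ W) : Term n q W

namespace Term

variable {n q : ℕ} {W : Type}

/-- Whether the wire `i` is read by a term. -/
def Reads : Term n q W → W → Prop
  | one, _ => False
  | var i, k => k = i
  | and i j _, k => k = i ∨ k = j
  | query x, k => k ∈ Set.range x

/-- The value of a term in a basis state. -/
def eval (fq : ℕ) (m : EuclideanSpace ℝ (Fin n) → Bool) : Term n q W → (W → Bool) → Bool
  | one, _ => true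
  | var i, s => s i
  | and i j _, s => s i && s j
  | query x, s => m (fixedPoint fq fun k => s (x k))

/-- Whether a term is an oracle query. -/
def isQuery : Term n q W → Bool
  | query _ => true
  | _ => false

theorem eval_congr (fq : ℕ) (m : EuclideanSpace ℝ (Fin n) → Bool) (τ : Term n q W)
    {s s' : W → Bool} (h : ∀ i, τ.Reads i → s i = s' i) : τ.eval fq m s = τ.eval fq m s' := by
  cases τ with
  | one => rfl
  | var i => exact h i rfl
  | and i j hij => simp only [eval, h i (Or.inl rfl), h j (Or.inr rfl)]
  | query x =>
    have : (fun k => s (x k)) = fun k => s' (x k) := funext fun k => h _ ⟨k, rfl⟩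
    simp only [eval, this]

/-- The Pauli `X` gate. -/
def pauliX : Matrix.unitaryGroup Bool ℂ :=
  ⟨Matrix.of fun a c => if a = c then 0 else 1, by
    rw [Matrix.mem_unitaryGroup_iff]
    ext a c
    cases a <;> cases c <;> simp [Matrix.mul_apply, Matrix.star_apply]⟩

/-- The elementary gate or query that adds a term to the wire `t`. -/
def toGate (t : W) : (τ : Term n q W) → ¬ τ.Reads t → WGate n q W
  | one, _ => .single pauliX t
  | var i, h => .cnot i t (Ne.symm h)
  | and i j hij, h => .toffoli i j t hij (fun e => h (Or.inl e.symm)) (fun e => h (Or.inr e.symm))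
  | query x, h => .query x t h

theorem isQuery_toGate (t : W) (τ : Term n q W) (h : ¬ τ.Reads t) :
    (τ.toGate t h).isQuery = τ.isQuery := by
  cases τ <;> rfl

theorem apply_toGate [DecidableEq W] (fq : ℕ) (m : EuclideanSpace ℝ (Fin n) → Bool) (t : W)
    (τ : Term n q W) (h : ¬ τ.Reads t) (ψ : (W → Bool) → ℂ) (s : W → Bool) :
    (τ.toGate t h).apply fq m ψ s = ψ (Function.update s t (xor (s t) (τ.eval fq m s))) := by
  cases τ with
  | one =>
    simp only [toGate, WGate.apply, pauliX, eval, Fintype.sum_bool]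
    cases s t <;> simp
  | var i => rfl
  | and i j hij => rfl
  | query x => rfl

end Term

/-- A straight-line program: the terms to be added to each wire. Every term of a wire reads only
wires of lower rank. -/
structure Program (n q : ℕ) (W : Type) where
  /-- the order of evaluation -/
  rank : W → ℕ
  /-- the terms to be added to a wire -/
  terms : W → List (Term n q W)
  /-- terms read only wires of lower rank -/
  rank_lt : ∀ w, ∀ τ ∈ terms w, ∀ i, τ.Reads i → rank i < rank w

/-- The sum modulo two of a list of terms. -/
def termSum {n q : ℕ} {W : Type} (fq : ℕ) (m : EuclideanSpace ℝ (Fin n) → Bool)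
    (l : List (Term n q W)) (s : W → Bool) : Bool :=
  (l.map fun τ => τ.eval fq m s).foldr xor false

theorem termSum_congr {n q : ℕ} {W : Type} (fq : ℕ) (m : EuclideanSpace ℝ (Fin n) → Bool)
    (l : List (Term n q W)) {s s' : W → Bool} (h : ∀ τ ∈ l, ∀ i, τ.Reads i → s i = s' i) :
    termSum fq m l s = termSum fq m l s' := by
  unfold termSum
  congr 1
  exact List.map_congr_left fun τ hτ => τ.eval_congr fq m (h τ hτ)

namespace Program

variable {n q : ℕ} {W : Type} (P : Program n q W)

theorem not_reads_self (w : W) (τ : Term n q W) (h : τ ∈ P.terms w) : ¬ τ.Reads w := fun hr =>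
  lt_irrefl _ (P.rank_lt w τ h w hr)

/-- The steps that compute one wire. -/
def gatesAt (w : W) : List (WGate n q W) :=
  (P.terms w).pmap (fun τ h => τ.toGate w h) fun τ h => P.not_reads_self w τ h

theorem countP_gatesAt_isQuery (w : W) :
    (P.gatesAt w).countP (fun g => g.isQuery) = (P.terms w).countP (fun τ => τ.isQuery) := by
  unfold gatesAt
  have : ∀ (l : List (Term n q W)) (h : ∀ τ ∈ l, ¬ τ.Reads w),
      (l.pmap (fun τ h => τ.toGate w h) h).countP (fun g => g.isQuery) =
        l.countP (fun τ => τ.isQuery) := by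
    intro l
    induction l with
    | nil => intro h; rfl
    | cons τ l ih =>
      intro h
      rw [List.pmap_cons, List.countP_cons, List.countP_cons, ih, Term.isQuery_toGate]
  exact this _ _

theorem length_gatesAt (w : W) : (P.gatesAt w).length = (P.terms w).length := by
  simp [gatesAt]

section

variable [Fintype W]

/-- The wires in order of evaluation. -/
def wires : List W := (Finset.univ : Finset W).toList.mergeSort fun a b => decide (P.rank a ≤ P.rank b)

/-- The steps of a program. -/
def gates : List (WGate n q W) := P.wires.flatMap P.gatesAt

theorem wires_perm : P.wires.Perm (Finset.univ : Finset W).toList := List.mergeSort_perm _ _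

theorem mem_wires (w : W) : w ∈ P.wires := by
  rw [P.wires_perm.mem_iff]
  simp

theorem nodup_wires : P.wires.Nodup := by
  rw [P.wires_perm.nodup_iff]
  exact Finset.nodup_toList _

theorem pairwise_wires : P.wires.Pairwise fun a b => P.rank a ≤ P.rank b := by
  have := List.pairwise_mergeSort (le := fun a b => decide (P.rank a ≤ P.rank b))
    (fun a b c hab hbc => by
      simp only [decide_eq_true_eq] at *
      omega)
    (fun a b => by
      simp only [Bool.or_eq_true, decide_eq_true_eq]
      omega) (Finset.univ : Finset W).toList
  simpa [wires] using this

theorem countP_gates (c : WGate n q W → Bool) :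
    P.gates.countP c = ∑ w, (P.gatesAt w).countP c := by
  unfold gates
  rw [List.countP_flatMap, (P.wires_perm.map _).sum_eq]
  exact Finset.sum_map_toList _ _

end

variable [DecidableEq W] (fq : ℕ) (m : EuclideanSpace ℝ (Fin n) → Bool)

/-- Evaluation of one wire. -/
def step (s : W → Bool) (w : W) : W → Bool :=
  Function.update s w (xor (s w) (termSum fq m (P.terms w) s))

/-- No term of `w` reads `w`, so the second evaluation adds the same bit again and it cancels. -/
theorem step_step (s : W → Bool) (w : W) : P.step fq m (P.step fq m s w) w = s := by
  have h : termSum fq m (P.terms w) (P.step fq m s w) = termSum fq m (P.terms w) s := by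
    refine termSum_congr fq m _ fun τ hτ i hi => ?_
    have : i ≠ w := fun e => P.not_reads_self w τ hτ (e ▸ hi)
    simp [step, this]
  rw [step, h]
  simp [step]

/-- The target is not read by any term, so the gates do not disturb each other's values and their
effects add up modulo two. -/
theorem runGates_pmap (w : W) (l : List (Term n q W)) (h : ∀ τ ∈ l, ¬ τ.Reads w)
    (ψ : (W → Bool) → ℂ) (s : W → Bool) :
    runGates fq m (l.pmap (fun τ h => τ.toGate w h) h) ψ s =
      ψ (Function.update s w (xor (s w) (termSum fq m l s))) := by
  induction l generalizing ψ with
  | nil => simp [termSum]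
  | cons τ l ih =>
    rw [List.pmap_cons, runGates_cons, ih, Term.apply_toGate]
    have h1 : τ.eval fq m (Function.update s w (xor (s w) (termSum fq m l s))) =
        τ.eval fq m s := by
      refine τ.eval_congr fq m fun i hi => ?_
      have : i ≠ w := fun e => h τ (List.mem_cons_self) (e ▸ hi)
      simp [this]
    rw [h1]
    simp only [Function.update_self, Function.update_idem, termSum, List.map_cons,
      List.foldr_cons, Bool.xor_assoc]
    rw [Bool.xor_comm (τ.eval fq m s)]

theorem runGates_gatesAt (w : W) (ψ : (W → Bool) → ℂ) (s : W → Bool) :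
    runGates fq m (P.gatesAt w) ψ s = ψ (P.step fq m s w) :=
  runGates_pmap fq m w _ _ ψ s

theorem apply_apply_toGate (w : W) (τ : Term n q W) (h : ¬ τ.Reads w) (ψ : (W → Bool) → ℂ) :
    (τ.toGate w h).apply fq m ((τ.toGate w h).apply fq m ψ) = ψ := by
  funext s
  rw [Term.apply_toGate, Term.apply_toGate]
  have h1 : τ.eval fq m (Function.update s w (xor (s w) (τ.eval fq m s))) = τ.eval fq m s := by
    refine τ.eval_congr fq m fun i hi => ?_
    have : i ≠ w := fun e => h (e ▸ hi)
    simp [this]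
  rw [h1]
  simp

variable [Fintype W]

/-- Evaluation of a program. -/
def eval : Equiv.Perm (W → Bool) where
  toFun s := P.wires.foldl (P.step fq m) s
  invFun s := P.wires.foldr (fun w s => P.step fq m s w) s
  left_inv s := by
    generalize P.wires = l
    induction l generalizing s with
    | nil => rfl
    | cons a l ih =>
      simp only at ih
      simp only [List.foldl_cons, List.foldr_cons, ih, step_step]
  right_inv s := by
    generalize P.wires = l
    induction l with
    | nil => rfl
    | cons a l ih =>
      simp only at ih
      simp only [List.foldl_cons, List.foldr_cons, ih, step_step]

theorem runGates_gates (ψ : (W → Bool) → ℂ) (s : W → Bool) :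
    runGates fq m P.gates ψ s = ψ ((P.eval fq m).symm s) := by
  change _ = ψ (P.wires.foldr (fun w s => P.step fq m s w) s)
  unfold gates
  generalize P.wires = l
  induction l generalizing ψ with
  | nil => rfl
  | cons a l ih =>
    rw [List.flatMap_cons, runGates_append, ih, runGates_gatesAt, List.foldr_cons]

/-- Each gate is its own inverse, so the reversed list is the inverse circuit. This is what
uncomputes the work wires of the bisection. -/
theorem runGates_gates_reverse (ψ : (W → Bool) → ℂ) (s : W → Bool) :
    runGates fq m P.gates.reverse ψ s = ψ (P.eval fq m s) := by
  have key : ∀ (l : List (WGate n q W)),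
      (∀ g ∈ l, ∀ φ : (W → Bool) → ℂ, g.apply fq m (g.apply fq m φ) = φ) → ∀ φ,
      runGates fq m l.reverse (runGates fq m l φ) = φ := by
    intro l
    induction l with
    | nil => intro _ φ; rfl
    | cons g l ih =>
      intro h φ
      rw [List.reverse_cons, runGates_append, runGates_cons fq m g l,
        ih fun g' hg' => h g' (List.mem_cons_of_mem _ hg')]
      exact h g List.mem_cons_self φ
  have h1 := key P.gates (by
    intro g hg φ
    obtain ⟨w, -, hg⟩ := List.mem_flatMap.1 hg
    obtain ⟨τ, hτ, rfl⟩ := List.mem_pmap.1 hg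
    exact apply_apply_toGate fq m w τ _ φ) (fun t => ψ (P.eval fq m t))
  have h2 : runGates fq m P.gates (fun t => ψ (P.eval fq m t)) = ψ := by
    funext t
    rw [runGates_gates]
    simp
  rw [h2] at h1
  rw [h1]

/-- A wire changes only at its own turn, and the wires that it reads have lower rank, hence are not
touched then or later. So the equation may be read entirely in the final state, and the order of
evaluation disappears from all later arguments. -/
theorem eval_apply (s : W → Bool) (w : W) :
    P.eval fq m s w = xor (s w) (termSum fq m (P.terms w) (P.eval fq m s)) := by
  have hpass : ∀ (l : List W) (s : W → Bool) (w : W), w ∉ l → l.foldl (P.step fq m) s w = s w := by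
    intro l
    induction l with
    | nil => intro s w _; rfl
    | cons a l ih =>
      intro s w hw
      rw [List.mem_cons, not_or] at hw
      rw [List.foldl_cons, ih _ _ hw.2]
      simp [step, hw.1]
  have key : ∀ (l : List W), l.Nodup → (l.Pairwise fun a b => P.rank a ≤ P.rank b) →
      ∀ (s : W → Bool), ∀ w ∈ l, l.foldl (P.step fq m) s w =
        xor (s w) (termSum fq m (P.terms w) (l.foldl (P.step fq m) s)) := by
    intro l
    induction l with
    | nil => intro _ _ s w hw; simp at hw
    | cons a l ih =>
      intro hnd hpw s w hw
      rw [List.nodup_cons] at hnd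
      rw [List.pairwise_cons] at hpw
      rw [List.foldl_cons]
      by_cases hwl : w ∈ l
      · rw [ih hnd.2 hpw.2 _ w hwl]
        have : w ≠ a := fun e => hnd.1 (e ▸ hwl)
        simp [step, this]
      · have hwa : w = a := (List.mem_cons.1 hw).resolve_right hwl
        subst hwa
        rw [hpass l _ w hwl]
        have h1 : termSum fq m (P.terms w) (l.foldl (P.step fq m) (P.step fq m s w)) =
            termSum fq m (P.terms w) s := by
          refine termSum_congr fq m _ fun τ hτ i hi => ?_
          have h2 := P.rank_lt w τ hτ i hi
          have h3 : i ∉ l := fun hil => by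
            have := hpw.1 i hil
            omega
          have h4 : i ≠ w := fun e => by
            subst e
            omega
          rw [hpass l _ i h3]
          simp [step, h4]
        rw [h1]
        simp [step]
  exact key P.wires P.nodup_wires P.pairwise_wires s w (P.mem_wires w)

end Program

/-! ### Phases -/

/-- The phase `exp (2 π i t)`. -/
def phase (t : ℝ) : ℂ := Complex.exp ((2 * Real.pi * t : ℝ) * Complex.I)

theorem phase_add (s t : ℝ) : phase (s + t) = phase s * phase t := by
  unfold phase
  rw [← Complex.exp_add]
  congr 1
  push_cast
  ring

@[simp] theorem phase_zero : phase 0 = 1 := by simp [phase]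

@[simp] theorem norm_phase (t : ℝ) : ‖phase t‖ = 1 := Complex.norm_exp_ofReal_mul_I _

theorem phase_intCast (k : ℤ) : phase k = 1 := by
  unfold phase
  rw [Complex.exp_eq_one_iff]
  exact ⟨k, by push_cast; ring⟩

theorem phase_add_intCast (t : ℝ) (k : ℤ) : phase (t + k) = phase t := by
  rw [phase_add, phase_intCast, mul_one]

theorem star_phase (t : ℝ) : star (phase t) = phase (-t) := by
  unfold phase
  rw [Complex.star_def, ← Complex.exp_conj]
  congr 1
  rw [map_mul, Complex.conj_ofReal, Complex.conj_I]
  push_cast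
  ring

theorem phase_sum {ι : Type*} (A : Finset ι) (f : ι → ℝ) :
    phase (∑ i ∈ A, f i) = ∏ i ∈ A, phase (f i) := by
  classical
  induction A using Finset.induction_on with
  | empty => simp
  | insert a A ha ih => rw [Finset.sum_insert ha, Finset.prod_insert ha, phase_add, ih]

theorem phase_half : phase (1 / 2) = -1 := by
  unfold phase
  rw [show (2 * Real.pi * (1 / 2) : ℝ) = Real.pi by ring, Complex.exp_pi_mul_I]

theorem norm_phase_sub_phase (a b : ℝ) : ‖phase a - phase b‖ = 2 * |Real.sin (Real.pi * (a - b))| := by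
  have h : phase a - phase b = phase b * (phase (a - b) - 1) := by
    rw [mul_sub, ← phase_add]
    simp
  rw [h, norm_mul, norm_phase, one_mul]
  unfold phase
  rw [mul_comm _ Complex.I, Complex.norm_exp_I_mul_ofReal_sub_one, Real.norm_eq_abs, abs_mul]
  rw [abs_of_pos (by norm_num : (0 : ℝ) < 2)]
  congr 3
  ring

/-- Uses sin² ≤ |sin|. The bound is linear in the error on purpose: only the mean of the error over
the random offset is controlled, not its mean square. -/
theorem norm_phase_sub_phase_sq_le (a b : ℝ) : ‖phase a - phase b‖ ^ 2 ≤ 4 * Real.pi * |a - b| := by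
  rw [norm_phase_sub_phase, mul_pow, sq_abs]
  have h1 : |Real.sin (Real.pi * (a - b))| ≤ Real.pi * |a - b| := by
    refine Real.abs_sin_le_abs.trans ?_
    rw [abs_mul, abs_of_pos Real.pi_pos]
  have h2 : |Real.sin (Real.pi * (a - b))| ≤ 1 := Real.abs_sin_le_one _
  have h3 := abs_nonneg (Real.sin (Real.pi * (a - b)))
  rw [← sq_abs (Real.sin _)]
  nlinarith

theorem norm_phase_sub_phase_sq_le_four (a b : ℝ) : ‖phase a - phase b‖ ^ 2 ≤ 4 := by
  rw [norm_phase_sub_phase, mul_pow, sq_abs]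
  nlinarith [Real.sin_sq_le_one (Real.pi * (a - b))]

/-- Jordan's inequality on either side of 1/2; on the far side it needs 4(1 - t) ≥ t. The range 3/4
= 1/2 + 1/4 is that of a signed frequency in [-1/2, 1/2] against a target in [-1/4, 1/4], so
closeness on the circle gives closeness on the line. -/
theorem sq_le_norm_phase_sub_phase_sq {a b : ℝ} (h : |a - b| ≤ 3 / 4) :
    (a - b) ^ 2 ≤ ‖phase a - phase b‖ ^ 2 := by
  rw [norm_phase_sub_phase, mul_pow, sq_abs]
  have hpi := Real.pi_pos
  have key : |a - b| ≤ 2 * Real.sin (Real.pi * |a - b|) := by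
    rcases le_total |a - b| (1 / 2) with h1 | h1
    · have := Real.mul_le_sin (x := Real.pi * |a - b|) (by positivity) (by nlinarith)
      have h2 : 2 / Real.pi * (Real.pi * |a - b|) = 2 * |a - b| := by field_simp
      have := abs_nonneg (a - b)
      linarith
    · have := Real.mul_le_sin (x := Real.pi - Real.pi * |a - b|) (by nlinarith) (by nlinarith)
      have h2 : 2 / Real.pi * (Real.pi - Real.pi * |a - b|) = 2 * (1 - |a - b|) := by field_simp
      rw [Real.sin_pi_sub, h2] at this
      linarith
  have h3 : Real.sin (Real.pi * (a - b)) ^ 2 = Real.sin (Real.pi * |a - b|) ^ 2 := by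
    rcases abs_choice (a - b) with h4 | h4 <;> rw [h4]
    rw [mul_neg, Real.sin_neg, neg_sq]
  rw [h3, ← sq_abs]
  have := abs_nonneg (a - b)
  nlinarith

/-! ### Phase gates, Hadamard gates and the Fourier transform -/

/-- The one-qubit phase gate. -/
def phaseU (θ : ℝ) : Matrix.unitaryGroup Bool ℂ :=
  ⟨Matrix.diagonal fun c => if c then phase θ else 1, by
    rw [Matrix.mem_unitaryGroup_iff, Matrix.star_eq_conjTranspose, Matrix.diagonal_conjTranspose,
      Matrix.diagonal_mul_diagonal, ← Matrix.diagonal_one]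
    congr 1
    funext c
    cases c
    · simp
    · simp only [Pi.star_apply, if_true]
      rw [star_phase, ← phase_add]
      simp⟩

/-- The Hadamard gate. -/
def hadamardU : Matrix.unitaryGroup Bool ℂ :=
  ⟨Matrix.of fun a c => ((Real.sqrt 2)⁻¹ : ℝ) * phase (if a && c then 1 / 2 else 0), by
    have h2 : (((Real.sqrt 2)⁻¹ : ℝ) : ℂ) * (((Real.sqrt 2)⁻¹ : ℝ) : ℂ) = 1 / 2 := by
      rw [← Complex.ofReal_mul, ← mul_inv, Real.mul_self_sqrt (by norm_num)]
      norm_num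
    rw [Matrix.mem_unitaryGroup_iff]
    have hh := phase_half
    ext a c
    rw [Matrix.mul_apply, Fintype.sum_bool]
    simp only [Matrix.star_apply, Matrix.of_apply]
    cases a <;> cases c <;>
      simp only [Bool.and_true, Bool.and_false, if_true, hh, phase_zero, star_neg, Complex.star_def,
        Complex.conj_ofReal, mul_one, mul_neg, neg_mul, neg_neg, h2,
        Bool.false_eq_true, if_false] <;> norm_num⟩

variable {n q : ℕ} {W : Type}

/-- A controlled phase, from elementary gates. -/
def controlledPhase (θ : ℝ) (a b : W) (h : a ≠ b) : List (WGate n q W) :=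
  [.single (phaseU (θ / 2)) a, .single (phaseU (θ / 2)) b, .cnot a b h,
    .single (phaseU (-(θ / 2))) b, .cnot a b h]

open Classical in
/-- The controlled phases between `a` and the wires of a list. -/
def controlledPhases (θ : W → W → ℝ) (a : W) (l : List W) : List (WGate n q W) :=
  l.flatMap fun b => if h : a ≠ b ∧ θ a b ≠ 0 then controlledPhase (θ a b) a b h.1 else []

/-- Hadamard gates on a list of wires, each followed by controlled phases with the later wires. -/
def fourierGates (θ : W → W → ℝ) : List W → List (WGate n q W)
  | [] => []
  | a :: l => .single hadamardU a :: (controlledPhases θ a l ++ fourierGates θ l)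

/-- The phase that the Fourier gates give to the transition from `s'` to `s`. -/
def fourierPhase (θ : W → W → ℝ) : List W → (W → Bool) → (W → Bool) → ℝ
  | [], _, _ => 0
  | a :: l, s, s' => (if s a && s' a then 1 / 2 else 0) +
      (l.map fun b => if s a && s' b then θ a b else 0).sum + fourierPhase θ l s s'

/-- Single-qubit phases on a list of wires. -/
def phaseGates (θ : W → ℝ) (l : List W) : List (WGate n q W) :=
  l.map fun a => .single (phaseU (θ a)) a

section

variable [DecidableEq W] (fq : ℕ) (m : EuclideanSpace ℝ (Fin n) → Bool)

theorem apply_phaseU (θ : ℝ) (a : W) (ψ : (W → Bool) → ℂ) (s : W → Bool) :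
    (WGate.single (phaseU θ) a : WGate n q W).apply fq m ψ s =
      phase (if s a then θ else 0) * ψ s := by
  simp only [WGate.apply, phaseU, Fintype.sum_bool]
  cases h : s a
  · have : Function.update s a false = s := by rw [← h, Function.update_eq_self]
    simp [this]
  · have : Function.update s a true = s := by rw [← h, Function.update_eq_self]
    simp [this]

theorem runGates_phaseGates (θ : W → ℝ) (l : List W) (ψ : (W → Bool) → ℂ) (s : W → Bool) :
    runGates (q := q) fq m (phaseGates θ l) ψ s =
      phase ((l.map fun a => if s a then θ a else 0).sum) * ψ s := by
  induction l generalizing ψ with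
  | nil => simp [phaseGates]
  | cons a l ih =>
    rw [phaseGates, List.map_cons, runGates_cons]
    refine (ih _).trans ?_
    rw [apply_phaseU, List.map_cons, List.sum_cons, phase_add]
    ring

/-- The product of two bits is half of a + b - (a xor b), so three one-qubit phases of half the
angle suffice. -/
theorem runGates_controlledPhase (θ : ℝ) (a b : W) (h : a ≠ b) (ψ : (W → Bool) → ℂ)
    (s : W → Bool) :
    runGates (q := q) fq m (controlledPhase θ a b h) ψ s =
      phase (if s a && s b then θ else 0) * ψ s := by
  simp only [controlledPhase, runGates_cons, runGates_nil]
  simp only [WGate.apply.eq_2, apply_phaseU, Function.update_self, Function.update_idem,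
    Function.update_of_ne h]
  have h1 : ∀ x y : Bool, xor (xor x y) y = x := by decide
  rw [h1, Function.update_eq_self]
  simp only [← mul_assoc, ← phase_add]
  congr 2
  cases s a <;> cases s b <;> simp

theorem runGates_controlledPhases (θ : W → W → ℝ) (a : W) (l : List W) (hl : a ∉ l)
    (ψ : (W → Bool) → ℂ) (s : W → Bool) :
    runGates (q := q) fq m (controlledPhases θ a l) ψ s =
      phase ((l.map fun b => if s a && s b then θ a b else 0).sum) * ψ s := by
  induction l generalizing ψ with
  | nil => simp [controlledPhases]
  | cons b l ih =>
    rw [List.mem_cons, not_or] at hl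
    rw [controlledPhases, List.flatMap_cons, runGates_append]
    refine (ih hl.2 _).trans ?_
    rw [List.map_cons, List.sum_cons]
    by_cases h : θ a b = 0
    · simp [h]
    · rw [dif_pos ⟨hl.1, h⟩, runGates_controlledPhase, phase_add]
      ring

theorem apply_hadamardU (a : W) (ψ : (W → Bool) → ℂ) (s : W → Bool) :
    (WGate.single hadamardU a : WGate n q W).apply fq m ψ s =
      ∑ c : Bool, ((Real.sqrt 2)⁻¹ : ℝ) * phase (if s a && c then 1 / 2 else 0) *
        ψ (Function.update s a c) := rfl

omit [DecidableEq W] in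
theorem fourierPhase_congr (θ : W → W → ℝ) (l : List W) {s t s' t' : W → Bool}
    (h : ∀ a ∈ l, s a = t a) (h' : ∀ a ∈ l, s' a = t' a) :
    fourierPhase θ l s s' = fourierPhase θ l t t' := by
  induction l with
  | nil => rfl
  | cons a l ih =>
    have h1 : ∀ b ∈ l, s b = t b := fun b hb => h b (List.mem_cons_of_mem _ hb)
    have h1' : ∀ b ∈ l, s' b = t' b := fun b hb => h' b (List.mem_cons_of_mem _ hb)
    have h2 := h a List.mem_cons_self
    have h2' := h' a List.mem_cons_self
    unfold fourierPhase
    rw [h2, h2', ih h1 h1']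
    congr 3
    exact List.map_congr_left fun b hb => by rw [h1' b hb]

/-- A sum over all states, grouped by their values off the wire `a`, with the state holding `v`
there as representative. This is the bookkeeping for one Hadamard gate. -/
theorem sum_eq_sum_update [Fintype W] (a : W) (v : Bool) (F : (W → Bool) → ℂ) :
    ∑ s, F s = ∑ s : W → Bool, if s a = v then ∑ c, F (Function.update s a c) else 0 := by
  have h1 : ∀ s : W → Bool, (if s a = v then ∑ c, F (Function.update s a c) else 0) =
      ∑ c, if s a = v then F (Function.update s a c) else 0 := by
    intro s
    split_ifs <;> simp
  have h2 : ∀ s : W → Bool, F s = ∑ c, if s a = c then F s else 0 := by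
    intro s
    simp
  rw [Finset.sum_congr rfl fun s _ => h1 s, Finset.sum_congr rfl fun s _ => h2 s,
    Finset.sum_comm, Finset.sum_comm (s := Finset.univ (α := W → Bool))]
  refine Finset.sum_congr rfl fun c _ => ?_
  rw [← Finset.sum_filter, ← Finset.sum_filter]
  refine Finset.sum_nbij' (fun s => Function.update s a v) (fun s => Function.update s a c) ?_ ?_
    ?_ ?_ ?_
  · intro s _
    simp
  · intro s _
    simp
  · intro s hs
    rw [Finset.mem_filter] at hs
    rw [Function.update_idem, ← hs.2, Function.update_eq_self]
  · intro s hs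
    rw [Finset.mem_filter] at hs
    rw [Function.update_idem, ← hs.2, Function.update_eq_self]
  · intro s hs
    rw [Finset.mem_filter] at hs
    rw [Function.update_idem, ← hs.2, Function.update_eq_self]

-- A sum over paths: each Hadamard gate on the list branches its wire once, so a transition is
-- reached by exactly one path. The phases applied after the gate on `a` see the new value of `a`
-- and the old values of the later wires.
open Classical in
theorem runGates_fourierGates [Fintype W] (θ : W → W → ℝ) (l : List W) (hl : l.Nodup)
    (ψ : (W → Bool) → ℂ) (s : W → Bool) :
    runGates (q := q) fq m (fourierGates θ l) ψ s =
      ∑ s' : W → Bool, if ∀ x, x ∉ l → s' x = s x then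
        ((Real.sqrt 2)⁻¹ : ℝ) ^ l.length * phase (fourierPhase θ l s s') * ψ s' else 0 := by
  induction l generalizing ψ with
  | nil =>
    have : ∀ s' : W → Bool, (∀ x, s' x = s x) ↔ s' = s := fun s' => funext_iff.symm
    simp [fourierGates, fourierPhase, this]
  | cons a l ih =>
    rw [List.nodup_cons] at hl
    have hne : ∀ b ∈ l, b ≠ a := fun b hb e => hl.1 (e ▸ hb)
    rw [fourierGates, runGates_cons, runGates_append, ih hl.2]
    refine Eq.trans ?_ (sum_eq_sum_update a (s a) _).symm
    refine Finset.sum_congr rfl fun s'' _ => ?_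
    by_cases h1 : ∀ x, x ∉ l → s'' x = s x
    · rw [if_pos h1, if_pos (h1 a hl.1), runGates_controlledPhases fq m θ a l hl.1,
        apply_hadamardU, Finset.mul_sum, Finset.mul_sum]
      refine Finset.sum_congr rfl fun c _ => ?_
      have h2 : ∀ x, x ∉ a :: l → Function.update s'' a c x = s x := by
        intro x hx
        rw [List.mem_cons, not_or] at hx
        rw [Function.update_of_ne hx.1, h1 x hx.2]
      rw [if_pos h2, fourierPhase, List.length_cons, h1 a hl.1, Function.update_self]
      have h3 : (l.map fun b => if s a && Function.update s'' a c b then θ a b else 0) =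
          l.map fun b => if s a && s'' b then θ a b else 0 := by
        refine List.map_congr_left fun b hb => ?_
        rw [Function.update_of_ne (hne b hb)]
      have h4 : fourierPhase θ l s (Function.update s'' a c) = fourierPhase θ l s s'' := by
        refine fourierPhase_congr θ l (fun _ _ => rfl) fun b hb => ?_
        rw [Function.update_of_ne (hne b hb)]
      rw [h3, h4, phase_add, phase_add]
      ring
    · rw [if_neg h1]
      split_ifs with h2
      · symm
        refine Finset.sum_eq_zero fun c _ => ?_
        rw [if_neg]
        intro h3
        apply h1
        intro x hx
        by_cases hxa : x = a
        · rw [hxa, h2]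
        · rw [← h3 x (by simp [hxa, hx]), Function.update_of_ne hxa]
      · rfl

end

theorem countP_isQuery_fourierGates (θ : W → W → ℝ) (l : List W) :
    (fourierGates θ l : List (WGate n q W)).countP (fun g => g.isQuery) = 0 := by
  rw [List.countP_eq_zero]
  induction l with
  | nil => simp [fourierGates]
  | cons a l ih =>
    intro g hg
    rw [fourierGates, List.mem_cons, List.mem_append] at hg
    rcases hg with rfl | hg | hg
    · simp [WGate.isQuery]
    · obtain ⟨b, -, hg⟩ := List.mem_flatMap.1 hg
      split_ifs at hg
      · simp only [controlledPhase, List.mem_cons, List.not_mem_nil, or_false] at hg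
        rcases hg with rfl | rfl | rfl | rfl | rfl <;> simp [WGate.isQuery]
      · simp at hg
    · exact ih g hg

/-- No gates are spent on zero angles, so only the number of true partners of a wire matters.
Without this the count would be quadratic in the dimension. -/
theorem length_fourierGates_le (θ : W → W → ℝ) (l : List W) (B : ℕ)
    (hB : ∀ a ∈ l, ∀ l' : List W, l'.Sublist l → ((open Classical in
      l'.filter fun b => decide (θ a b ≠ 0))).length ≤ B) :
    (fourierGates θ l : List (WGate n q W)).length ≤ l.length * (5 * B + 1) := by
  classical
  induction l with
  | nil => simp [fourierGates]
  | cons a l ih =>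
    have h1 := ih fun b hb l' hl' => hB b (List.mem_cons_of_mem _ hb) l'
      (hl'.trans (List.sublist_cons_self _ _))
    have h2 := hB a List.mem_cons_self l (List.sublist_cons_self _ _)
    have h3 : ∀ l' : List W, (controlledPhases θ a l' : List (WGate n q W)).length ≤
        5 * (l'.filter fun b => decide (θ a b ≠ 0)).length := by
      intro l'
      induction l' with
      | nil => simp [controlledPhases]
      | cons b l' ih' =>
        rw [controlledPhases, List.flatMap_cons, List.length_append]
        rw [controlledPhases] at ih'
        by_cases h : θ a b = 0
        · simpa [h] using ih'
        · rw [List.filter_cons_of_pos (by simpa using h), List.length_cons]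
          have : ((if h : a ≠ b ∧ θ a b ≠ 0 then controlledPhase (θ a b) a b h.1 else [] :
              List (WGate n q W))).length ≤ 5 := by
            split_ifs <;> simp [controlledPhase]
          omega
    have h4 := h3 l
    have h5 : 5 * (l.filter fun b => decide (θ a b ≠ 0)).length ≤ 5 * B := by
      refine Nat.mul_le_mul_left 5 (le_trans (le_of_eq ?_) h2)
      congr
    rw [fourierGates, List.length_cons, List.length_append, List.length_cons]
    have : (l.length + 1) * (5 * B + 1) = l.length * (5 * B + 1) + (5 * B + 1) := by ring
    omega

/-- If the list is ordered so that phases with earlier wires vanish, the Fourier phase is a sum over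
all pairs. -/
theorem fourierPhase_eq_sum (θ : W → W → ℝ) (l : List W) (hθ : ∀ a, θ a a = 0)
    (hl : l.Pairwise fun a b => θ b a = 0) (s s' : W → Bool) :
    fourierPhase θ l s s' = (l.map fun a => (if s a && s' a then 1 / 2 else 0) +
      (l.map fun b => if s a && s' b then θ a b else 0).sum).sum := by
  induction l with
  | nil => rfl
  | cons a l ih =>
    rw [List.pairwise_cons] at hl
    have h1 : (l.map fun c => (if s c && s' c then (1 / 2 : ℝ) else 0) +
        ((a :: l).map fun b => if s c && s' b then θ c b else 0).sum) =
        l.map fun c => (if s c && s' c then (1 / 2 : ℝ) else 0) +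
        (l.map fun b => if s c && s' b then θ c b else 0).sum := by
      refine List.map_congr_left fun c hc => ?_
      simp [hl.1 c hc]
    rw [fourierPhase, ih hl.2, List.map_cons, List.sum_cons, h1, List.map_cons, List.sum_cons]
    simp [hθ]

/-! ### The gauge of a convex body -/

section gauge

variable {n : ℕ} {K : Set (EuclideanSpace ℝ (Fin n))} {r : ℝ}

theorem absorbent_of_closedBall_subset (hr : 0 < r) (hrK : Metric.closedBall 0 r ⊆ K) :
    Absorbent ℝ K :=
  absorbent_nhds_zero (Filter.mem_of_superset (Metric.closedBall_mem_nhds 0 hr) hrK)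

theorem gauge_le_norm_div (hr : 0 < r) (hrK : Metric.closedBall 0 r ⊆ K)
    (x : EuclideanSpace ℝ (Fin n)) : gauge K x ≤ ‖x‖ / r := by
  rw [le_div_iff₀ hr, mul_comm]
  exact mul_gauge_le_norm (Metric.ball_subset_closedBall.trans hrK)

theorem gauge_le_add_norm_sub_div (hK : Convex ℝ K) (hr : 0 < r)
    (hrK : Metric.closedBall 0 r ⊆ K) (x y : EuclideanSpace ℝ (Fin n)) :
    gauge K x ≤ gauge K y + ‖x - y‖ / r := by
  have h1 := gauge_add_le hK (absorbent_of_closedBall_subset hr hrK) y (x - y)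
  rw [add_sub_cancel] at h1
  linarith [gauge_le_norm_div hr hrK (x - y)]

/-- This and the next lemma are the only way in which oracle answers are used: each answer is a
one-sided bound for the gauge, with slack δ/r from its Lipschitz constant. -/
theorem gauge_le_of_mem_neighborhood (hK : Convex ℝ K) (hr : 0 < r)
    (hrK : Metric.closedBall 0 r ⊆ K) {δ : ℝ} {x : EuclideanSpace ℝ (Fin n)}
    (hx : x ∈ neighborhood K δ) : gauge K x ≤ 1 + δ / r := by
  obtain ⟨y, hy, hxy⟩ := hx
  have h1 := gauge_le_add_norm_sub_div hK hr hrK x y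
  have h2 := gauge_le_one_of_mem hy
  have h3 : ‖x - y‖ / r ≤ δ / r := by gcongr
  linarith

theorem le_gauge_of_notMem_deepInterior (hK : Convex ℝ K) (hr : 0 < r)
    (hrK : Metric.closedBall 0 r ⊆ K) {δ : ℝ} {x : EuclideanSpace ℝ (Fin n)}
    (hx : x ∉ deepInterior K δ) : 1 - δ / r ≤ gauge K x := by
  by_contra! h
  apply hx
  intro y hy
  have h1 := gauge_le_add_norm_sub_div hK hr hrK y x
  have h2 : ‖y - x‖ / r ≤ δ / r := by
    gcongr
    rwa [Metric.mem_closedBall, dist_eq_norm] at hy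
  have h0 : (0 : EuclideanSpace ℝ (Fin n)) ∈ K := hrK (by simp [hr.le])
  apply setOfPred_gauge_lt_one_subset_self hK h0 (absorbent_of_closedBall_subset hr hrK)
  change gauge K y < 1
  linarith

/-- `f` is a subgradient of the gauge of `K` at `x`. -/
def IsSupporting (K : Set (EuclideanSpace ℝ (Fin n))) (x : EuclideanSpace ℝ (Fin n))
    (f : EuclideanSpace ℝ (Fin n) →ₗ[ℝ] ℝ) : Prop :=
  f x = gauge K x ∧ ∀ y, f y ≤ gauge K y

/-- Hahn–Banach: on the line through x the functional is prescribed by the value of the gauge, which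
dominates it since the gauge is nonnegative. At the origin the zero subspace takes the place of the
line. -/
theorem exists_isSupporting (hK : Convex ℝ K) (hr : 0 < r) (hrK : Metric.closedBall 0 r ⊆ K)
    (x : EuclideanSpace ℝ (Fin n)) : ∃ f, IsSupporting K x f := by
  have hhom : ∀ c : ℝ, 0 < c → ∀ y, gauge K (c • y) = c * gauge K y := fun c hc y =>
    gauge_smul_of_nonneg hc.le y
  have hadd := gauge_add_le hK (absorbent_of_closedBall_subset hr hrK)
  by_cases hx : x = 0
  · obtain ⟨g, -, hg⟩ := exists_extension_of_le_sublinear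
      (⊥ : EuclideanSpace ℝ (Fin n) →ₗ.[ℝ] ℝ) (gauge K) hhom hadd (by
        rintro ⟨y, hy⟩
        have hy' : y = 0 := (Submodule.mem_bot ℝ).1 hy
        subst hy'
        have : (⟨0, hy⟩ : (⊥ : EuclideanSpace ℝ (Fin n) →ₗ.[ℝ] ℝ).domain) = 0 := rfl
        rw [this, LinearPMap.map_zero]
        exact gauge_nonneg _)
    exact ⟨g, by simp [hx], hg⟩
  · obtain ⟨g, hg1, hg⟩ := exists_extension_of_le_sublinear
      (LinearPMap.mkSpanSingleton x (gauge K x) hx) (gauge K) hhom hadd (by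
        rintro ⟨y, hy⟩
        obtain ⟨c, rfl⟩ := Submodule.mem_span_singleton.1 hy
        refine (le_of_eq (LinearPMap.mkSpanSingleton'_apply x (gauge K x) _ c hy)).trans ?_
        rw [smul_eq_mul]
        rcases le_or_gt 0 c with hc | hc
        · exact (gauge_smul_of_nonneg hc x).ge
        · exact (mul_nonpos_of_nonpos_of_nonneg hc.le (gauge_nonneg _)).trans (gauge_nonneg _))
    refine ⟨g, ?_, hg⟩
    have h1 := hg1 ⟨x, Submodule.mem_span_singleton_self x⟩
    rw [LinearPMap.mkSpanSingleton_apply] at h1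
    exact h1

theorem IsSupporting.abs_apply_le {x : EuclideanSpace ℝ (Fin n)}
    {f : EuclideanSpace ℝ (Fin n) →ₗ[ℝ] ℝ} (hf : IsSupporting K x f) (hr : 0 < r)
    (hrK : Metric.closedBall 0 r ⊆ K) (v : EuclideanSpace ℝ (Fin n)) : |f v| ≤ ‖v‖ / r := by
  rw [abs_le]
  have h1 := (hf.2 v).trans (gauge_le_norm_div hr hrK v)
  have h2 := (hf.2 (-v)).trans (gauge_le_norm_div hr hrK (-v))
  rw [map_neg, norm_neg] at h2
  constructor <;> linarith

/-- The gauge is close to its linearization at `x` in the box `x + [0, D]ⁿ`, when its subgradients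
at `x` and at the points `x + n D eᵢ` are close. -/
theorem IsSupporting.gauge_sub_le (hK : Convex ℝ K) (hr : 0 < r)
    (hrK : Metric.closedBall 0 r ⊆ K) {x : EuclideanSpace ℝ (Fin n)}
    {f : EuclideanSpace ℝ (Fin n) →ₗ[ℝ] ℝ} (hf : IsSupporting K x f) (hn : 0 < n) {D : ℝ}
    (hD : 0 < D) (g : Fin n → EuclideanSpace ℝ (Fin n) →ₗ[ℝ] ℝ)
    (hg : ∀ i, IsSupporting K (x + (n * D) • EuclideanSpace.single i 1) (g i)) (d : Fin n → ℝ)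
    (hd0 : ∀ i, 0 ≤ d i) (hdD : ∀ i, d i ≤ D) :
    gauge K (x + WithLp.toLp 2 d) - gauge K x - f (WithLp.toLp 2 d) ≤
      D * ∑ i, (g i (EuclideanSpace.single i 1) - f (EuclideanSpace.single i 1)) := by
  have habs := absorbent_of_closedBall_subset hr hrK
  have hn' : (0 : ℝ) < n := by exact_mod_cast hn
  set e : Fin n → EuclideanSpace ℝ (Fin n) := fun i => EuclideanSpace.single i 1 with he
  have hdsum : (WithLp.toLp 2 d : EuclideanSpace ℝ (Fin n)) = ∑ i, d i • e i := by
    ext j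
    simp [he, Finset.sum_apply, Pi.single_apply]
  have hfd : f (WithLp.toLp 2 d) = ∑ i, d i * f (e i) := by
    rw [hdsum, map_sum]
    simp
  -- The point is the average of n points displaced along single axes, each by n times its
  -- coordinate. By convexity, values on the axes control values in the whole box.
  have hxd : x + WithLp.toLp 2 d = ∑ i, (1 / (n : ℝ)) • (x + (n * d i) • e i) := by
    simp_rw [smul_add, smul_smul, Finset.sum_add_distrib, Finset.sum_const, Finset.card_univ,
      Fintype.card_fin, hdsum]
    congr 1
    · rw [← Nat.cast_smul_eq_nsmul ℝ, smul_smul]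
      field_simp
      simp
    · refine Finset.sum_congr rfl fun i _ => ?_
      congr 1
      field_simp
  -- The subgradient inequality of `g i` at the end of the segment, read backwards at x.
  have hend : ∀ i, gauge K (x + (n * D) • e i) ≤ gauge K x + n * D * g i (e i) := by
    intro i
    rw [← (hg i).1, map_add, map_smul, smul_eq_mul]
    linarith [(hg i).2 x]
  have hmono : ∀ i, f (e i) ≤ g i (e i) := by
    intro i
    have h1 := hend i
    have h2 := hf.2 (x + (n * D) • e i)
    rw [map_add, map_smul, smul_eq_mul, hf.1] at h2
    have h3 : 0 < n * D := by positivity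
    nlinarith
  -- Convexity along the segment from x to its end point carries the bound to the interior.
  have hmid : ∀ i, gauge K (x + (n * d i) • e i) ≤ gauge K x + n * d i * g i (e i) := by
    intro i
    have h1 : x + (n * d i) • e i = (1 - d i / D) • x + (d i / D) • (x + (n * D) • e i) := by
      rw [smul_add, smul_smul, ← add_assoc, ← add_smul, sub_add_cancel, one_smul]
      congr 2
      field_simp
    have h2 : 0 ≤ d i / D := div_nonneg (hd0 i) hD.le
    have h3 : d i / D ≤ 1 := (div_le_one hD).2 (hdD i)
    have h4 := gauge_add_le hK habs ((1 - d i / D) • x) ((d i / D) • (x + (n * D) • e i))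
    rw [← h1, gauge_smul_of_nonneg (by linarith), gauge_smul_of_nonneg h2, smul_eq_mul,
      smul_eq_mul] at h4
    have h5 := mul_le_mul_of_nonneg_left (hend i) h2
    have h6 : d i / D * (n * D * g i (e i)) = n * d i * g i (e i) := by field_simp
    nlinarith
  have hsum : gauge K (x + WithLp.toLp 2 d) ≤ gauge K x + ∑ i, d i * g i (e i) := by
    rw [hxd]
    refine (gauge_sum_le hK habs _ _).trans ?_
    have h1 : ∀ i, gauge K ((1 / (n : ℝ)) • (x + (n * d i) • e i)) ≤
        1 / n * gauge K x + d i * g i (e i) := by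
      intro i
      rw [gauge_smul_of_nonneg (by positivity), smul_eq_mul]
      have h2 := mul_le_mul_of_nonneg_left (hmid i) (by positivity : 0 ≤ 1 / (n : ℝ))
      have h3 : 1 / (n : ℝ) * (n * d i * g i (e i)) = d i * g i (e i) := by field_simp
      linarith
    refine (Finset.sum_le_sum fun i _ => h1 i).trans (le_of_eq ?_)
    rw [Finset.sum_add_distrib, Finset.sum_const, Finset.card_univ, Fintype.card_fin, nsmul_eq_mul]
    field_simp
  rw [hfd, Finset.mul_sum]
  have h7 : ∑ i, d i * (g i (e i) - f (e i)) ≤ ∑ i, D * (g i (e i) - f (e i)) :=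
    Finset.sum_le_sum fun i _ => mul_le_mul_of_nonneg_right (hdD i) (sub_nonneg.2 (hmono i))
  simp only [mul_sub, Finset.sum_sub_distrib] at h7 ⊢
  linarith

theorem IsSupporting.sub_nonneg {x : EuclideanSpace ℝ (Fin n)}
    {f : EuclideanSpace ℝ (Fin n) →ₗ[ℝ] ℝ} (hf : IsSupporting K x f)
    (v : EuclideanSpace ℝ (Fin n)) : 0 ≤ gauge K (x + v) - gauge K x - f v := by
  have := hf.2 (x + v)
  rw [map_add, hf.1] at this
  linarith

end gauge

/-! ### Averages of shifts, reciprocals, bisection and separating directions -/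

/-- The sum of a shifted difference of a bounded function over a box telescopes. -/
theorem sum_shift_sub_le {n M : ℕ} (V : (Fin n → ℕ) → ℝ) (B : ℝ) (hV : ∀ z, |V z| ≤ B)
    (i : Fin n) (a : ℕ) :
    (M : ℝ) * ∑ z : Fin n → Fin M,
      (V (Function.update (fun j => (z j : ℕ)) i (z i + a)) - V fun j => (z j : ℕ)) ≤
      (M : ℝ) ^ n * (2 * a * B) := by
  -- On a line the sum is free of M: a shift by `a` is a composition of `a` unit shifts, and each of
  -- them telescopes to a difference of two values.
  have h1 : ∀ (u : ℕ → ℝ), (∀ k, |u k| ≤ B) → ∀ a : ℕ,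
      ∑ k ∈ Finset.range M, (u (k + a) - u k) ≤ 2 * a * B := by
    intro u hu a
    induction a with
    | zero => simp
    | succ a ih =>
      have h2 : ∑ k ∈ Finset.range M, (u (k + (a + 1)) - u k) =
          ∑ k ∈ Finset.range M, (u (k + 1 + a) - u (k + a)) +
            ∑ k ∈ Finset.range M, (u (k + a) - u k) := by
        rw [← Finset.sum_add_distrib]
        refine Finset.sum_congr rfl fun k _ => ?_
        rw [show k + (a + 1) = k + 1 + a by ring]
        ring
      rw [h2, Finset.sum_range_sub fun k => u (k + a)]
      have h3 := abs_le.1 (hu (M + a))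
      have h4 := abs_le.1 (hu (0 + a))
      push_cast
      nlinarith
  set F : (Fin n → Fin M) → ℝ := fun z =>
    V (Function.update (fun j => (z j : ℕ)) i (z i + a)) - V fun j => (z j : ℕ) with hF
  -- Overwriting coordinate i by every k counts each point M times, and splits the sum into lines in
  -- direction i.
  have h2 : (M : ℝ) * ∑ z, F z = ∑ z : Fin n → Fin M, ∑ k : Fin M, F (Function.update z i k) := by
    have hsw : ∀ k : Fin M, ∀ z : Fin n → Fin M, F (Function.update z i k) =
        ∑ l : Fin M, if z i = l then F (Function.update z i k) else 0 := by
      intro k z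
      simp
    rw [Finset.sum_comm]
    have h3 : ∀ k : Fin M, ∑ z : Fin n → Fin M, F (Function.update z i k) =
        ∑ l : Fin M, ∑ z : Fin n → Fin M, if z i = k then F z else 0 := by
      intro k
      rw [Finset.sum_congr rfl fun z _ => hsw k z, Finset.sum_comm]
      refine Finset.sum_congr rfl fun l _ => ?_
      rw [← Finset.sum_filter, ← Finset.sum_filter]
      refine Finset.sum_nbij' (fun z => Function.update z i k) (fun z => Function.update z i l)
        ?_ ?_ ?_ ?_ ?_
      · intro z _
        simp
      · intro z _
        simp
      · intro z hz
        rw [Finset.mem_filter] at hz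
        rw [Function.update_idem, ← hz.2, Function.update_eq_self]
      · intro z hz
        rw [Finset.mem_filter] at hz
        rw [Function.update_idem, ← hz.2, Function.update_eq_self]
      · intro z hz
        rfl
    rw [Finset.sum_congr rfl fun k _ => h3 k]
    simp only [Finset.sum_const, Finset.card_univ, Fintype.card_fin, nsmul_eq_mul]
    rw [← Finset.mul_sum, Finset.sum_comm]
    simp
  rw [h2]
  have h4 : ∀ z : Fin n → Fin M, ∑ k : Fin M, F (Function.update z i k) ≤ 2 * a * B := by
    intro z
    refine le_trans (le_of_eq ?_) (h1 (fun k => V (Function.update (fun j => (z j : ℕ)) i k))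
      (fun k => hV _) a)
    rw [Finset.sum_range]
    refine Finset.sum_congr rfl fun k _ => ?_
    have h5 : (fun j => ((Function.update z i k j : Fin M) : ℕ)) =
        Function.update (fun j => (z j : ℕ)) i (k : ℕ) := by
      funext j
      by_cases hj : j = i
      · subst hj
        simp
      · simp [hj]
    simp only [hF, h5, Function.update_idem, Function.update_self]
  refine (Finset.sum_le_sum fun z _ => h4 z).trans (le_of_eq ?_)
  rw [Finset.sum_const, Finset.card_univ, Fintype.card_fun, Fintype.card_fin, Fintype.card_fin,
    nsmul_eq_mul]
  push_cast
  ring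

/-- Second-order estimate for the reciprocal. -/
theorem abs_inv_sub_inv_add_le {u v w : ℝ} (hu : 1 / 2 ≤ u) (hv : 1 / 2 ≤ v) (B : ℝ)
    (h0 : 0 ≤ v - u - w) (hB : v - u - w ≤ B) :
    |v⁻¹ - u⁻¹ + w / u ^ 2| ≤ 4 * B + 8 * (v - u) ^ 2 := by
  have hu0 : 0 < u := by linarith
  have hv0 : 0 < v := by linarith
  -- An exact identity: the error is the curvature of the reciprocal minus the deviation of v from
  -- its linearization u + w.
  have h1 : v⁻¹ - u⁻¹ + w / u ^ 2 = (v - u) ^ 2 / (u ^ 2 * v) - (v - u - w) / u ^ 2 := by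
    field_simp
    ring
  have h2 : (v - u) ^ 2 / (u ^ 2 * v) ≤ 8 * (v - u) ^ 2 := by
    rw [div_le_iff₀ (by positivity)]
    have : 1 / 8 ≤ u ^ 2 * v := by nlinarith [sq_nonneg (u - 1 / 2)]
    nlinarith [sq_nonneg (v - u)]
  have h3 : (v - u - w) / u ^ 2 ≤ 4 * (v - u - w) := by
    rw [div_le_iff₀ (by positivity)]
    have : 1 / 4 ≤ u ^ 2 := by nlinarith
    nlinarith
  have h4 : 0 ≤ (v - u) ^ 2 / (u ^ 2 * v) := by positivity
  have h5 : 0 ≤ (v - u - w) / u ^ 2 := div_nonneg h0 (by positivity)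
  rw [h1, abs_le]
  constructor <;> nlinarith [sq_nonneg (v - u)]

/-- Correctness of the binary search for the reciprocal of the gauge with a membership oracle. -/
theorem abs_search_sub_inv_gauge_le {n : ℕ} {K : Set (EuclideanSpace ℝ (Fin n))} {r δ : ℝ}
    (hK : Convex ℝ K) (hr : 0 < r) (hrK : Metric.closedBall 0 r ⊆ K) (hδ : 0 ≤ δ)
    {m : EuclideanSpace ℝ (Fin n) → Bool} (hm : IsMembershipOracle K δ m)
    (x : EuclideanSpace ℝ (Fin n)) (hx : 1 / 2 ≤ gauge K x) (a : ℕ → Bool) (y : ℕ → ℝ)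
    (hy0 : y 0 = 0) (hy : ∀ k, y (k + 1) = y k + if a k then (1 / 2) ^ k else 0)
    (T : ℕ) (ha : ∀ k < T, a k = m ((y k + (1 / 2) ^ k) • x)) :
    |y T - (gauge K x)⁻¹| ≤ 2 * (δ / r) + 2 * (1 / 2) ^ T := by
  have hx0 : 0 < gauge K x := by linarith
  have hdr : 0 ≤ δ / r := div_nonneg hδ hr.le
  -- The invariant of the bisection: the reciprocal lies in [y, y + 2·2^(-k)] up to the error δ/r.
  -- The oracle errors do not accumulate, because every bound comes from a single query. At the
  -- start the interval is [0, 2], which is why the gauge must be at least 1/2.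
  have key : ∀ k ≤ T, 0 ≤ y k ∧ y k * gauge K x ≤ 1 + δ / r ∧
      1 - δ / r ≤ (y k + 2 * (1 / 2) ^ k) * gauge K x := by
    intro k
    induction k with
    | zero =>
      intro _
      rw [hy0]
      refine ⟨le_rfl, by linarith, ?_⟩
      norm_num
      linarith
    | succ k ih =>
      intro hk
      obtain ⟨h0, h1, h2⟩ := ih (by omega)
      have hpow : (0 : ℝ) < (1 / 2) ^ k := by positivity
      have hak := ha k (by omega)
      have hg : gauge K ((y k + (1 / 2) ^ k) • x) = (y k + (1 / 2) ^ k) * gauge K x :=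
        gauge_smul_of_nonneg (by positivity) x
      rw [hy, pow_succ]
      rcases h : a k with _ | _
      · have h3 := le_gauge_of_notMem_deepInterior hK hr hrK ((hm _).2 (hak.symm.trans h))
        rw [hg] at h3
        simp only [Bool.false_eq_true, if_false]
        refine ⟨by linarith, by linarith, ?_⟩
        linarith
      · have h3 := gauge_le_of_mem_neighborhood hK hr hrK ((hm _).1 (hak.symm.trans h))
        rw [hg] at h3
        simp only [if_true]
        refine ⟨by positivity, by linarith, ?_⟩
        linarith
  obtain ⟨-, h1, h2⟩ := key T le_rfl
  have h3 : (gauge K x)⁻¹ ≤ 2 := by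
    rw [inv_le_comm₀ hx0 (by norm_num)]
    linarith
  have h4 : y T ≤ (1 + δ / r) * (gauge K x)⁻¹ := by rwa [← div_eq_mul_inv, le_div_iff₀ hx0]
  have h5 : (1 - δ / r) * (gauge K x)⁻¹ ≤ y T + 2 * (1 / 2) ^ T := by
    rwa [← div_eq_mul_inv, div_le_iff₀ hx0]
  have h6 := mul_le_mul_of_nonneg_left h3 hdr
  have h7 : (0 : ℝ) < (1 / 2) ^ T := by positivity
  rw [abs_le]
  constructor <;> linarith

theorem deepInterior_subset {n : ℕ} (K : Set (EuclideanSpace ℝ (Fin n))) {η : ℝ} (hη : 0 ≤ η) :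
    deepInterior K η ⊆ K := fun _ hx => hx (Metric.mem_closedBall_self hη)

theorem isSeparatingDirection_of_forall {n : ℕ} {K : Set (EuclideanSpace ℝ (Fin n))} {η : ℝ}
    {p c : EuclideanSpace ℝ (Fin n)} (hc : c ≠ 0)
    (h : ∀ y ∈ deepInterior K η, inner ℝ c (p - y) ≤ η * ‖c‖) :
    IsSeparatingDirection K η p (‖c‖⁻¹ • c) := by
  have hc' : 0 < ‖c‖ := norm_pos_iff.2 hc
  refine ⟨by rw [norm_smul, norm_inv, norm_norm, inv_mul_cancel₀ hc'.ne'], fun y hy => ?_⟩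
  have h1 := h y hy
  rw [inner_sub_right] at h1
  rw [real_inner_smul_left, real_inner_smul_left]
  have h2 : ‖c‖⁻¹ * (inner ℝ c p - inner ℝ c y) ≤ η := by
    rw [inv_mul_le_iff₀ hc']
    linarith
  linarith

/-- A vector close to a negative multiple of a subgradient near `p` separates `p` from `K`. -/
theorem IsSupporting.isSeparatingDirection {n : ℕ} {K : Set (EuclideanSpace ℝ (Fin n))}
    {r R η : ℝ} (hr : 0 < r) (hrK : Metric.closedBall 0 r ⊆ K) (hKR : K ⊆ Metric.closedBall 0 R)
    (hη : 0 ≤ η) {x : EuclideanSpace ℝ (Fin n)} {f : EuclideanSpace ℝ (Fin n) →ₗ[ℝ] ℝ}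
    (hf : IsSupporting K x f) (hx : 1 / 2 ≤ gauge K x) {p c : EuclideanSpace ℝ (Fin n)}
    (hc : c ≠ 0) {α β ε X P : ℝ} (hα : 0 < α)
    (hcf : ‖c - WithLp.toLp 2 fun i => -α * f (EuclideanSpace.single i 1)‖ ≤ ε)
    (hβ : 1 - gauge K x + ‖p - x‖ / r ≤ β) (hX : ‖x‖ ≤ X) (hX0 : 0 < X) (hP : ‖p‖ ≤ P)
    (hmain : α * β + ε * (P + R + η) ≤ η * (α / (2 * X))) :
    IsSeparatingDirection K η p (‖c‖⁻¹ • c) := by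
  set ω : EuclideanSpace ℝ (Fin n) :=
    WithLp.toLp 2 fun i => -α * f (EuclideanSpace.single i 1) with hω
  have hinner : ∀ v : EuclideanSpace ℝ (Fin n), inner ℝ ω v = -α * f v := by
    intro v
    have hv : v = ∑ i, v i • (EuclideanSpace.single i 1 : EuclideanSpace ℝ (Fin n)) := by
      ext j
      simp [Finset.sum_apply, Pi.single_apply]
    conv_rhs => rw [hv, map_sum]
    simp only [map_smul, smul_eq_mul, Finset.mul_sum]
    simp only [PiLp.inner_apply, hω]
    refine Finset.sum_congr rfl fun i _ => ?_
    simp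
    ring
  have hε : 0 ≤ ε := (norm_nonneg _).trans hcf
  refine isSeparatingDirection_of_forall hc fun y hy => ?_
  have hyK := deepInterior_subset K hη hy
  have h1 : inner ℝ ω (p - y) ≤ α * β := by
    rw [hinner, map_sub]
    have h2 := (hf.2 y).trans (gauge_le_one_of_mem hyK)
    have h3 : f p = f x + f (p - x) := by rw [← map_add, add_sub_cancel]
    have h4 := (_root_.abs_le.1 (hf.abs_apply_le hr hrK (p - x))).1
    rw [hf.1] at h3
    nlinarith
  have hyR : ‖y‖ ≤ R := by simpa using hKR hyK
  have h5 : inner ℝ (c - ω) (p - y) ≤ ε * (P + R) := by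
    refine (real_inner_le_norm _ _).trans ?_
    have : ‖p - y‖ ≤ P + R := (norm_sub_le _ _).trans (by linarith)
    exact mul_le_mul hcf this (norm_nonneg _) hε
  have h6 : inner ℝ c (p - y) = inner ℝ ω (p - y) + inner ℝ (c - ω) (p - y) := by
    rw [← inner_add_left, add_sub_cancel]
  -- The subgradient cannot be short, as it takes a value of at least 1/2 at x. This is needed
  -- because the error is measured relative to the norm of the output vector.
  have h7 : α / (2 * X) ≤ ‖ω‖ := by
    rw [div_le_iff₀ (by positivity)]
    have h8 := abs_real_inner_le_norm ω x
    rw [hinner, hf.1, abs_mul, abs_neg, abs_of_pos hα, abs_of_pos (by linarith)] at h8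
    have h9 : ‖ω‖ * ‖x‖ ≤ ‖ω‖ * X := by gcongr
    nlinarith
  have h10 : ‖ω‖ - ε ≤ ‖c‖ := by
    have := norm_sub_norm_le ω c
    rw [norm_sub_rev] at this
    linarith
  rw [h6]
  nlinarith [mul_le_mul_of_nonneg_left h7 hη, mul_le_mul_of_nonneg_left h10 hη]

/-! ### Fourier analysis on `(ℤ/N)ⁿ` -/

section fourier

variable {n N : ℕ} [NeZero N]

/-- The discrete Fourier transform on `(ℤ/N)ⁿ`. -/
def dft (Φ : (Fin n → ZMod N) → ℂ) (y : Fin n → ZMod N) : ℂ :=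
  ∑ x, Φ x * ZMod.stdAddChar (-∑ i, x i * y i)

theorem map_sum_eq_prod_stdAddChar {ι : Type*} (A : Finset ι) (f : ι → ZMod N) :
    (ZMod.stdAddChar (∑ i ∈ A, f i) : ℂ) = ∏ i ∈ A, (ZMod.stdAddChar (f i) : ℂ) := by
  classical
  induction A using Finset.induction_on with
  | empty => simp
  | insert a A ha ih =>
    rw [Finset.sum_insert ha, Finset.prod_insert ha, AddChar.map_add_eq_mul, ih]

/-- Orthogonality of characters: the sum factors over the coordinates, and a factor with nonzero
frequency vanishes. -/
theorem sum_stdAddChar_dot (d : Fin n → ZMod N) :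
    ∑ y : Fin n → ZMod N, (ZMod.stdAddChar (∑ i, d i * y i) : ℂ) =
      if d = 0 then (N : ℂ) ^ n else 0 := by
  have h1 : ∀ y : Fin n → ZMod N, (ZMod.stdAddChar (∑ i, d i * y i) : ℂ) =
      ∏ i, (ZMod.stdAddChar (y i * d i) : ℂ) := by
    intro y
    rw [map_sum_eq_prod_stdAddChar]
    simp only [mul_comm]
  rw [Finset.sum_congr rfl fun y _ => h1 y]
  have h2 := (Fintype.piFinset_univ (α := Fin n) (β := fun _ => ZMod N))
  have h3 := Finset.prod_univ_sum (fun _ : Fin n => (Finset.univ : Finset (ZMod N)))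
    (fun i a => (ZMod.stdAddChar (a * d i) : ℂ))
  rw [h2] at h3
  rw [← h3]
  have h4 : ∀ i, ∑ a : ZMod N, (ZMod.stdAddChar (a * d i) : ℂ) = if d i = 0 then (N : ℂ) else 0 := by
    intro i
    have := AddChar.sum_mulShift (d i) (ZMod.isPrimitive_stdAddChar N)
    rw [ZMod.card] at this
    rw [this]
    split_ifs <;> simp
  rw [Finset.prod_congr rfl fun i _ => h4 i]
  split_ifs with hd
  · subst hd
    simp
  · obtain ⟨i, hi⟩ := Function.ne_iff.1 hd
    exact Finset.prod_eq_zero (Finset.mem_univ i) (if_neg hi)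

theorem norm_stdAddChar (a : ZMod N) : ‖(ZMod.stdAddChar a : ℂ)‖ = 1 := by
  rw [ZMod.stdAddChar_apply]
  exact Circle.norm_coe _

theorem star_stdAddChar (a : ZMod N) :
    (starRingEnd ℂ) (ZMod.stdAddChar a : ℂ) = ZMod.stdAddChar (-a) := by
  rw [AddChar.map_neg_eq_inv, Complex.inv_eq_conj (norm_stdAddChar a)]

theorem sum_norm_dft_sq (Φ : (Fin n → ZMod N) → ℂ) :
    ∑ y, ‖dft Φ y‖ ^ 2 = (N : ℝ) ^ n * ∑ x, ‖Φ x‖ ^ 2 := by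
  have h0 : ∀ z : ℂ, ((‖z‖ ^ 2 : ℝ) : ℂ) = z * (starRingEnd ℂ) z := by
    intro z
    rw [Complex.mul_conj, Complex.normSq_eq_norm_sq]
  have h1 : ((∑ y, ‖dft Φ y‖ ^ 2 : ℝ) : ℂ) = ((N : ℝ) ^ n * ∑ x, ‖Φ x‖ ^ 2 : ℝ) := by
    push_cast
    have h2 : ∀ y, ((‖dft Φ y‖ : ℂ)) ^ 2 = ∑ x, ∑ x', Φ x * (starRingEnd ℂ) (Φ x') *
        ZMod.stdAddChar (∑ i, (x' - x) i * y i) := by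
      intro y
      have := h0 (dft Φ y)
      push_cast at this
      rw [this, dft, map_sum, Finset.sum_mul_sum]
      refine Finset.sum_congr rfl fun x _ => Finset.sum_congr rfl fun x' _ => ?_
      rw [map_mul, star_stdAddChar, neg_neg]
      have h3 : (∑ i, (x' - x) i * y i) = (-∑ i, x i * y i) + ∑ i, x' i * y i := by
        simp only [Pi.sub_apply, sub_mul, Finset.sum_sub_distrib]
        ring
      rw [h3, AddChar.map_add_eq_mul]
      ring
    rw [Finset.sum_congr rfl fun y _ => h2 y, Finset.sum_comm, Finset.mul_sum]
    refine Finset.sum_congr rfl fun x _ => ?_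
    rw [Finset.sum_comm]
    have h4 : ∀ x', ∑ y : Fin n → ZMod N, Φ x * (starRingEnd ℂ) (Φ x') *
        ZMod.stdAddChar (∑ i, (x' - x) i * y i) =
        if x' = x then (N : ℂ) ^ n * (Φ x * (starRingEnd ℂ) (Φ x)) else 0 := by
      intro x'
      rw [← Finset.mul_sum, sum_stdAddChar_dot]
      by_cases h : x' = x
      · subst h
        simp
        ring
      · rw [if_neg h, if_neg (by rwa [sub_eq_zero]), mul_zero]
    rw [Finset.sum_congr rfl fun x' _ => h4 x']
    have := h0 (Φ x)
    push_cast at this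
    simp [this]
  exact_mod_cast h1

/-- A translation becomes multiplication by a character, so the twisted difference of Φ becomes
multiplication by the distance of that character from ζ. -/
theorem dft_shift_sub (Φ : (Fin n → ZMod N) → ℂ) (i : Fin n) (ζ : ℂ) (y : Fin n → ZMod N) :
    dft (fun x => Φ (x + Pi.single i 1) - ζ * Φ x) y =
      (ZMod.stdAddChar (y i) - ζ) * dft Φ y := by
  unfold dft
  simp only [sub_mul, Finset.sum_sub_distrib, mul_assoc, ← Finset.mul_sum]
  congr 1
  rw [Finset.mul_sum]
  refine Fintype.sum_equiv (Equiv.addRight (Pi.single i 1)) _ _ fun x => ?_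
  have h1 : ∑ j, (x + Pi.single i 1 : Fin n → ZMod N) j * y j = ∑ j, x j * y j + y i := by
    simp only [Pi.add_apply, add_mul, Finset.sum_add_distrib]
    congr 1
    simp [Pi.single_apply]
  rw [Equiv.coe_addRight, h1, neg_add, AddChar.map_add_eq_mul, mul_left_comm]
  congr 1
  rw [mul_left_comm, ← AddChar.map_add_eq_mul]
  simp

/-- Parseval for the twisted difference. It turns the second moment of the measured frequency into
an average of local increments. -/
theorem sum_norm_dft_sq_mul (Φ : (Fin n → ZMod N) → ℂ) (i : Fin n) (ζ : ℂ) :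
    ∑ y, ‖dft Φ y‖ ^ 2 * ‖(ZMod.stdAddChar (y i) : ℂ) - ζ‖ ^ 2 =
      (N : ℝ) ^ n * ∑ x, ‖Φ (x + Pi.single i 1) - ζ * Φ x‖ ^ 2 := by
  rw [← sum_norm_dft_sq]
  refine Finset.sum_congr rfl fun y _ => ?_
  rw [dft_shift_sub, norm_mul, mul_pow]
  ring

theorem stdAddChar_eq_phase (k : ℤ) : (ZMod.stdAddChar (k : ZMod N) : ℂ) = phase (k / N) := by
  rw [ZMod.stdAddChar_coe]
  unfold phase
  congr 1
  push_cast
  ring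

theorem card_coordinate_eq (i : Fin n) (a : ZMod N) :
    (N : ℝ) * (Finset.univ.filter fun x : Fin n → ZMod N => x i = a).card = (N : ℝ) ^ n := by
  have h : ∀ c : ZMod N, (Finset.univ.filter fun x : Fin n → ZMod N => x i = c).card =
      (Finset.univ.filter fun x : Fin n → ZMod N => x i = a).card := by
    intro c
    refine Finset.card_bij' (fun x _ => Function.update x i a) (fun x _ => Function.update x i c)
      ?_ ?_ ?_ ?_
    · intro x _
      simp
    · intro x _
      simp
    · intro x hx
      rw [Finset.mem_filter] at hx
      rw [Function.update_idem, ← hx.2, Function.update_eq_self]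
    · intro x hx
      rw [Finset.mem_filter] at hx
      rw [Function.update_idem, ← hx.2, Function.update_eq_self]
  have h2 := Finset.card_eq_sum_card_fiberwise (f := fun x : Fin n → ZMod N => x i)
    (s := Finset.univ) (t := Finset.univ) (fun _ _ => Finset.mem_coe.2 (Finset.mem_univ _))
  rw [Finset.sum_congr rfl fun c _ => h c] at h2
  simp only [Finset.card_univ, Fintype.card_fun, ZMod.card, Fintype.card_fin, Finset.sum_const,
    smul_eq_mul] at h2
  exact_mod_cast h2.symm

/-- The frequency statistics of a function `exp (2 π i A(x))` whose phase `A` has nearly constant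
differences. -/
theorem sum_dft_phase_le (A : (Fin n → ℕ) → ℝ) (ω : Fin n → ℝ) (B : ℝ)
    (hB : 0 ≤ B) (hA : ∀ (i : Fin n) (x : Fin n → ℕ), (∀ j, x j < N) → x i + 1 < N →
      |A (Function.update x i (x i + 1)) - A x - ω i| ≤ B) :
    ∑ y, ‖dft (fun x : Fin n → ZMod N => phase (A fun i => (x i).val)) y‖ ^ 2 *
      ∑ i, ‖(ZMod.stdAddChar (y i) : ℂ) - phase (ω i)‖ ^ 2 ≤
      (N : ℝ) ^ (2 * n) * (n * (4 * Real.pi * B + 4 / N)) := by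
  have hN : (0 : ℝ) < N := by exact_mod_cast Nat.pos_of_ne_zero (NeZero.ne N)
  set Φ : (Fin n → ZMod N) → ℂ := fun x => phase (A fun i => (x i).val) with hΦ
  have hi : ∀ i, ∑ y, ‖dft Φ y‖ ^ 2 * ‖(ZMod.stdAddChar (y i) : ℂ) - phase (ω i)‖ ^ 2 ≤
      (N : ℝ) ^ (2 * n) * (4 * Real.pi * B + 4 / N) := by
    intro i
    rw [sum_norm_dft_sq_mul]
    -- At the last point of a line the cyclic shift wraps around and only the trivial bound 4 holds.
    -- These points are a fraction 1/N of the grid, which is the source of the summand 4/N.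
    have hterm : ∀ x : Fin n → ZMod N, ‖Φ (x + Pi.single i 1) - phase (ω i) * Φ x‖ ^ 2 ≤
        4 * Real.pi * B + if x i = -1 then 4 else 0 := by
      intro x
      simp only [hΦ]
      rw [← phase_add]
      by_cases hx : x i = -1
      · rw [if_pos hx]
        refine (norm_phase_sub_phase_sq_le_four _ _).trans ?_
        have := Real.pi_pos
        have : 0 ≤ 4 * Real.pi * B := by positivity
        linarith
      · have hlt : (x i).val + 1 < N := by
          have h1 := ZMod.val_lt (x i)
          rcases Nat.lt_or_ge ((x i).val + 1) N with h | h
          · exact h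
          · exfalso
            apply hx
            have h2 : (x i).val + 1 = N := by omega
            have h3 : ((((x i).val + 1 : ℕ)) : ZMod N) = 0 := by
              rw [h2]
              simp
            push_cast at h3
            rw [ZMod.natCast_zmod_val] at h3
            exact eq_neg_of_add_eq_zero_left h3
        have h4 : (fun j => ((x + Pi.single i 1 : Fin n → ZMod N) j).val) =
            Function.update (fun j => (x j).val) i ((x i).val + 1) := by
          funext j
          by_cases hj : j = i
          · subst hj
            simp only [Pi.add_apply, Pi.single_eq_same, Function.update_self]
            have : (1 : ZMod N) = ((1 : ℕ) : ZMod N) := by simp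
            rw [← ZMod.natCast_zmod_val (x j), this, ← Nat.cast_add, ZMod.val_natCast,
              Nat.mod_eq_of_lt]
            · rw [ZMod.natCast_zmod_val]
            · exact hlt
          · simp [hj]
        rw [if_neg hx, add_zero, h4]
        refine (norm_phase_sub_phase_sq_le _ _).trans ?_
        have h5 := (hA i (fun j => (x j).val) (fun j => ZMod.val_lt _) hlt)
        have := Real.pi_pos
        refine mul_le_mul_of_nonneg_left (le_trans (le_of_eq ?_) h5) (by positivity)
        congr 1
        ring
    have h6 : ∑ x, ‖Φ (x + Pi.single i 1) - phase (ω i) * Φ x‖ ^ 2 ≤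
        (N : ℝ) ^ n * (4 * Real.pi * B + 4 / N) := by
      refine (Finset.sum_le_sum fun x _ => hterm x).trans (le_of_eq ?_)
      rw [Finset.sum_add_distrib, Finset.sum_const, ← Finset.sum_filter, Finset.sum_const,
        Finset.card_univ, Fintype.card_fun, ZMod.card, Fintype.card_fin, nsmul_eq_mul,
        nsmul_eq_mul, ← card_coordinate_eq i (-1)]
      push_cast
      rw [← card_coordinate_eq i (-1)]
      field_simp
    refine (mul_le_mul_of_nonneg_left h6 (by positivity)).trans (le_of_eq ?_)
    ring
  simp only [Finset.mul_sum]
  rw [Finset.sum_comm]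
  refine (Finset.sum_le_sum fun i _ => hi i).trans (le_of_eq ?_)
  rw [Finset.sum_const, Finset.card_univ, Fintype.card_fin, nsmul_eq_mul]
  ring

end fourier

/-! ### Binary arithmetic -/

/-- The number with binary digits `e 0, …, e (D - 1)`. -/
def unsignedVal (e : ℕ → Bool) (D : ℕ) : ℤ := ∑ j ∈ Finset.range D, if e j then 2 ^ j else 0

/-- The number with two's-complement digits `e 0, …, e D`, of which `e D` is the sign. -/
def signedVal (e : ℕ → Bool) (D : ℕ) : ℤ := unsignedVal e D - if e D then 2 ^ D else 0

theorem unsignedVal_succ (e : ℕ → Bool) (D : ℕ) :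
    unsignedVal e (D + 1) = unsignedVal e D + if e D then 2 ^ D else 0 :=
  Finset.sum_range_succ _ _

theorem unsignedVal_congr {e e' : ℕ → Bool} {D : ℕ} (h : ∀ j < D, e j = e' j) :
    unsignedVal e D = unsignedVal e' D :=
  Finset.sum_congr rfl fun j hj => by rw [h j (Finset.mem_range.1 hj)]

theorem signedVal_congr {e e' : ℕ → Bool} {D : ℕ} (h : ∀ j ≤ D, e j = e' j) :
    signedVal e D = signedVal e' D := by
  unfold signedVal
  rw [h D le_rfl, unsignedVal_congr fun j hj => h j hj.le]

theorem unsignedVal_nonneg (e : ℕ → Bool) (D : ℕ) : 0 ≤ unsignedVal e D :=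
  Finset.sum_nonneg fun j _ => by split_ifs <;> positivity

theorem unsignedVal_lt (e : ℕ → Bool) (D : ℕ) : unsignedVal e D < 2 ^ D := by
  induction D with
  | zero => simp [unsignedVal]
  | succ D ih =>
    rw [unsignedVal_succ, pow_succ]
    have : (0 : ℤ) < 2 ^ D := by positivity
    split_ifs <;> linarith

theorem signedVal_lt (e : ℕ → Bool) (D : ℕ) : signedVal e D < 2 ^ D := by
  have h1 := unsignedVal_lt e D
  have : (0 : ℤ) < 2 ^ D := by positivity
  unfold signedVal
  split_ifs <;> linarith

theorem le_signedVal (e : ℕ → Bool) (D : ℕ) : -2 ^ D ≤ signedVal e D := by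
  have h1 := unsignedVal_nonneg e D
  have : (0 : ℤ) < 2 ^ D := by positivity
  unfold signedVal
  split_ifs <;> linarith

theorem signedVal_eq (e : ℕ → Bool) (D : ℕ) :
    signedVal e D = unsignedVal e (D + 1) - 2 ^ (D + 1) * if e D then 1 else 0 := by
  rw [signedVal, unsignedVal_succ, pow_succ]
  split_ifs <;> ring

theorem twosComplement_eq_signedVal {D : ℕ} (v : Fin (D + 1) → Bool) (e : ℕ → Bool)
    (h : ∀ j : Fin (D + 1), v j = e j) : twosComplement v = signedVal e D := by
  unfold twosComplement signedVal unsignedVal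
  rw [Fin.sum_univ_castSucc, Finset.sum_range]
  have h1 : v (Fin.last D) = e D := h (Fin.last D)
  rw [h1, sub_eq_add_neg]
  congr 1
  · refine Finset.sum_congr rfl fun j _ => ?_
    have h2 : ¬ (j : ℕ) + 1 = D + 1 := by
      have := j.2
      omega
    rw [h, Fin.val_castSucc, if_neg h2]
  · rw [Fin.val_last]
    split_ifs <;> simp_all

theorem signedVal_of_const {e : ℕ → Bool} {D D' : ℕ} (hD : D ≤ D')
    (h : ∀ j, D ≤ j → j ≤ D' → e j = e D) : signedVal e D' = signedVal e D := by
  induction D', hD using Nat.le_induction with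
  | base => rfl
  | succ D' hD ih =>
    rw [← ih fun j h1 h2 => h j h1 (by omega), signedVal, signedVal, unsignedVal_succ,
      h (D' + 1) (by omega) le_rfl, h D' hD (by omega), pow_succ]
    split_ifs <;> ring

theorem unsignedVal_add (e : ℕ → Bool) (a D : ℕ) :
    unsignedVal e (a + D) = unsignedVal e a + 2 ^ a * unsignedVal (fun j => e (a + j)) D := by
  unfold unsignedVal
  rw [Finset.sum_range_add, Finset.mul_sum]
  congr 1
  refine Finset.sum_congr rfl fun j _ => ?_
  rw [pow_add]
  split_ifs <;> simp

theorem signedVal_add (e : ℕ → Bool) (a D : ℕ) :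
    signedVal e (a + D) = unsignedVal e a + 2 ^ a * signedVal (fun j => e (a + j)) D := by
  rw [signedVal, signedVal, unsignedVal_add, pow_add]
  split_ifs <;> ring

theorem signedVal_not (e : ℕ → Bool) (D : ℕ) :
    signedVal (fun j => !e j) D = -signedVal e D - 1 := by
  have h : ∀ D, unsignedVal (fun j => !e j) D = 2 ^ D - 1 - unsignedVal e D := by
    intro D
    induction D with
    | zero => simp [unsignedVal]
    | succ D ih =>
      rw [unsignedVal_succ, unsignedVal_succ, ih, pow_succ]
      cases e D <;> simp <;> ring
  rw [signedVal, signedVal, h]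
  cases e D <;> simp <;> ring

/-- For a nonnegative number a set digit bounds the value below. A negative number reduces to this
by complementing all digits, which sends v to -v - 1. -/
theorem le_abs_signedVal_of_ne {e : ℕ → Bool} {j D : ℕ} (hj : j < D) (h : e j ≠ e D) :
    2 ^ j ≤ |signedVal e D| := by
  have key : ∀ e : ℕ → Bool, e j = true → (2 : ℤ) ^ j ≤ unsignedVal e D := by
    intro e he
    have := Finset.single_le_sum (f := fun j => if e j then (2 : ℤ) ^ j else 0)
      (fun j _ => by positivity) (Finset.mem_range.2 hj)
    simpa [he, unsignedVal] using this
  cases hD : e D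
  · have h1 : e j = true := by
      rw [hD] at h
      simpa using h
    have h2 := key e h1
    have h3 : signedVal e D = unsignedVal e D := by simp [signedVal, hD]
    rw [h3]
    exact h2.trans (le_abs_self _)
  · have h1 : e j = false := by
      rw [hD] at h
      simpa using h
    have h2 := key (fun j => !e j) (by simp [h1])
    have h4 := signedVal_not e D
    have h3 : signedVal (fun j => !e j) D = unsignedVal (fun j => !e j) D := by
      simp [signedVal, hD]
    rw [h3] at h4
    rw [← abs_neg]
    refine le_trans ?_ (le_abs_self _)
    linarith

/-- Correctness of the full adder by induction; the carry out of the digits summed so far completes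
the identity. -/
theorem unsignedVal_ripple {a b c s : ℕ → Bool} {Q : ℕ} (hc0 : c 0 = false)
    (hc : ∀ j < Q, c (j + 1) = xor (a j && b j) (xor (a j && c j) (b j && c j)))
    (hs : ∀ j < Q, s j = xor (a j) (xor (b j) (c j))) :
    unsignedVal s Q + (if c Q then 2 ^ Q else 0) = unsignedVal a Q + unsignedVal b Q := by
  induction Q with
  | zero => simp [unsignedVal, hc0]
  | succ Q ih =>
    have h1 := ih (fun j hj => hc j (by omega)) fun j hj => hs j (by omega)
    rw [unsignedVal_succ, unsignedVal_succ, unsignedVal_succ, hc Q (by omega), hs Q (by omega),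
      pow_succ]
    rw [show unsignedVal s Q = unsignedVal a Q + unsignedVal b Q -
      (if c Q then 2 ^ Q else 0) by linarith]
    cases a Q <;> cases b Q <;> cases c Q <;> simp <;> ring

/-- Discarding the last carry gives the sum modulo 2^(D+1). Both sides lie in the same interval of
that length, so they agree when there is no overflow. -/
theorem signedVal_ripple {a b c s : ℕ → Bool} {D : ℕ} (hc0 : c 0 = false)
    (hc : ∀ j < D + 1, c (j + 1) = xor (a j && b j) (xor (a j && c j) (b j && c j)))
    (hs : ∀ j < D + 1, s j = xor (a j) (xor (b j) (c j)))
    (hlo : -2 ^ D ≤ signedVal a D + signedVal b D) (hhi : signedVal a D + signedVal b D < 2 ^ D) :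
    signedVal s D = signedVal a D + signedVal b D := by
  have h1 := unsignedVal_ripple hc0 hc hs
  have h2 : (2 : ℤ) ^ (D + 1) ∣ signedVal s D - (signedVal a D + signedVal b D) := by
    rw [signedVal_eq s, signedVal_eq a, signedVal_eq b]
    refine ⟨(-(if s D then 1 else 0) + (if a D then 1 else 0) + (if b D then 1 else 0)) -
      if c (D + 1) then 1 else 0, ?_⟩
    rw [show unsignedVal s (D + 1) = unsignedVal a (D + 1) + unsignedVal b (D + 1) -
      (if c (D + 1) then 2 ^ (D + 1) else 0) by linarith]
    split_ifs <;> ring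
  have h3 := le_signedVal s D
  have h4 := signedVal_lt s D
  rw [pow_succ] at h2
  have h5 := Int.eq_zero_of_abs_lt_dvd h2 (by
    rw [abs_lt]
    constructor <;> linarith)
  linarith

/-- Arithmetic shift of a number that is divisible by the power of two. -/
theorem signedVal_shift {e : ℕ → Bool} {k D : ℕ} (hk : ∀ j < k, e j = false)
    (h : ∀ j, D ≤ j → e j = e D) : 2 ^ k * signedVal (fun j => e (j + k)) D = signedVal e D := by
  have h1 := signedVal_add e k D
  have h2 : unsignedVal e k = 0 := Finset.sum_eq_zero fun j hj => by
    rw [hk j (Finset.mem_range.1 hj)]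
    simp
  rw [h2, zero_add, signedVal_of_const (by omega) fun j h1 _ => h j h1] at h1
  rw [h1]
  congr 2
  funext j
  rw [add_comm]

/-! ### Sign extension and truncation of the input -/

/-- The digits of a number with `b` two's-complement digits, sign-extended. -/
def extDigit {b : ℕ} (v : Fin b → Bool) (j : ℕ) : Bool :=
  if h : 0 < b then v ⟨min j (b - 1), by omega⟩ else false

theorem extDigit_of_le {b : ℕ} (v : Fin b → Bool) {j : ℕ} (hj : b - 1 ≤ j) :
    extDigit v j = extDigit v (b - 1) := by
  unfold extDigit
  split_ifs
  · congr 2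
    omega
  · rfl

theorem signedVal_extDigit {b : ℕ} (v : Fin b → Bool) {D : ℕ} (hD : b - 1 ≤ D) :
    signedVal (extDigit v) D = twosComplement v := by
  rw [signedVal_of_const (e := extDigit v) hD fun j h1 _ => extDigit_of_le v h1]
  cases b with
  | zero => simp [signedVal, unsignedVal, twosComplement, extDigit]
  | succ b =>
    refine (twosComplement_eq_signedVal v _ fun j => ?_).symm
    unfold extDigit
    rw [dif_pos (by omega)]
    congr 1
    ext
    have := j.2
    simp
    omega

/-- The digits of `v / 2 ^ f`, rounded down to a multiple of `2 ^ (-F)`, in units of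
`2 ^ (-F)`. -/
def truncDigit {b : ℕ} (f F : ℕ) (v : Fin b → Bool) (j : ℕ) : Bool :=
  if j + f < F then false else extDigit v (j + f - F)

/-- If the input has more than F fractional digits, the dropped ones make up less than one unit.
Otherwise zeros are appended and the value is exact. -/
theorem signedVal_truncDigit_bounds {b : ℕ} (f F : ℕ) (v : Fin b → Bool) {D : ℕ}
    (hD : F + b ≤ D) :
    (signedVal (truncDigit f F v) D : ℝ) ≤ twosComplement v / 2 ^ f * 2 ^ F ∧
      twosComplement v / 2 ^ f * 2 ^ F ≤ (signedVal (truncDigit f F v) D : ℝ) + 1 := by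
  rcases le_total F f with h | h
  · obtain ⟨t, rfl⟩ := Nat.exists_eq_add_of_le h
    have h1 := signedVal_add (extDigit v) t D
    rw [signedVal_extDigit v (by omega)] at h1
    have h2 : (fun j => extDigit v (t + j)) = truncDigit (F + t) F v := by
      funext j
      unfold truncDigit
      rw [if_neg (by omega)]
      congr 1
      omega
    rw [h2] at h1
    have h3 := unsignedVal_nonneg (extDigit v) t
    have h4 := unsignedVal_lt (extDigit v) t
    have h5 : (twosComplement v : ℝ) / 2 ^ (F + t) * 2 ^ F =
        signedVal (truncDigit (F + t) F v) D + (unsignedVal (extDigit v) t : ℝ) / 2 ^ t := by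
      rw [h1, pow_add]
      push_cast
      field_simp
      ring
    have h6 : (0 : ℝ) ≤ unsignedVal (extDigit v) t := by exact_mod_cast h3
    have h7 : (unsignedVal (extDigit v) t : ℝ) ≤ 2 ^ t := by exact_mod_cast h4.le
    rw [h5]
    constructor
    · have : 0 ≤ (unsignedVal (extDigit v) t : ℝ) / 2 ^ t := by positivity
      linarith
    · have : (unsignedVal (extDigit v) t : ℝ) / 2 ^ t ≤ 1 := (div_le_one (by positivity)).2 h7
      linarith
  · obtain ⟨t, rfl⟩ := Nat.exists_eq_add_of_le h
    obtain ⟨D, rfl⟩ := Nat.exists_eq_add_of_le (show t ≤ D by omega)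
    have h1 := signedVal_add (truncDigit f (f + t) v) t D
    have h2 : (fun j => truncDigit f (f + t) v (t + j)) = extDigit v := by
      funext j
      unfold truncDigit
      rw [if_neg (by omega)]
      congr 1
      omega
    have h3 : unsignedVal (truncDigit f (f + t) v) t = 0 :=
      Finset.sum_eq_zero fun j hj => by
        have h4 := Finset.mem_range.1 hj
        have h5 : truncDigit f (f + t) v j = false := by
          rw [truncDigit, if_pos (by omega)]
        simp [h5]
    rw [h2, h3, signedVal_extDigit v (by omega), zero_add] at h1
    rw [h1, pow_add]
    push_cast
    have : (twosComplement v : ℝ) / 2 ^ f * (2 ^ f * 2 ^ t) = 2 ^ t * twosComplement v := by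
      field_simp
    rw [this]
    constructor <;> linarith

/-! ### The circuit -/

/-- Parameters of the separation circuit. -/
structure Params (n b : ℕ) where
  /-- number of fractional bits of the input -/
  inFrac : ℕ
  /-- number of bits per coordinate of the register that is Fourier transformed -/
  fineBits : ℕ
  /-- number of bits per coordinate of the random offset -/
  coarseBits : ℕ
  /-- number of fractional bits to which the input is truncated -/
  baseFrac : ℕ
  /-- number of steps of the binary search -/
  steps : ℕ
  /-- bound for the logarithm of the coordinates of the input -/
  logBound : ℕ
  /-- the scale of the phase -/
  scale : ℝ
  fineBits_pos : 0 < fineBits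

namespace Params

variable {n b : ℕ} (π : Params n b)

/-- The position of the sign bit of a queried coordinate. -/
def top : ℕ := π.steps + π.fineBits + π.coarseBits + (π.baseFrac + π.logBound + 3)

/-- The number of fractional bits of a grid point. -/
def gridFrac : ℕ := π.baseFrac + π.fineBits + π.coarseBits

end Params

/-- The qubits of the separation circuit. -/
inductive Wire {n b : ℕ} (π : Params n b) : Type
  | inp (k : Fin n × Fin b)
  | fine (k : Fin n × Fin π.fineBits)
  | coarse (k : Fin n × Fin π.coarseBits)
  | pt (k : Fin n × Fin (π.top + 1))
  | base (k : Fin n × Fin (π.top + 1))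
  | acc (t : Fin π.steps) (k : Fin n × Fin (π.top + 1))
  | carry (t : Fin π.steps) (k : Fin n × Fin (π.top + 1))
  | cand (t : Fin π.steps) (k : Fin n × Fin (π.top + 1))
  | ans (t : Fin π.steps)
  | agree (k : Fin n × Fin (b + 1))
  | small (i : Fin (n + 1))
  | memb (k : Fin 1)
  | flag (k : Fin 1)
  | out (k : Fin n × Fin (b + π.fineBits + 1))

namespace Wire

variable {n b : ℕ} {π : Params n b}

/-- The wires as a sum type. -/
def equivSum (π : Params n b) : Wire π ≃
    ((((Fin n × Fin b) ⊕ (Fin n × Fin π.fineBits)) ⊕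
      ((Fin n × Fin π.coarseBits) ⊕ (Fin n × Fin (π.top + 1)))) ⊕
    (((Fin n × Fin (π.top + 1)) ⊕ (Fin π.steps × (Fin n × Fin (π.top + 1)))) ⊕
      ((Fin π.steps × (Fin n × Fin (π.top + 1))) ⊕
        (Fin π.steps × (Fin n × Fin (π.top + 1)))))) ⊕
    ((((Fin π.steps) ⊕ (Fin n × Fin (b + 1))) ⊕ ((Fin (n + 1)) ⊕ (Fin 1))) ⊕
      ((Fin 1) ⊕ (Fin n × Fin (b + π.fineBits + 1)))) where
  toFun
    | inp k => .inl (.inl (.inl (.inl k)))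
    | fine k => .inl (.inl (.inl (.inr k)))
    | coarse k => .inl (.inl (.inr (.inl k)))
    | pt k => .inl (.inl (.inr (.inr k)))
    | base k => .inl (.inr (.inl (.inl k)))
    | acc t k => .inl (.inr (.inl (.inr (t, k))))
    | carry t k => .inl (.inr (.inr (.inl (t, k))))
    | cand t k => .inl (.inr (.inr (.inr (t, k))))
    | ans t => .inr (.inl (.inl (.inl t)))
    | agree k => .inr (.inl (.inl (.inr k)))
    | small i => .inr (.inl (.inr (.inl i)))
    | memb k => .inr (.inl (.inr (.inr k)))
    | flag k => .inr (.inr (.inl k))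
    | out k => .inr (.inr (.inr k))
  invFun
    | .inl (.inl (.inl (.inl k))) => inp k
    | .inl (.inl (.inl (.inr k))) => fine k
    | .inl (.inl (.inr (.inl k))) => coarse k
    | .inl (.inl (.inr (.inr k))) => pt k
    | .inl (.inr (.inl (.inl k))) => base k
    | .inl (.inr (.inl (.inr (t, k)))) => acc t k
    | .inl (.inr (.inr (.inl (t, k)))) => carry t k
    | .inl (.inr (.inr (.inr (t, k)))) => cand t k
    | .inr (.inl (.inl (.inl t))) => ans t
    | .inr (.inl (.inl (.inr k))) => agree k
    | .inr (.inl (.inr (.inl i))) => small i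
    | .inr (.inl (.inr (.inr k))) => memb k
    | .inr (.inr (.inl k)) => flag k
    | .inr (.inr (.inr k)) => out k
  left_inv w := by cases w <;> rfl
  right_inv w := by
    rcases w with (((w | w) | (w | w)) | ((w | w) | (w | w))) | (((w | w) | (w | w)) | (w | w)) <;>
      rfl

instance : Fintype (Wire π) := Fintype.ofEquiv _ (equivSum π).symm

instance : DecidableEq (Wire π) := Classical.decEq _

theorem card_eq (π : Params n b) : Fintype.card (Wire π) =
    n * b + n * π.fineBits + (n * π.coarseBits + n * (π.top + 1)) +
      (n * (π.top + 1) + π.steps * (n * (π.top + 1)) +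
        (π.steps * (n * (π.top + 1)) + π.steps * (n * (π.top + 1)))) +
    (π.steps + n * (b + 1) + (n + 1 + 1) + (1 + n * (b + π.fineBits + 1))) := by
  rw [Fintype.card_congr (equivSum π)]
  simp only [Fintype.card_sum, Fintype.card_prod, Fintype.card_fin]

end Wire

namespace Params

variable {n b : ℕ} (π : Params n b)

open Wire

/-- The sign-extended digits of the input. -/
def extTerms (i : Fin n) (j : ℕ) : List (Term n (π.top + 1) (Wire π)) :=
  if h : 0 < b then [.var (inp (i, ⟨min j (b - 1), by omega⟩))] else []

/-- The digits of the truncated input. -/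
def truncTerms (i : Fin n) (j : ℕ) : List (Term n (π.top + 1) (Wire π)) :=
  if j + π.inFrac < π.baseFrac then [] else π.extTerms i (j + π.inFrac - π.baseFrac)

/-- The digits of the grid point, followed by `steps` zeros after the binary point. -/
def ptTerms (i : Fin n) (j : ℕ) : List (Term n (π.top + 1) (Wire π)) :=
  if j < π.steps then []
  else if h : j - π.steps < π.fineBits then [.var (fine (i, ⟨j - π.steps, h⟩))]
  else if h : j - π.steps - π.fineBits < π.coarseBits then
    [.var (coarse (i, ⟨j - π.steps - π.fineBits, h⟩))]
  else π.truncTerms i (j - π.steps - π.fineBits - π.coarseBits)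

/-- The digits of the truncated input, at the scale of the grid point. -/
def baseTerms (i : Fin n) (j : ℕ) : List (Term n (π.top + 1) (Wire π)) :=
  if j < π.steps + π.fineBits + π.coarseBits then []
  else π.truncTerms i (j - π.steps - π.fineBits - π.coarseBits)

/-- The wire that holds digit `j` of the grid point divided by `2 ^ t`. -/
def shifted (t : ℕ) (i : Fin n) (j : ℕ) : Wire π :=
  -- The index is capped at the sign digit, so the shift is arithmetic and costs no wires of its
  -- own.
  pt (i, ⟨min (j + t) π.top, by omega⟩)

/-- The terms of the binary search. -/
def searchTerms : Wire π → List (Term n (π.top + 1) (Wire π))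
  | pt (i, j) => π.ptTerms i j
  | acc ⟨0, _⟩ _ => []
  -- A multiplexer: acc + ans·acc + ans·cand modulo two is the candidate if the query was answered
  -- positively and the old partial sum otherwise.
  | acc ⟨t + 1, h⟩ k => [.var (acc ⟨t, by omega⟩ k),
      .and (ans ⟨t, by omega⟩) (acc ⟨t, by omega⟩ k) (by simp),
      .and (ans ⟨t, by omega⟩) (cand ⟨t, by omega⟩ k) (by simp)]
  | carry _ (_, ⟨0, _⟩) => []
  | carry t (i, ⟨j + 1, h⟩) =>
    [.and (acc t (i, ⟨j, by omega⟩)) (π.shifted t i j) (by simp [shifted]),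
      .and (acc t (i, ⟨j, by omega⟩)) (carry t (i, ⟨j, by omega⟩)) (by simp),
      .and (π.shifted t i j) (carry t (i, ⟨j, by omega⟩)) (by simp [shifted])]
  | cand t (i, j) => [.var (acc t (i, j)), .var (π.shifted t i j), .var (carry t (i, j))]
  | ans t => [.query ⟨fun k => cand t k, fun k k' h => by simpa using h⟩]
  | _ => []

/-- The rank of a wire in the binary search. -/
def searchRank : Wire π → ℕ
  | pt _ => 1
  -- One round of the search consists of the partial sum, a chain of `top + 1` carries, the
  -- candidate and the answer. The stride leaves room for all of them.
  | acc t _ => 2 + t * (π.top + 5)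
  | carry t (_, j) => 3 + t * (π.top + 5) + j
  | cand t _ => 4 + t * (π.top + 5) + π.top
  | ans t => 5 + t * (π.top + 5) + π.top
  | _ => 0

/-- The wire that tells whether the input is small. -/
def isSmall : Wire π := small ⟨n, by omega⟩

/-- The terms of the final computation. -/
def finalTerms : Wire π → List (Term n (π.top + 1) (Wire π))
  | base (i, j) => π.baseTerms i j
  -- A running conjunction: for a digit of large weight the previous value is multiplied by 1 +
  -- digit + sign.
  | agree (_, ⟨0, _⟩) => [.one]
  | agree (i, ⟨j + 1, h⟩) =>
    if π.inFrac + π.logBound ≤ j then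
      [.var (agree (i, ⟨j, by omega⟩)),
        .and (agree (i, ⟨j, by omega⟩)) (inp (i, ⟨j, by omega⟩)) (by simp),
        .and (agree (i, ⟨j, by omega⟩)) (inp (i, ⟨b - 1, by omega⟩)) (by simp)]
    else [.var (agree (i, ⟨j, by omega⟩))]
  | small ⟨0, _⟩ => [.one]
  | small ⟨i + 1, h⟩ => [.and (small ⟨i, by omega⟩) (agree (⟨i, by omega⟩, ⟨b, by omega⟩)) (by simp)]
  | memb _ => [.query ⟨fun k => base k, fun k k' h => by simpa using h⟩]
  | flag _ => [.and (memb 0) π.isSmall (by simp [isSmall])]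
  -- The lowest digit is always set, so each output coordinate is odd and the output vector cannot
  -- vanish.
  | out (_, ⟨0, _⟩) => [.one]
  -- With S for smallness and d for the input digit, the sum S·fine + 1 + S + d + S·d is the
  -- frequency digit if S holds and the complement of d otherwise. The index into `fine` undoes the
  -- digit reversal of the Fourier transform, and the inner `min` extends the sign.
  | out (i, ⟨j + 1, _⟩) =>
    [.and π.isSmall (fine (i, ⟨π.fineBits - 1 - min j (π.fineBits - 1), by
        have := π.fineBits_pos
        omega⟩)) (by simp [isSmall]), .one, .var π.isSmall] ++
      if h : 0 < b then [.var (inp (i, ⟨min j (b - 1), by omega⟩)),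
        .and π.isSmall (inp (i, ⟨min j (b - 1), by omega⟩)) (by simp [isSmall])] else []
  | _ => []

/-- The rank of a wire in the final computation. -/
def finalRank : Wire π → ℕ
  | base _ => 1
  | agree (_, j) => 1 + j
  | small i => b + 3 + i
  | memb _ => 2
  | flag _ => b + n + 5
  | out _ => b + n + 5
  | _ => 0

theorem reads_extTerms {i : Fin n} {j : ℕ} {τ : Term n (π.top + 1) (Wire π)}
    (h : τ ∈ π.extTerms i j) {w : Wire π} (hw : τ.Reads w) : ∃ k, w = inp k := by
  unfold extTerms at h
  split_ifs at h
  · rw [List.mem_singleton] at h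
    subst h
    exact ⟨_, hw⟩
  · simp at h

theorem reads_truncTerms {i : Fin n} {j : ℕ} {τ : Term n (π.top + 1) (Wire π)}
    (h : τ ∈ π.truncTerms i j) {w : Wire π} (hw : τ.Reads w) : ∃ k, w = inp k := by
  unfold truncTerms at h
  split_ifs at h
  · simp at h
  · exact π.reads_extTerms h hw

/-- The binary search as a program. -/
def searchProgram : Program n (π.top + 1) (Wire π) where
  rank := π.searchRank
  terms := π.searchTerms
  rank_lt := by
    intro w τ hτ v hv
    rcases w with k | k | k | ⟨i, j⟩ | k | ⟨_ | t, ht⟩ | ⟨t, i, _ | j, hj⟩ | ⟨t, i, j⟩ | t | k | k | k | k | k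
    · simp [searchTerms] at hτ
    · simp [searchTerms] at hτ
    · simp [searchTerms] at hτ
    · simp only [searchTerms] at hτ
      unfold ptTerms at hτ
      split_ifs at hτ
      · simp at hτ
      · rw [List.mem_singleton] at hτ
        subst hτ
        cases hv
        simp [searchRank]
      · rw [List.mem_singleton] at hτ
        subst hτ
        cases hv
        simp [searchRank]
      · obtain ⟨k, rfl⟩ := π.reads_truncTerms hτ hv
        simp [searchRank]
    · simp [searchTerms] at hτ
    · simp [searchTerms] at hτ
    · simp only [searchTerms, List.mem_cons, List.not_mem_nil, or_false] at hτ
      have h1 : (t + 1) * (π.top + 5) = t * (π.top + 5) + (π.top + 5) := by ring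
      rcases hτ with rfl | rfl | rfl
      · cases hv
        simp only [searchRank]
        omega
      · rcases hv with rfl | rfl <;> simp only [searchRank] <;> omega
      · rcases hv with rfl | rfl <;> simp only [searchRank] <;> omega
    · simp [searchTerms] at hτ
    · simp only [searchTerms, List.mem_cons, List.not_mem_nil, or_false] at hτ
      rcases hτ with rfl | rfl | rfl <;> rcases hv with rfl | rfl <;>
        simp only [searchRank, shifted] <;> omega
    · simp only [searchTerms, List.mem_cons, List.not_mem_nil, or_false] at hτ
      have := j.2
      rcases hτ with rfl | rfl | rfl <;> cases hv <;> simp only [searchRank, shifted] <;> omega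
    · simp only [searchTerms, List.mem_cons, List.not_mem_nil, or_false] at hτ
      subst hτ
      obtain ⟨k, rfl⟩ := hv
      change π.searchRank (cand t k) < π.searchRank (ans t)
      simp only [searchRank]
      omega
    all_goals simp [searchTerms] at hτ

/-- The final computation as a program. -/
def finalProgram : Program n (π.top + 1) (Wire π) where
  rank := π.finalRank
  terms := π.finalTerms
  rank_lt := by
    intro w τ hτ v hv
    rcases w with k | k | k | k | ⟨i, j⟩ | ⟨t, k⟩ | ⟨t, k⟩ | ⟨t, k⟩ | t | ⟨i, _ | j, hj⟩ | ⟨_ | i, hi⟩ | k | k |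
      ⟨i, _ | j, hj⟩
    · simp [finalTerms] at hτ
    · simp [finalTerms] at hτ
    · simp [finalTerms] at hτ
    · simp [finalTerms] at hτ
    · simp only [finalTerms] at hτ
      unfold baseTerms at hτ
      split_ifs at hτ
      · simp at hτ
      · obtain ⟨k, rfl⟩ := π.reads_truncTerms hτ hv
        simp [finalRank]
    · simp [finalTerms] at hτ
    · simp [finalTerms] at hτ
    · simp [finalTerms] at hτ
    · simp [finalTerms] at hτ
    · simp only [finalTerms, List.mem_singleton] at hτ
      subst hτ
      cases hv
    · simp only [finalTerms] at hτ
      split_ifs at hτ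
      · simp only [List.mem_cons, List.not_mem_nil, or_false] at hτ
        rcases hτ with rfl | rfl | rfl
        · cases hv
          simp [finalRank]
        · rcases hv with rfl | rfl <;> simp [finalRank]
        · rcases hv with rfl | rfl <;> simp [finalRank]
      · rw [List.mem_singleton] at hτ
        subst hτ
        cases hv
        simp [finalRank]
    · simp only [finalTerms, List.mem_singleton] at hτ
      subst hτ
      cases hv
    · simp only [finalTerms, List.mem_singleton] at hτ
      subst hτ
      rcases hv with rfl | rfl <;> simp only [finalRank] <;> omega
    · simp only [finalTerms, List.mem_singleton] at hτ
      subst hτ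
      obtain ⟨k, rfl⟩ := hv
      change π.finalRank (base k) < 2
      simp [finalRank]
    · simp only [finalTerms, List.mem_singleton] at hτ
      subst hτ
      rcases hv with rfl | rfl <;> simp only [finalRank, isSmall] <;> omega
    · simp only [finalTerms, List.mem_singleton] at hτ
      subst hτ
      cases hv
    · simp only [finalTerms, List.mem_append, List.mem_cons, List.not_mem_nil, or_false] at hτ
      rcases hτ with (rfl | rfl | rfl) | hτ
      · rcases hv with rfl | rfl <;> simp only [finalRank, isSmall] <;> omega
      · cases hv
      · cases hv
        simp only [finalRank, isSmall]
        omega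
      · split_ifs at hτ
        · simp only [List.mem_cons, List.not_mem_nil, or_false] at hτ
          rcases hτ with rfl | rfl
          · cases hv
            simp only [finalRank]
            omega
          · rcases hv with rfl | rfl <;> simp only [finalRank, isSmall] <;> omega
        · simp at hτ

/-- The wires that are put into superposition. -/
def superposed : List (Wire π) :=
  (Finset.univ : Finset (Fin n × Fin π.fineBits)).toList.map fine ++
    (Finset.univ : Finset (Fin n × Fin π.coarseBits)).toList.map coarse

/-- The wires that are Fourier transformed, most significant digits first. -/
def transformed : List (Wire π) :=
  ((Finset.univ : Finset (Fin n × Fin π.fineBits)).toList.mergeSort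
    fun k l => decide (l.2 ≤ k.2)).map fine

/-- The angles of the Fourier transform. -/
def angle : Wire π → Wire π → ℝ
  | fine (i, j), fine (i', j') => if i = i' ∧ j' < j then -(1 / 2) ^ ((j : ℕ) - j' + 1) else 0
  | _, _ => 0

/-- The angles by which the answers of the binary search are turned into a phase. -/
def answerAngle : Wire π → ℝ
  | ans t => π.scale * (1 / 2) ^ (t : ℕ)
  | _ => 0

/-- The steps of the separation circuit. -/
def gates : List (WGate n (π.top + 1) (Wire π)) :=
  -- With zero angles these are plain Hadamard gates. The answers are then computed, turned into a
  -- phase and uncomputed, so that no work wire stays entangled with the grid point and spoils the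
  -- interference in the transform.
  fourierGates (fun _ _ => 0) π.superposed ++
    (π.searchProgram.gates ++ (phaseGates π.answerAngle ((List.finRange π.steps).map ans) ++
      (π.searchProgram.gates.reverse ++ (fourierGates π.angle π.transformed ++
        π.finalProgram.gates))))

/-- The separation circuit. -/
def circuit : SeparationCircuit n b :=
  circuitOfWires (π.gridFrac + π.steps) (b + π.fineBits + 1)
    ⟨inp, fun k k' h => by simpa using h⟩ (flag 0) ⟨out, fun k k' h => by simpa using h⟩ π.gates

end Params

namespace Params

variable {n b : ℕ} (π : Params n b)

open Wire

/-! ### Size of the circuit -/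

theorem nodup_superposed : π.superposed.Nodup := by
  unfold superposed
  rw [List.nodup_append]
  refine ⟨(Finset.nodup_toList _).map fun k l h => by simpa using h,
    (Finset.nodup_toList _).map fun k l h => by simpa using h, ?_⟩
  intro a ha c hc
  obtain ⟨k, -, rfl⟩ := List.mem_map.1 ha
  obtain ⟨l, -, rfl⟩ := List.mem_map.1 hc
  simp

theorem length_superposed : π.superposed.length = n * π.fineBits + n * π.coarseBits := by
  simp [superposed]

theorem nodup_transformed : π.transformed.Nodup := by
  unfold transformed
  refine List.Nodup.map (fun k l h => by simpa using h) ?_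
  rw [(List.mergeSort_perm _ _).nodup_iff]
  exact Finset.nodup_toList _

theorem length_transformed : π.transformed.length = n * π.fineBits := by
  simp [transformed]

theorem mem_transformed (k : Fin n × Fin π.fineBits) : fine k ∈ π.transformed := by
  unfold transformed
  refine List.mem_map_of_mem ?_
  rw [(List.mergeSort_perm _ _).mem_iff]
  simp

/-- Every round of the search queries once when computed and once when uncomputed; the remaining
query decides the flag. -/
theorem queryCount_circuit : π.circuit.queryCount = 2 * π.steps + 1 := by
  unfold circuit
  rw [circuitOfWires_queryCount, gates]
  simp only [List.countP_append, List.countP_reverse, countP_isQuery_fourierGates]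
  have h1 : (phaseGates π.answerAngle ((List.finRange π.steps).map ans) :
      List (WGate n (π.top + 1) (Wire π))).countP (fun g => g.isQuery) = 0 := by
    rw [List.countP_eq_zero]
    intro g hg
    obtain ⟨a, -, rfl⟩ := List.mem_map.1 hg
    simp [WGate.isQuery]
  have h2 : π.searchProgram.gates.countP (fun g => g.isQuery) = π.steps := by
    rw [Program.countP_gates]
    simp only [Program.countP_gatesAt_isQuery]
    have : ∀ w, (π.searchProgram.terms w).countP (fun τ => τ.isQuery) =
        if ∃ t, w = ans t then 1 else 0 := by
      classical
      intro w
      have hext : ∀ i j, ∀ a ∈ π.truncTerms i j, a.isQuery = false := by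
        intro i j
        unfold truncTerms extTerms
        split_ifs <;> simp [Term.isQuery]
      change (π.searchTerms w).countP _ = _
      rcases w with k | k | k | ⟨i, j⟩ | k | ⟨_ | t, ht⟩ | ⟨t, i, _ | j, hj⟩ | ⟨t, i, j⟩ | t | k | k | k | k | k
      all_goals try simp [searchTerms, Term.isQuery]
      unfold ptTerms
      split_ifs
      all_goals try simp
      exact fun a ha => hext i _ a ha
    rw [Finset.sum_congr rfl fun w _ => this w, Finset.sum_boole, Nat.cast_id,
      ← Fintype.card_subtype]
    have e : {w : Wire π // ∃ t, w = ans t} ≃ Fin π.steps :=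
      (Equiv.ofBijective (fun t : Fin π.steps => (⟨ans t, t, rfl⟩ : {w : Wire π // ∃ t, w = ans t}))
        ⟨fun t t' h => by simpa using h, fun ⟨w, t, h⟩ => ⟨t, by simp [h]⟩⟩).symm
    rw [Fintype.card_congr e, Fintype.card_fin]
  have h3 : π.finalProgram.gates.countP (fun g => g.isQuery) = 1 := by
    rw [Program.countP_gates]
    simp only [Program.countP_gatesAt_isQuery]
    rw [Finset.sum_eq_single (memb 0)]
    · simp [finalProgram, finalTerms, Term.isQuery]
    · intro w _ hw
      have hext : ∀ i j, ∀ a ∈ π.truncTerms i j, a.isQuery = false := by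
        intro i j
        unfold truncTerms extTerms
        split_ifs <;> simp [Term.isQuery]
      change (π.finalTerms w).countP _ = _
      rcases w with k | k | k | k | ⟨i, j⟩ | ⟨t, k⟩ | ⟨t, k⟩ | ⟨t, k⟩ | t | ⟨i, _ | j, hj⟩ | ⟨_ | i, hi⟩ | k | k |
        ⟨i, _ | j, hj⟩
      all_goals try simp [finalTerms, Term.isQuery]
      · unfold baseTerms
        split_ifs
        · simp
        · exact fun a ha => hext i _ a ha
      · split_ifs <;> simp
      · exact hw (by rw [Subsingleton.elim k 0])
      · rintro a - (rfl | rfl) <;> rfl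
    · simp
  rw [h1, h2, h3]
  omega

theorem length_searchTerms_le (w : Wire π) : (π.searchTerms w).length ≤ 5 := by
  have hext : ∀ i j, (π.truncTerms i j).length ≤ 5 := by
    intro i j
    unfold truncTerms extTerms
    split_ifs <;> simp
  rcases w with k | k | k | ⟨i, j⟩ | k | ⟨_ | t, ht⟩ | ⟨t, i, _ | j, hj⟩ | ⟨t, i, j⟩ | t | k | k | k | k | k
  all_goals try simp [searchTerms]
  unfold ptTerms
  split_ifs
  all_goals try simp
  exact hext i _

theorem length_finalTerms_le (w : Wire π) : (π.finalTerms w).length ≤ 5 := by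
  have hext : ∀ i j, (π.truncTerms i j).length ≤ 5 := by
    intro i j
    unfold truncTerms extTerms
    split_ifs <;> simp
  rcases w with k | k | k | k | ⟨i, j⟩ | ⟨t, k⟩ | ⟨t, k⟩ | ⟨t, k⟩ | t | ⟨i, _ | j, hj⟩ | ⟨_ | i, hi⟩ | k | k |
    ⟨i, _ | j, hj⟩
  all_goals try simp [finalTerms]
  · unfold baseTerms
    split_ifs
    · simp
    · exact hext i _
  · split_ifs <;> simp
  · split_ifs <;> simp

theorem length_gates_le (P : Program n (π.top + 1) (Wire π)) (hP : ∀ w, (P.terms w).length ≤ 5) :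
    P.gates.length ≤ 5 * Fintype.card (Wire π) := by
  have h1 := P.countP_gates fun _ => true
  simp only [List.countP_true] at h1
  rw [h1]
  refine (Finset.sum_le_card_nsmul _ _ 5 fun w _ => ?_).trans ?_
  · rw [Program.length_gatesAt]
    exact hP w
  · rw [Finset.card_univ, smul_eq_mul, mul_comm]

theorem gateCount_circuit_le : π.circuit.gateCount ≤
    n * π.fineBits + n * π.coarseBits + 15 * Fintype.card (Wire π) + π.steps +
      n * π.fineBits * (5 * π.fineBits + 1) := by
  classical
  unfold circuit
  rw [circuitOfWires_gateCount]
  refine List.countP_le_length.trans ?_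
  unfold gates
  simp only [List.length_append, List.length_reverse]
  have h1 := π.length_gates_le π.searchProgram π.length_searchTerms_le
  have h2 := π.length_gates_le π.finalProgram π.length_finalTerms_le
  have h3 : (phaseGates π.answerAngle ((List.finRange π.steps).map ans) :
      List (WGate n (π.top + 1) (Wire π))).length = π.steps := by
    simp [phaseGates]
  have h4 := length_fourierGates_le (n := n) (q := π.top + 1) (fun _ _ => (0 : ℝ)) π.superposed 0
    (by simp)
  -- Only digits of the same coordinate have a nonzero angle, so a wire has at most `fineBits`
  -- partners, whatever the dimension.
  have h5 := length_fourierGates_le (n := n) (q := π.top + 1) π.angle π.transformed π.fineBits (by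
    intro a ha l' hl'
    obtain ⟨⟨i, j⟩, -, rfl⟩ := List.mem_map.1 ha
    have hnd : (l'.filter fun b => decide (π.angle (fine (i, j)) b ≠ 0)).Nodup :=
      (π.nodup_transformed.sublist hl').filter _
    have h6 : (l'.filter fun b => decide (π.angle (fine (i, j)) b ≠ 0)) ⊆
        (List.finRange π.fineBits).map fun j' => fine (i, j') := by
      intro c hc
      rw [List.mem_filter] at hc
      obtain ⟨⟨i', j'⟩, -, rfl⟩ := List.mem_map.1 (hl'.subset hc.1)
      have h7 : i = i' := by
        by_contra h
        have := hc.2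
        simp [angle, h] at this
      subst h7
      exact List.mem_map_of_mem (List.mem_finRange j')
    have h8 := (hnd.subperm h6).length_le
    rw [List.length_map, List.length_finRange] at h8
    refine le_trans (le_of_eq ?_) h8
    congr)
  rw [length_superposed] at h4
  rw [length_transformed] at h5
  omega

end Params

/-! ### The Fourier phase as a character -/

theorem sum_testBit {q x : ℕ} (hx : x < 2 ^ q) :
    ∑ j : Fin q, (if x.testBit j then (2 : ℝ) ^ (j : ℕ) else 0) = x := by
  have key : ∀ q : ℕ, ∑ j ∈ Finset.range q, (if x.testBit j then 2 ^ j else 0) = x % 2 ^ q := by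
    intro q
    induction q with
    | zero => simp [Nat.mod_one]
    | succ q ih =>
      rw [Finset.sum_range_succ, ih, Nat.mod_pow_succ, Nat.testBit_eq_decide_div_mod_eq]
      rcases Nat.mod_two_eq_zero_or_one (x / 2 ^ q) with h | h <;> simp [h]
  have h := key q
  rw [Nat.mod_eq_of_lt hx, Finset.sum_range] at h
  conv_rhs => rw [← h]
  push_cast
  rfl

theorem sum_testBit_rev {q x : ℕ} (hx : x < 2 ^ q) :
    ∑ j : Fin q, (if x.testBit (q - 1 - j) then (2 : ℝ) ^ (q - 1 - (j : ℕ)) else 0) = x := by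
  rw [← sum_testBit hx]
  refine Fintype.sum_equiv Fin.revPerm _ _ fun j => ?_
  have h : ((Fin.revPerm j : Fin q) : ℕ) = q - 1 - j := by
    rw [Fin.revPerm_apply, Fin.val_rev]
    omega
  rw [h]

theorem two_pow_mul_div_eq_half {j q : ℕ} (hj : j < q) :
    (2 : ℝ) ^ (q - 1 - j) * 2 ^ j / 2 ^ q = 1 / 2 := by
  obtain ⟨d, rfl⟩ := Nat.exists_eq_add_of_lt hj
  rw [← pow_add, show j + d + 1 - 1 - j + j = j + d by omega, pow_succ]
  field_simp

theorem two_pow_mul_div_of_lt {l j q : ℕ} (hl : l < j) (hj : j < q) :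
    (2 : ℝ) ^ (q - 1 - j) * 2 ^ l / 2 ^ q = (1 / 2) ^ (j - l + 1) := by
  obtain ⟨c, rfl⟩ := Nat.exists_eq_add_of_lt hl
  obtain ⟨d, rfl⟩ := Nat.exists_eq_add_of_lt hj
  rw [show l + c + 1 + d + 1 - 1 - (l + c + 1) = d by omega,
    show l + c + 1 - l + 1 = c + 2 by omega, one_div, inv_pow]
  field_simp
  ring

theorem two_pow_mul_div_of_gt {l j q : ℕ} (hl : j < l) (hj : l < q) :
    (2 : ℝ) ^ (q - 1 - j) * 2 ^ l / 2 ^ q = 2 ^ (l - j - 1) := by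
  obtain ⟨c, rfl⟩ := Nat.exists_eq_add_of_lt hl
  obtain ⟨d, rfl⟩ := Nat.exists_eq_add_of_lt hj
  rw [show j + c + 1 + d + 1 - 1 - j = c + 1 + d by omega, show j + c + 1 - j - 1 = c by omega]
  field_simp
  ring

theorem stdAddChar_neg_sum {n N : ℕ} [NeZero N] (x y : Fin n → ZMod N) :
    (ZMod.stdAddChar (-∑ i, x i * y i) : ℂ) =
      phase (∑ i, -((x i).val * (y i).val : ℝ) / N) := by
  have h2 : (-∑ i, x i * y i) = (((-∑ i, ((x i).val * (y i).val : ℕ) : ℤ)) : ZMod N) := by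
    push_cast
    simp only [ZMod.natCast_zmod_val]
  rw [h2, stdAddChar_eq_phase]
  congr 1
  push_cast
  rw [← Finset.sum_div, Finset.sum_neg_distrib]

/-- Expand xy/2^q in digits, those of y in reversed order. Terms with l > j are integers and
disappear, diagonal terms are -1/2, which equals 1/2 modulo one and is the Hadamard sign, and terms
with l < j are the controlled phases. -/
theorem phase_pairs {q x y : ℕ} (hx : x < 2 ^ q) (hy : y < 2 ^ q) :
    phase (∑ j : Fin q, ∑ l : Fin q, if y.testBit (q - 1 - j) && x.testBit l then
      (if l = j then 1 / 2 else if l < j then -(1 / 2) ^ ((j : ℕ) - l + 1) else 0) else 0) =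
      phase (-(x * y) / 2 ^ q) := by
  have h1 : (-(x * y) / 2 ^ q : ℝ) = ∑ j : Fin q, ∑ l : Fin q,
      if y.testBit (q - 1 - j) && x.testBit l then
        -((2 : ℝ) ^ (q - 1 - (j : ℕ)) * 2 ^ (l : ℕ) / 2 ^ q) else 0 := by
    conv_lhs => rw [← sum_testBit hx, ← sum_testBit_rev hy, mul_comm, Finset.sum_mul_sum]
    rw [← Finset.sum_neg_distrib, Finset.sum_div]
    refine Finset.sum_congr rfl fun j _ => ?_
    rw [← Finset.sum_neg_distrib, Finset.sum_div]
    refine Finset.sum_congr rfl fun l _ => ?_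
    cases y.testBit (q - 1 - j) <;> cases x.testBit l <;> simp
    ring
  rw [h1, phase_sum, phase_sum]
  refine Finset.prod_congr rfl fun j _ => ?_
  rw [phase_sum, phase_sum]
  refine Finset.prod_congr rfl fun l _ => ?_
  split_ifs with h2 h3 h4
  · subst h3
    have : (-((2 : ℝ) ^ (q - 1 - (l : ℕ)) * 2 ^ (l : ℕ) / 2 ^ q)) = 1 / 2 + ((-1 : ℤ) : ℝ) := by
      rw [two_pow_mul_div_eq_half l.2]
      norm_num
    rw [this, phase_add_intCast]
  · have hlt : (l : ℕ) < j := h4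
    rw [two_pow_mul_div_of_lt hlt j.2]
  · have hlt : (j : ℕ) < l := by
      have h5 : (j : ℕ) ≤ l := by
        rw [← not_lt]
        exact h4
      have h6 : (l : ℕ) ≠ j := fun h => h3 (Fin.ext h)
      omega
    have : (-((2 : ℝ) ^ (q - 1 - (j : ℕ)) * 2 ^ (l : ℕ) / 2 ^ q)) =
        0 + ((-2 ^ ((l : ℕ) - j - 1) : ℤ) : ℝ) := by
      rw [two_pow_mul_div_of_gt hlt l.2]
      push_cast
      ring
    rw [this, phase_add_intCast]
  · rfl

namespace Params

variable {n b : ℕ} (π : Params n b)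

open Wire

theorem fourierPhase_transformed (s s' : Wire π → Bool) :
    fourierPhase π.angle π.transformed s s' = ∑ i : Fin n, ∑ j : Fin π.fineBits,
      ∑ l : Fin π.fineBits, if s (fine (i, j)) && s' (fine (i, l)) then
        (if l = j then 1 / 2 else if l < j then -(1 / 2) ^ ((j : ℕ) - l + 1) else 0) else 0 := by
  classical
  rw [fourierPhase_eq_sum]
  · have hperm : π.transformed.Perm
        ((Finset.univ : Finset (Fin n × Fin π.fineBits)).toList.map fine) :=
      (List.mergeSort_perm _ _).map _
    have hsum : ∀ g : Wire π → ℝ, (π.transformed.map g).sum = ∑ k, g (fine k) := by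
      intro g
      rw [(hperm.map g).sum_eq, List.map_map]
      exact Finset.sum_map_toList _ _
    rw [hsum, Fintype.sum_prod_type]
    refine Finset.sum_congr rfl fun i _ => Finset.sum_congr rfl fun j _ => ?_
    rw [hsum, Fintype.sum_prod_type, Finset.sum_eq_single i]
    · have h1 : (if s (fine (i, j)) && s' (fine (i, j)) then (1 / 2 : ℝ) else 0) =
          ∑ l : Fin π.fineBits, if l = j then
            (if s (fine (i, j)) && s' (fine (i, l)) then (1 / 2 : ℝ) else 0) else 0 := by
        simp
      rw [h1, ← Finset.sum_add_distrib]
      refine Finset.sum_congr rfl fun l _ => ?_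
      by_cases h2 : l = j
      · subst h2
        simp [angle]
      · by_cases h3 : l < j <;> simp [angle, h2, h3]
    · intro i' _ hi'
      refine Finset.sum_eq_zero fun l _ => ?_
      simp [angle, Ne.symm hi']
    · simp
  · intro a
    cases a <;> simp [angle]
  · unfold transformed
    rw [List.pairwise_map]
    have := List.pairwise_mergeSort
      (le := fun k l : Fin n × Fin π.fineBits => decide (l.2 ≤ k.2))
      (fun a b c hab hbc => by
        simp only [decide_eq_true_eq] at *
        exact hbc.trans hab)
      (fun a b => by
        simp only [Bool.or_eq_true, decide_eq_true_eq]
        exact le_total _ _) (Finset.univ : Finset (Fin n × Fin π.fineBits)).toList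
    refine this.imp fun {k l} h => ?_
    simp only [decide_eq_true_eq] at h
    simp only [angle]
    rw [if_neg]
    rintro ⟨-, h'⟩
    exact absurd h (not_le.2 h')

/-- The basis state with input `u`, and given contents of the two superposed registers. -/
def regState (u : Fin n × Fin b → Bool) (v : Fin n × Fin π.fineBits → Bool) (z : Fin n → ℕ) :
    Wire π → Bool
  | inp k => u k
  | fine k => v k
  | coarse (i, j) => (z i).testBit j
  | _ => false

/-- The basis state for the fine offset `x`. -/
def gridState (u : Fin n × Fin b → Bool) (x z : Fin n → ℕ) : Wire π → Bool :=
  π.regState u (fun k => (x k.1).testBit k.2) z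

/-- The basis state after the Fourier transform, for the frequency `y`. -/
def freqState (u : Fin n × Fin b → Bool) (y z : Fin n → ℕ) : Wire π → Bool :=
  π.regState u (fun k => (y k.1).testBit (π.fineBits - 1 - k.2)) z

@[simp] theorem gridState_fine (u : Fin n × Fin b → Bool) (x z : Fin n → ℕ) (i : Fin n)
    (j : Fin π.fineBits) : π.gridState u x z (fine (i, j)) = (x i).testBit j := rfl

@[simp] theorem freqState_fine (u : Fin n × Fin b → Bool) (y z : Fin n → ℕ) (i : Fin n)
    (j : Fin π.fineBits) :
    π.freqState u y z (fine (i, j)) = (y i).testBit (π.fineBits - 1 - j) := rfl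

instance : NeZero (2 ^ π.fineBits) := ⟨by positivity⟩

theorem phase_fourierPhase_freqState (u : Fin n × Fin b → Bool) (x y z : Fin n → ℕ)
    (hx : ∀ i, x i < 2 ^ π.fineBits) (hy : ∀ i, y i < 2 ^ π.fineBits) :
    phase (fourierPhase π.angle π.transformed (π.freqState u y z) (π.gridState u x z)) =
      phase (∑ i, -(x i * y i : ℝ) / 2 ^ π.fineBits) := by
  rw [fourierPhase_transformed, phase_sum, phase_sum]
  refine Finset.prod_congr rfl fun i _ => ?_
  simp only [gridState_fine, freqState_fine]
  exact phase_pairs (hx i) (hy i)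

/-- The phase after the binary search. -/
def searchPhase (m : EuclideanSpace ℝ (Fin n) → Bool) (s : Wire π → Bool) : ℝ :=
  ∑ t : Fin π.steps, if π.searchProgram.eval (π.gridFrac + π.steps) m s (ans t) then
    π.scale * (1 / 2) ^ (t : ℕ) else 0

/-- The state before the final computation. -/
def lateState (m : EuclideanSpace ℝ (Fin n) → Bool) (u : Fin n × Fin b → Bool) :
    (Wire π → Bool) → ℂ :=
  runGates (q := π.top + 1) (π.gridFrac + π.steps) m (fourierGates π.angle π.transformed) fun s =>
    phase (π.searchPhase m s) *
      runGates (q := π.top + 1) (π.gridFrac + π.steps) m (fourierGates (fun _ _ => 0) π.superposed)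
        (basisState (π.regState u (fun _ => false) fun _ => 0)) s

theorem initialState_eq (u : Fin n × Fin b → Bool) :
    initialState (⟨inp, fun k k' h => by simpa using h⟩ : Fin n × Fin b ↪ Wire π) u =
      π.regState u (fun _ => false) fun _ => 0 := by
  have hinj : Function.Injective (inp : Fin n × Fin b → Wire π) := fun k k' h => by simpa using h
  funext w
  unfold initialState
  change Function.extend (inp : Fin n × Fin b → Wire π) _ _ w = _
  cases w with
  | inp k => exact hinj.extend_apply _ _ k
  | _ =>
    rw [Function.extend_apply' _ _ _ (by rintro ⟨k, hk⟩; cases hk)]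
    simp [regState]

/-- The search acts by a permutation of basis states, the phase gates are diagonal, and the reversed
search undoes the permutation. What remains is a phase read off from the answers. -/
theorem runGates_gates (m : EuclideanSpace ℝ (Fin n) → Bool) (u : Fin n × Fin b → Bool)
    (s : Wire π → Bool) :
    runGates (π.gridFrac + π.steps) m π.gates
      (basisState (π.regState u (fun _ => false) fun _ => 0)) s =
      π.lateState m u ((π.finalProgram.eval (π.gridFrac + π.steps) m).symm s) := by
  unfold gates lateState
  simp only [runGates_append]
  rw [Program.runGates_gates]
  congr 1
  funext t
  rw [Program.runGates_gates_reverse, runGates_phaseGates, Program.runGates_gates]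
  simp only [Equiv.symm_apply_apply]
  congr 2
  unfold searchPhase
  rw [List.map_map, ← List.sum_ofFn, List.ofFn_eq_map]
  rfl

end Params

namespace Params

variable {n b : ℕ} (π : Params n b)

open Wire

/-! ### The probability of a correct answer -/

theorem gridState_eq_zero_of_notMem (u : Fin n × Fin b → Bool) (x z : Fin n → ℕ) {w : Wire π}
    (hw : w ∉ π.superposed) :
    π.regState u (fun _ => false) (fun _ => 0) w = π.gridState u x z w := by
  cases w with
  | fine k => exact absurd (by simp [superposed]) hw
  | coarse k => exact absurd (by simp [superposed]) hw
  | _ => rfl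

theorem fourierPhase_zero_right {W : Type} (θ : W → W → ℝ) (l : List W) (s s' : W → Bool)
    (h : ∀ a ∈ l, s' a = false) : fourierPhase θ l s s' = 0 := by
  induction l with
  | nil => rfl
  | cons a l ih =>
    have h1 : ∀ c ∈ l, s' c = false := fun c hc => h c (List.mem_cons_of_mem _ hc)
    rw [fourierPhase, ih h1, h a List.mem_cons_self, List.map_congr_left (g := fun _ => (0 : ℝ))]
    · simp
    · intro c hc
      simp [h1 c hc]

theorem runGates_superposed (fq : ℕ) (m : EuclideanSpace ℝ (Fin n) → Bool)
    (u : Fin n × Fin b → Bool) (x z : Fin n → ℕ) :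
    runGates (q := π.top + 1) fq m (fourierGates (fun _ _ => 0) π.superposed)
      (basisState (π.regState u (fun _ => false) fun _ => 0)) (π.gridState u x z) =
      ((Real.sqrt 2)⁻¹ : ℝ) ^ (n * π.fineBits + n * π.coarseBits) := by
  classical
  rw [runGates_fourierGates _ _ _ _ π.nodup_superposed,
    Finset.sum_eq_single (π.regState u (fun _ => false) fun _ => 0)]
  · rw [if_pos fun w hw => π.gridState_eq_zero_of_notMem u x z hw, fourierPhase_zero_right,
      length_superposed]
    · simp [basisState]
    · intro a ha
      rcases List.mem_append.1 ha with h | h <;> obtain ⟨k, -, rfl⟩ := List.mem_map.1 h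
      · rfl
      · exact Nat.zero_testBit _
  · intro s' _ hs'
    simp [basisState, hs']
  · simp

/-- The phase function on the fine grid. -/
def phaseFun (m : EuclideanSpace ℝ (Fin n) → Bool) (u : Fin n × Fin b → Bool) (z : Fin n → ℕ)
    (x : Fin n → ZMod (2 ^ π.fineBits)) : ℂ :=
  phase (π.searchPhase m (π.gridState u (fun i => (x i).val) z))

/-- The Fourier gates fix all wires off the fine register, so the path sum runs over fine offsets
only, with input and coarse offset fixed. The fine digits contribute to the normalization twice,
once for each layer of Hadamard gates. -/
theorem lateState_freqState (m : EuclideanSpace ℝ (Fin n) → Bool) (u : Fin n × Fin b → Bool)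
    (z : Fin n → ℕ) (y : Fin n → ZMod (2 ^ π.fineBits)) :
    π.lateState m u (π.freqState u (fun i => (y i).val) z) =
      ((Real.sqrt 2)⁻¹ : ℝ) ^ (2 * n * π.fineBits + n * π.coarseBits) *
        dft (π.phaseFun m u z) y := by
  classical
  unfold lateState dft
  rw [runGates_fourierGates _ _ _ _ π.nodup_transformed, Finset.mul_sum]
  symm
  refine Fintype.sum_of_injective (fun x : Fin n → ZMod (2 ^ π.fineBits) =>
    π.gridState u (fun i => (x i).val) z) ?_ _ _ ?_ ?_
  · intro x x' h
    funext i
    apply ZMod.val_injective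
    apply Nat.eq_of_testBit_eq
    intro j
    rcases lt_or_ge j π.fineBits with hj | hj
    · exact congrFun h (fine (i, ⟨j, hj⟩))
    · have h2 : 2 ^ π.fineBits ≤ 2 ^ j := Nat.pow_le_pow_right (by norm_num) hj
      rw [Nat.testBit_lt_two_pow ((ZMod.val_lt _).trans_le h2),
        Nat.testBit_lt_two_pow ((ZMod.val_lt _).trans_le h2)]
  · intro s' hs'
    rw [if_neg]
    intro h
    apply hs'
    refine ⟨fun i => ((Nat.ofBits fun j => s' (fine (i, j)) : ℕ) : ZMod (2 ^ π.fineBits)), ?_⟩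
    funext w
    by_cases hw : w ∈ π.transformed
    · obtain ⟨⟨i, j⟩, -, rfl⟩ := List.mem_map.1 hw
      simp only [gridState_fine]
      rw [ZMod.val_natCast, Nat.mod_eq_of_lt (Nat.ofBits_lt_two_pow _), Nat.testBit_ofBits_lt _ _ j.2]
    · rw [h w hw]
      cases w with
      | fine k => exact absurd (π.mem_transformed k) hw
      | _ => rfl
  · intro x
    have hoff : ∀ w, w ∉ π.transformed → π.gridState u (fun i => (x i).val) z w =
        π.freqState u (fun i => (y i).val) z w := by
      intro w hw
      cases w with
      | fine k => exact absurd (π.mem_transformed k) hw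
      | _ => rfl
    rw [if_pos hoff, π.phase_fourierPhase_freqState u _ _ z (fun i => ZMod.val_lt _)
      fun i => ZMod.val_lt _, runGates_superposed, length_transformed, stdAddChar_neg_sum, phaseFun]
    rw [show 2 * n * π.fineBits + n * π.coarseBits =
      n * π.fineBits + (n * π.fineBits + n * π.coarseBits) by ring, pow_add]
    push_cast
    ring

/-- The joint distribution of the random offset and the measured frequency. -/
def weight (m : EuclideanSpace ℝ (Fin n) → Bool) (u : Fin n × Fin b → Bool) (z : Fin n → ℕ)
    (y : Fin n → ZMod (2 ^ π.fineBits)) : ℝ :=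
  (((2 ^ π.coarseBits : ℕ) : ℝ) ^ n)⁻¹ * ((((2 ^ π.fineBits : ℕ) : ℝ) ^ (2 * n))⁻¹ *
    ‖dft (π.phaseFun m u z) y‖ ^ 2)

theorem norm_lateState_sq (m : EuclideanSpace ℝ (Fin n) → Bool) (u : Fin n × Fin b → Bool)
    (z : Fin n → ℕ) (y : Fin n → ZMod (2 ^ π.fineBits)) :
    ‖π.lateState m u (π.freqState u (fun i => (y i).val) z)‖ ^ 2 = π.weight m u z y := by
  have h2 : ((Real.sqrt 2)⁻¹) ^ 2 = (1 / 2 : ℝ) := by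
    rw [inv_pow, Real.sq_sqrt (by norm_num)]
    norm_num
  rw [lateState_freqState, norm_mul, mul_pow, norm_pow, Complex.norm_real, Real.norm_eq_abs,
    abs_of_nonneg (by positivity), ← pow_mul, mul_comm _ 2, pow_mul, h2, weight, ← mul_assoc]
  congr 1
  rw [← mul_inv, one_div, inv_pow]
  congr 1
  push_cast
  rw [← pow_mul, ← pow_mul, ← pow_add]
  congr 1
  ring

theorem weight_nonneg (m : EuclideanSpace ℝ (Fin n) → Bool) (u : Fin n × Fin b → Bool)
    (z : Fin n → ℕ) (y : Fin n → ZMod (2 ^ π.fineBits)) : 0 ≤ π.weight m u z y := by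
  unfold weight
  positivity

/-- The phase function has modulus one, so by Parseval each coarse offset has the same total weight:
the offset is uniformly distributed. -/
theorem sum_weight (m : EuclideanSpace ℝ (Fin n) → Bool) (u : Fin n × Fin b → Bool) :
    ∑ z : Fin n → Fin (2 ^ π.coarseBits), ∑ y, π.weight m u (fun i => z i) y = 1 := by
  have h1 : ∀ z : Fin n → ℕ, ∑ y, π.weight m u z y = (((2 ^ π.coarseBits : ℕ) : ℝ) ^ n)⁻¹ := by
    intro z
    unfold weight
    rw [← Finset.mul_sum, ← Finset.mul_sum, sum_norm_dft_sq]
    have h2 : ∀ x, ‖π.phaseFun m u z x‖ ^ 2 = 1 := fun x => by simp [phaseFun]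
    rw [Finset.sum_congr rfl fun x _ => h2 x, Finset.sum_const, Finset.card_univ, Fintype.card_fun,
      ZMod.card, Fintype.card_fin, nsmul_eq_mul, mul_one]
    have h3 : (((2 ^ π.fineBits) ^ n : ℕ) : ℝ) = ((2 ^ π.fineBits : ℕ) : ℝ) ^ n := by push_cast; rfl
    rw [h3, ← pow_add, ← two_mul, inv_mul_cancel₀ (by positivity), mul_one]
  rw [Finset.sum_congr rfl fun z _ => h1 _, Finset.sum_const, Finset.card_univ, Fintype.card_fun,
    Fintype.card_fin, Fintype.card_fin, nsmul_eq_mul]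
  have h3 : (((2 ^ π.coarseBits) ^ n : ℕ) : ℝ) = ((2 ^ π.coarseBits : ℕ) : ℝ) ^ n := by
    push_cast
    rfl
  rw [h3, mul_inv_cancel₀ (by positivity)]

/-- The measured answer, for the offset `z` and the frequency `y`. -/
def outcome (m : EuclideanSpace ℝ (Fin n) → Bool) (u : Fin n × Fin b → Bool) (z y : Fin n → ℕ) :
    Wire π → Bool :=
  π.finalProgram.eval (π.gridFrac + π.steps) m (π.freqState u y z)

/-- The measured vector. -/
def outcomeVector (m : EuclideanSpace ℝ (Fin n) → Bool) (u : Fin n × Fin b → Bool)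
    (z y : Fin n → ℕ) : EuclideanSpace ℝ (Fin n) :=
  fixedPoint 0 fun k => π.outcome m u z y (out k)

-- The final program permutes basis states, so it carries each probability to its outcome. Only an
-- inequality is needed, and states outside the family of pairs (z, y) are dropped.
open Classical in
theorem le_prob_circuit (m : EuclideanSpace ℝ (Fin n) → Bool) (u : Fin n × Fin b → Bool)
    (K : Set (EuclideanSpace ℝ (Fin n))) (η : ℝ) (p : EuclideanSpace ℝ (Fin n)) :
    ∑ z : Fin n → Fin (2 ^ π.coarseBits), ∑ y : Fin n → ZMod (2 ^ π.fineBits),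
      (if CorrectAnswer K η p (π.outcome m u (fun i => z i) (fun i => (y i).val) (flag 0))
        (π.outcomeVector m u (fun i => z i) fun i => (y i).val) then
        π.weight m u (fun i => z i) y else 0) ≤
      π.circuit.prob m u (π.circuit.correct K η p) := by
  unfold circuit
  rw [circuitOfWires_prob, initialState_eq]
  simp only [runGates_gates]
  rw [← Equiv.sum_comp (π.finalProgram.eval (π.gridFrac + π.steps) m)]
  simp only [Equiv.symm_apply_apply]
  rw [← Fintype.sum_prod_type']
  set ι : (Fin n → Fin (2 ^ π.coarseBits)) × (Fin n → ZMod (2 ^ π.fineBits)) → (Wire π → Bool) :=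
    fun zy => π.freqState u (fun i => (zy.2 i).val) (fun i => zy.1 i) with hι
  have hinj : Function.Injective ι := by
    rintro ⟨z, y⟩ ⟨z', y'⟩ h
    have h1 : z = z' := by
      funext i
      apply Fin.ext
      apply Nat.eq_of_testBit_eq
      intro j
      rcases lt_or_ge j π.coarseBits with hj | hj
      · exact congrFun h (coarse (i, ⟨j, hj⟩))
      · have h2 : 2 ^ π.coarseBits ≤ 2 ^ j := Nat.pow_le_pow_right (by norm_num) hj
        rw [Nat.testBit_lt_two_pow ((z i).2.trans_le h2),
          Nat.testBit_lt_two_pow ((z' i).2.trans_le h2)]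
    have h2 : y = y' := by
      funext i
      apply ZMod.val_injective
      apply Nat.eq_of_testBit_eq
      intro j
      rcases lt_or_ge j π.fineBits with hj | hj
      · have h3 := congrFun h (fine (i, ⟨π.fineBits - 1 - j, by omega⟩))
        simp only [hι, freqState_fine] at h3
        rwa [show π.fineBits - 1 - (π.fineBits - 1 - j) = j by omega] at h3
      · have h2 : 2 ^ π.fineBits ≤ 2 ^ j := Nat.pow_le_pow_right (by norm_num) hj
        rw [Nat.testBit_lt_two_pow ((ZMod.val_lt _).trans_le h2),
          Nat.testBit_lt_two_pow ((ZMod.val_lt _).trans_le h2)]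
    rw [h1, h2]
  refine le_trans (le_of_eq ?_) (Finset.sum_le_sum_of_subset_of_nonneg
    (Finset.subset_univ (Finset.univ.image ι)) fun s _ _ => by split_ifs <;> positivity)
  rw [Finset.sum_image fun a _ a' _ h => hinj h]
  refine Finset.sum_congr rfl fun zy _ => ?_
  rw [hι, norm_lateState_sq]
  rfl

/-- If frequencies close to `ω` give correct answers, and the differences of the phase function are
close to `ω` on average, then the circuit is correct with high probability. -/
theorem one_sub_le_prob_circuit (m : EuclideanSpace ℝ (Fin n) → Bool)
    (u : Fin n × Fin b → Bool) (K : Set (EuclideanSpace ℝ (Fin n))) (η : ℝ)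
    (p : EuclideanSpace ℝ (Fin n)) (ω : (Fin n → ℕ) → Fin n → ℝ) (B : (Fin n → ℕ) → ℝ) {τ : ℝ}
    (hτ : 0 < τ) (hB : ∀ z, (∀ i, z i < 2 ^ π.coarseBits) → 0 ≤ B z)
    (hA : ∀ z : Fin n → ℕ, (∀ i, z i < 2 ^ π.coarseBits) → ∀ (i : Fin n) (x : Fin n → ℕ),
      (∀ j, x j < 2 ^ π.fineBits) → x i + 1 < 2 ^ π.fineBits →
      |π.searchPhase m (π.gridState u (Function.update x i (x i + 1)) z) -
        π.searchPhase m (π.gridState u x z) - ω z i| ≤ B z)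
    (hgood : ∀ z : Fin n → ℕ, (∀ i, z i < 2 ^ π.coarseBits) → ∀ y : Fin n → ZMod (2 ^ π.fineBits),
      ∑ i, ‖(ZMod.stdAddChar (y i) : ℂ) - phase (ω z i)‖ ^ 2 < τ →
      CorrectAnswer K η p (π.outcome m u z (fun i => (y i).val) (flag 0))
        (π.outcomeVector m u z fun i => (y i).val)) :
    1 - τ⁻¹ * ((((2 ^ π.coarseBits : ℕ) : ℝ) ^ n)⁻¹ * ∑ z : Fin n → Fin (2 ^ π.coarseBits),
      n * (4 * Real.pi * B (fun i => z i) + 4 / (2 ^ π.fineBits : ℕ))) ≤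
      π.circuit.prob m u (π.circuit.correct K η p) := by
  classical
  refine le_trans ?_ (π.le_prob_circuit m u K η p)
  -- Markov's inequality term by term: a wrong answer forces the squared distance to be at least τ.
  have h1 : ∀ z : Fin n → Fin (2 ^ π.coarseBits), ∀ y : Fin n → ZMod (2 ^ π.fineBits),
      π.weight m u (fun i => z i) y - τ⁻¹ * (π.weight m u (fun i => z i) y *
        ∑ i, ‖(ZMod.stdAddChar (y i) : ℂ) - phase (ω (fun i => z i) i)‖ ^ 2) ≤
      if CorrectAnswer K η p (π.outcome m u (fun i => z i) (fun i => (y i).val) (flag 0))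
        (π.outcomeVector m u (fun i => z i) fun i => (y i).val) then
        π.weight m u (fun i => z i) y else 0 := by
    intro z y
    have hw := π.weight_nonneg m u (fun i => z i) y
    set S := ∑ i, ‖(ZMod.stdAddChar (y i) : ℂ) - phase (ω (fun i => z i) i)‖ ^ 2 with hS
    have hS0 : 0 ≤ S := Finset.sum_nonneg fun i _ => by positivity
    split_ifs with h
    · have : 0 ≤ τ⁻¹ * (π.weight m u (fun i => z i) y * S) := by positivity
      linarith
    · have h2 : τ ≤ S := by
        by_contra! h3
        exact h (hgood (fun i => z i) (fun i => (z i).2) y h3)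
      have h3 : 1 ≤ τ⁻¹ * S := by
        rw [inv_mul_eq_div, le_div_iff₀ hτ]
        linarith
      nlinarith
  refine le_trans ?_ (Finset.sum_le_sum fun z _ => Finset.sum_le_sum fun y _ => h1 z y)
  have hkey : ∑ z : Fin n → Fin (2 ^ π.coarseBits), ∑ y : Fin n → ZMod (2 ^ π.fineBits),
      π.weight m u (fun i => z i) y *
        ∑ i, ‖(ZMod.stdAddChar (y i) : ℂ) - phase (ω (fun i => z i) i)‖ ^ 2 ≤
      (((2 ^ π.coarseBits : ℕ) : ℝ) ^ n)⁻¹ * ∑ z : Fin n → Fin (2 ^ π.coarseBits),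
        n * (4 * Real.pi * B (fun i => z i) + 4 / (2 ^ π.fineBits : ℕ)) := by
    rw [Finset.mul_sum]
    refine Finset.sum_le_sum fun z _ => ?_
    have h4 := sum_dft_phase_le (N := 2 ^ π.fineBits)
      (fun x => π.searchPhase m (π.gridState u x fun i => z i)) (ω fun i => z i) (B fun i => z i)
      (hB _ fun i => (z i).2) (fun i x hx hxi => hA _ (fun i => (z i).2) i x hx hxi)
    unfold weight
    simp only [mul_assoc, ← Finset.mul_sum]
    refine mul_le_mul_of_nonneg_left ?_ (by positivity)
    rw [inv_mul_le_iff₀ (by positivity)]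
    refine le_trans (le_of_eq ?_) (h4.trans (le_of_eq ?_))
    · rfl
    · push_cast
      ring
  simp only [Finset.sum_sub_distrib, ← Finset.mul_sum]
  rw [sum_weight]
  have h5 := mul_le_mul_of_nonneg_left hkey (inv_pos.2 hτ).le
  simp only [← Finset.mul_sum] at h5
  linarith

end Params

theorem unsignedVal_testBit {q x : ℕ} (hx : x < 2 ^ q) : unsignedVal (fun j => x.testBit j) q = x := by
  have h := sum_testBit hx
  unfold unsignedVal
  rw [Finset.sum_range]
  have h2 : ((∑ j : Fin q, if x.testBit j then (2 : ℤ) ^ (j : ℕ) else 0 : ℤ) : ℝ) = (x : ℤ) := by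
    push_cast
    exact h
  exact_mod_cast h2

namespace Params

variable {n b : ℕ} (π : Params n b)

open Wire

/-! ### The input and the grid points -/

/-- All digits of the input of large weight agree with the sign. -/
def IsSmall (u : Fin n × Fin b → Bool) : Prop :=
  ∀ i j, π.inFrac + π.logBound ≤ j →
    extDigit (fun k => u (i, k)) j = extDigit (fun k => u (i, k)) (b - 1)

/-- The digits of the truncated input. -/
def baseDigit (u : Fin n × Fin b → Bool) (i : Fin n) : ℕ → Bool :=
  truncDigit π.inFrac π.baseFrac fun k => u (i, k)

/-- The truncated input, in units of `2 ^ (-baseFrac)`. -/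
def baseVal (u : Fin n × Fin b → Bool) (i : Fin n) : ℤ :=
  signedVal (π.baseDigit u i) (π.baseFrac + π.logBound)

/-- The grid point with the coarse offset `z` and the fine offset `x`. -/
def gridPoint (u : Fin n × Fin b → Bool) (x z : Fin n → ℕ) : EuclideanSpace ℝ (Fin n) :=
  WithLp.toLp 2 fun i =>
    (x i + 2 ^ π.fineBits * z i : ℝ) / 2 ^ π.gridFrac + (π.baseVal u i : ℝ) / 2 ^ π.baseFrac

theorem baseDigit_of_le {u : Fin n × Fin b → Bool} (hu : π.IsSmall u) (i : Fin n) {j : ℕ}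
    (hj : π.baseFrac + π.logBound ≤ j) :
    π.baseDigit u i j = π.baseDigit u i (π.baseFrac + π.logBound) := by
  unfold baseDigit truncDigit
  rw [if_neg (by omega), if_neg (by omega), hu i _ (by omega),
    hu i (π.baseFrac + π.logBound + π.inFrac - π.baseFrac) (by omega)]

theorem signedVal_baseDigit {u : Fin n × Fin b → Bool} (hu : π.IsSmall u) (i : Fin n) {D : ℕ}
    (hD : π.baseFrac + π.logBound ≤ D) : signedVal (π.baseDigit u i) D = π.baseVal u i :=
  signedVal_of_const hD fun _ h _ => π.baseDigit_of_le hu i h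

theorem baseVal_bounds {u : Fin n × Fin b → Bool} (hu : π.IsSmall u) (i : Fin n) :
    (π.baseVal u i : ℝ) / 2 ^ π.baseFrac ≤ fixedPoint π.inFrac u i ∧
      fixedPoint π.inFrac u i ≤ (π.baseVal u i : ℝ) / 2 ^ π.baseFrac + 1 / 2 ^ π.baseFrac := by
  have h := signedVal_truncDigit_bounds π.inFrac π.baseFrac (fun k => u (i, k))
    (D := π.baseFrac + π.logBound + b) (by omega)
  have h2 := π.signedVal_baseDigit hu i (D := π.baseFrac + π.logBound + b) (by omega)
  unfold baseDigit at h2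
  rw [h2] at h
  have h3 : fixedPoint π.inFrac u i = (twosComplement fun k => u (i, k) : ℝ) / 2 ^ π.inFrac := rfl
  rw [h3, ← add_div, div_le_iff₀ (by positivity), le_div_iff₀ (by positivity)]
  exact h

theorem abs_baseVal_le (u : Fin n × Fin b → Bool) (i : Fin n) :
    |π.baseVal u i| ≤ 2 ^ (π.baseFrac + π.logBound) :=
  abs_le.2 ⟨le_signedVal _ _, (signedVal_lt _ _).le⟩

/-- The digits of a grid point. -/
def ptDigit (u : Fin n × Fin b → Bool) (x z : Fin n → ℕ) (i : Fin n) (j : ℕ) : Bool :=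
  if j < π.steps then false
  else if j - π.steps < π.fineBits then (x i).testBit (j - π.steps)
  else if j - π.steps - π.fineBits < π.coarseBits then
    (z i).testBit (j - π.steps - π.fineBits)
  else π.baseDigit u i (j - π.steps - π.fineBits - π.coarseBits)

theorem signedVal_ptDigit {u : Fin n × Fin b → Bool} (hu : π.IsSmall u) {x z : Fin n → ℕ}
    (hx : ∀ i, x i < 2 ^ π.fineBits) (hz : ∀ i, z i < 2 ^ π.coarseBits) (i : Fin n) :
    signedVal (π.ptDigit u x z i) π.top = 2 ^ π.steps * (x i + 2 ^ π.fineBits * z i) +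
      2 ^ (π.steps + π.fineBits + π.coarseBits) * π.baseVal u i := by
  unfold top
  rw [signedVal_add, unsignedVal_add, unsignedVal_add]
  have h1 : unsignedVal (π.ptDigit u x z i) π.steps = 0 := Finset.sum_eq_zero fun j hj => by
    simp [ptDigit, Finset.mem_range.1 hj]
  have h2 : unsignedVal (fun j => π.ptDigit u x z i (π.steps + j)) π.fineBits = x i := by
    rw [← unsignedVal_testBit (hx i)]
    refine unsignedVal_congr fun j hj => ?_
    rw [ptDigit, if_neg (by omega), if_pos (by omega)]
    congr 1
    omega
  have h3 : unsignedVal (fun j => π.ptDigit u x z i (π.steps + π.fineBits + j)) π.coarseBits =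
      z i := by
    rw [← unsignedVal_testBit (hz i)]
    refine unsignedVal_congr fun j hj => ?_
    rw [ptDigit, if_neg (by omega), if_neg (by omega), if_pos (by omega)]
    congr 1
    omega
  have h4 : (fun j => π.ptDigit u x z i (π.steps + π.fineBits + π.coarseBits + j)) =
      π.baseDigit u i := by
    funext j
    rw [ptDigit, if_neg (by omega), if_neg (by omega), if_neg (by omega)]
    congr 1
    omega
  rw [h1, h2, h3, h4, π.signedVal_baseDigit hu i (by omega), pow_add]
  ring

theorem signedVal_ptDigit_eq {u : Fin n × Fin b → Bool} (hu : π.IsSmall u) {x z : Fin n → ℕ}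
    (hx : ∀ i, x i < 2 ^ π.fineBits) (hz : ∀ i, z i < 2 ^ π.coarseBits) (i : Fin n) :
    (signedVal (π.ptDigit u x z i) π.top : ℝ) =
      2 ^ (π.gridFrac + π.steps) * π.gridPoint u x z i := by
  rw [π.signedVal_ptDigit hu hx hz]
  simp only [gridPoint, gridFrac, pow_add]
  push_cast
  field_simp

/-- The bisection multiplies the point by factors up to 2, so twice the value must fit into the
register. The three guard digits in `top` provide this. -/
theorem abs_signedVal_ptDigit_lt {u : Fin n × Fin b → Bool} (hu : π.IsSmall u) {x z : Fin n → ℕ}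
    (hx : ∀ i, x i < 2 ^ π.fineBits) (hz : ∀ i, z i < 2 ^ π.coarseBits) (i : Fin n) :
    2 * |signedVal (π.ptDigit u x z i) π.top| < 2 ^ π.top := by
  have h1 : (2 : ℤ) ^ π.steps * (x i + 2 ^ π.fineBits * z i) <
      2 ^ (π.steps + π.fineBits + π.coarseBits) := by
    have h2 : (x i : ℤ) + 1 ≤ 2 ^ π.fineBits := by exact_mod_cast hx i
    have h3 : (z i : ℤ) + 1 ≤ 2 ^ π.coarseBits := by exact_mod_cast hz i
    rw [pow_add, pow_add, mul_assoc]
    refine mul_lt_mul_of_pos_left ?_ (by positivity)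
    have h4 : (2 : ℤ) ^ π.fineBits * (z i + 1) ≤ 2 ^ π.fineBits * 2 ^ π.coarseBits :=
      mul_le_mul_of_nonneg_left h3 (by positivity)
    linarith
  have h5 : (0 : ℤ) ≤ 2 ^ π.steps * (x i + 2 ^ π.fineBits * z i) := by positivity
  have h6 := abs_le.1 (π.abs_baseVal_le u i)
  have h7 : (0 : ℤ) < 2 ^ (π.steps + π.fineBits + π.coarseBits) := by positivity
  have h8 : (1 : ℤ) ≤ 2 ^ (π.baseFrac + π.logBound) := one_le_pow₀ (by norm_num)
  rw [π.signedVal_ptDigit hu hx hz]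
  have h9 : (2 : ℤ) ^ π.top = 2 ^ (π.steps + π.fineBits + π.coarseBits) *
      (2 ^ (π.baseFrac + π.logBound) * 8) := by
    rw [top, pow_add _ _ (π.baseFrac + π.logBound + 3), pow_add _ (π.baseFrac + π.logBound)]
    norm_num
  rw [h9]
  set A := (2 : ℤ) ^ π.steps * (x i + 2 ^ π.fineBits * z i)
  set Q := (2 : ℤ) ^ (π.steps + π.fineBits + π.coarseBits)
  set L := (2 : ℤ) ^ (π.baseFrac + π.logBound)
  have h10 : |A + Q * π.baseVal u i| ≤ Q * (2 * L) := by
    rw [abs_le]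
    constructor <;> nlinarith [mul_le_mul_of_nonneg_left h6.1 h7.le,
      mul_le_mul_of_nonneg_left h6.2 h7.le, mul_le_mul_of_nonneg_left h8 h7.le]
  have h11 : 0 < Q * L := by positivity
  nlinarith

/-! ### Values of the wires -/

variable {π} {m : EuclideanSpace ℝ (Fin n) → Bool} {fq : ℕ} {u : Fin n × Fin b → Bool}

theorem termSum_extTerms {s : Wire π → Bool} (hs : ∀ k, s (inp k) = u k) (i : Fin n) (j : ℕ) :
    termSum fq m (π.extTerms i j) s = extDigit (fun k => u (i, k)) j := by
  unfold extTerms extDigit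
  split_ifs
  · simp [termSum, Term.eval, hs]
  · rfl

theorem termSum_truncTerms {s : Wire π → Bool} (hs : ∀ k, s (inp k) = u k) (i : Fin n) (j : ℕ) :
    termSum fq m (π.truncTerms i j) s = π.baseDigit u i j := by
  unfold truncTerms baseDigit truncDigit
  split_ifs
  · rfl
  · exact termSum_extTerms hs _ _

theorem termSum_ptTerms {s : Wire π → Bool} {x z : Fin n → ℕ} (hs : ∀ k, s (inp k) = u k)
    (hf : ∀ i j, s (fine (i, j)) = (x i).testBit j)
    (hc : ∀ i j, s (coarse (i, j)) = (z i).testBit j) (i : Fin n) (j : ℕ) :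
    termSum fq m (π.ptTerms i j) s = π.ptDigit u x z i j := by
  unfold ptTerms ptDigit
  split_ifs
  · rfl
  · simp [termSum, Term.eval, hf]
  · simp [termSum, Term.eval, hc]
  · exact termSum_truncTerms hs _ _

theorem termSum_baseTerms {s : Wire π → Bool} (hs : ∀ k, s (inp k) = u k) (i : Fin n) (j : ℕ) :
    termSum fq m (π.baseTerms i j) s = π.ptDigit u (fun _ => 0) (fun _ => 0) i j := by
  unfold baseTerms ptDigit
  split_ifs <;> first | omega | rfl | exact termSum_truncTerms hs _ _ | simp [termSum]

/-- The carries of the addition of two numbers. -/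
def rippleCarry (a c : ℕ → Bool) : ℕ → Bool
  | 0 => false
  | j + 1 => xor (a j && c j) (xor (a j && rippleCarry a c j) (c j && rippleCarry a c j))

theorem search_eval_of_nil (s : Wire π → Bool) (w : Wire π) (h : π.searchTerms w = []) :
    π.searchProgram.eval fq m s w = s w := by
  rw [Program.eval_apply]
  change xor (s w) (termSum fq m (π.searchTerms w) _) = _
  rw [h]
  simp [termSum]

theorem search_eval_of_false (s : Wire π → Bool) (w : Wire π) (h : s w = false) :
    π.searchProgram.eval fq m s w =
      termSum fq m (π.searchTerms w) (π.searchProgram.eval fq m s) := by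
  rw [Program.eval_apply, h, Bool.false_xor]
  rfl

theorem final_eval_of_nil (s : Wire π → Bool) (w : Wire π) (h : π.finalTerms w = []) :
    π.finalProgram.eval fq m s w = s w := by
  rw [Program.eval_apply]
  change xor (s w) (termSum fq m (π.finalTerms w) _) = _
  rw [h]
  simp [termSum]

theorem final_eval_of_false (s : Wire π → Bool) (w : Wire π) (h : s w = false) :
    π.finalProgram.eval fq m s w =
      termSum fq m (π.finalTerms w) (π.finalProgram.eval fq m s) := by
  rw [Program.eval_apply, h, Bool.false_xor]
  rfl

theorem fixedPoint_eq {q fq : ℕ} (v : Fin n × Fin (q + 1) → Bool) (e : Fin n → ℕ → Bool)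
    (h : ∀ i (j : Fin (q + 1)), v (i, j) = e i j) (i : Fin n) :
    fixedPoint fq v i = (signedVal (e i) q : ℝ) / 2 ^ fq := by
  unfold fixedPoint
  simp only
  rw [twosComplement_eq_signedVal _ (e i) fun j => h i j]

section search

variable (π m u)
variable (x z : Fin n → ℕ)

/-- The state after the binary search. -/
def searchState : Wire π → Bool :=
  π.searchProgram.eval (π.gridFrac + π.steps) m (π.gridState u x z)

/-- A digit of a partial sum of the binary search. -/
def accDigit (t : Fin π.steps) (i : Fin n) (j : ℕ) : Bool :=
  π.searchState m u x z (acc t (i, ⟨min j π.top, by omega⟩))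

/-- A digit of a grid point divided by `2 ^ t`. -/
def shiftDigit (t : ℕ) (i : Fin n) (j : ℕ) : Bool := π.ptDigit u x z i (min (j + t) π.top)

/-- A digit of a candidate of the binary search. -/
def candDigit (t : Fin π.steps) (i : Fin n) (j : ℕ) : Bool :=
  xor (π.accDigit m u x z t i j) (xor (π.shiftDigit u x z t i j)
    (rippleCarry (π.accDigit m u x z t i) (π.shiftDigit u x z t i) j))

variable {π m u x z}

theorem searchState_shifted (t : ℕ) (i : Fin n) (j : ℕ) :
    π.searchState m u x z (π.shifted t i j) = π.shiftDigit u x z t i j := by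
  unfold searchState shifted
  rw [search_eval_of_false _ _ rfl]
  refine termSum_ptTerms (fun k => ?_) (fun i j => ?_) (fun i j => ?_) i _
  · rw [search_eval_of_nil _ _ rfl]
    rfl
  · rw [search_eval_of_nil _ _ rfl]
    rfl
  · rw [search_eval_of_nil _ _ rfl]
    rfl

theorem searchState_acc (t : Fin π.steps) (i : Fin n) (j : ℕ) (hj : j < π.top + 1) :
    π.searchState m u x z (acc t (i, ⟨j, hj⟩)) = π.accDigit m u x z t i j := by
  unfold accDigit
  congr 3
  ext
  simp
  omega

theorem searchState_carry (t : Fin π.steps) (i : Fin n) (j : ℕ) (hj : j < π.top + 1) :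
    π.searchState m u x z (carry t (i, ⟨j, hj⟩)) =
      rippleCarry (π.accDigit m u x z t i) (π.shiftDigit u x z t i) j := by
  induction j with
  | zero =>
    unfold searchState
    rw [search_eval_of_false _ _ rfl]
    rfl
  | succ j ih =>
    have ih' := ih (by omega)
    have h1 := searchState_acc (m := m) (u := u) (x := x) (z := z) t i j (by omega)
    have h2 := searchState_shifted (m := m) (u := u) (x := x) (z := z) (π := π) t i j
    unfold searchState at ih' h1 h2 ⊢
    rw [search_eval_of_false _ _ rfl]
    simp [searchTerms, termSum, Term.eval, ih', h1, h2, rippleCarry]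

theorem searchState_cand (t : Fin π.steps) (i : Fin n) (j : Fin (π.top + 1)) :
    π.searchState m u x z (cand t (i, j)) = π.candDigit m u x z t i j := by
  have h0 := searchState_carry (m := m) (u := u) (x := x) (z := z) t i j j.2
  have h1 := searchState_acc (m := m) (u := u) (x := x) (z := z) t i j j.2
  have h2 := searchState_shifted (m := m) (u := u) (x := x) (z := z) (π := π) t i j
  unfold searchState at h0 h1 h2 ⊢
  rw [search_eval_of_false _ _ rfl]
  simp [searchTerms, termSum, Term.eval, h0, h1, h2, candDigit]

/-- The point is stored with `steps` zeros at the low end, so every halving of the search is exact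
and the queried points lie on the ray without rounding. -/
theorem signedVal_shiftDigit {t : ℕ} (ht : t ≤ π.steps) (i : Fin n) :
    2 ^ t * signedVal (π.shiftDigit u x z t i) π.top = signedVal (π.ptDigit u x z i) π.top := by
  have h := signedVal_shift (e := fun j => π.ptDigit u x z i (min j π.top)) (k := t) (D := π.top)
    (fun j hj => by
      have : min j π.top < π.steps := by omega
      simp [ptDigit, this])
    (fun j hj => by simp [hj])
  refine h.trans (signedVal_congr fun j hj => ?_)
  simp [hj]

/-- The answers of the binary search. -/
def searchAnswer (π : Params n b) (m : EuclideanSpace ℝ (Fin n) → Bool) (u : Fin n × Fin b → Bool)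
    (x z : Fin n → ℕ) (t : ℕ) : Bool :=
  if h : t < π.steps then π.searchState m u x z (ans ⟨t, h⟩) else false

/-- The partial sums of the binary search. -/
def searchSum (π : Params n b) (m : EuclideanSpace ℝ (Fin n) → Bool) (u : Fin n × Fin b → Bool)
    (x z : Fin n → ℕ) (t : ℕ) : ℝ :=
  ∑ k ∈ Finset.range t, if searchAnswer π m u x z k then (1 / 2) ^ k else 0

theorem searchSum_bounds (t : ℕ) :
    0 ≤ searchSum π m u x z t ∧ searchSum π m u x z t + 2 * (1 / 2) ^ t ≤ 2 := by
  induction t with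
  | zero => simp [searchSum]
  | succ t ih =>
    unfold searchSum at ih ⊢
    rw [Finset.sum_range_succ, pow_succ]
    have : (0 : ℝ) < (1 / 2) ^ t := by positivity
    split_ifs <;> constructor <;> linarith

theorem signedVal_candDigit (hu : π.IsSmall u) (hx : ∀ i, x i < 2 ^ π.fineBits)
    (hz : ∀ i, z i < 2 ^ π.coarseBits) (t : Fin π.steps) (i : Fin n)
    (hacc : (signedVal (π.accDigit m u x z t i) π.top : ℝ) =
      searchSum π m u x z t * signedVal (π.ptDigit u x z i) π.top) :
    (signedVal (π.candDigit m u x z t i) π.top : ℝ) =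
      (searchSum π m u x z t + (1 / 2) ^ (t : ℕ)) * signedVal (π.ptDigit u x z i) π.top := by
  have h1 : (signedVal (π.shiftDigit u x z t i) π.top : ℝ) =
      (1 / 2) ^ (t : ℕ) * signedVal (π.ptDigit u x z i) π.top := by
    rw [← signedVal_shiftDigit t.2.le]
    push_cast
    rw [← mul_assoc, ← mul_pow]
    norm_num
  have h2 : |(signedVal (π.accDigit m u x z t i) π.top + signedVal (π.shiftDigit u x z t i) π.top :
      ℝ)| < 2 ^ π.top := by
    rw [hacc, h1, ← add_mul, abs_mul]
    have h3 := searchSum_bounds (π := π) (m := m) (u := u) (x := x) (z := z) t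
    have h4 : (0 : ℝ) < (1 / 2) ^ (t : ℕ) := by positivity
    have h5 : |searchSum π m u x z t + (1 / 2) ^ (t : ℕ)| ≤ 2 := by
      rw [abs_of_nonneg (by linarith)]
      linarith
    have h6 : (2 : ℝ) * |(signedVal (π.ptDigit u x z i) π.top : ℝ)| < 2 ^ π.top := by
      exact_mod_cast π.abs_signedVal_ptDigit_lt hu hx hz i
    exact (mul_le_mul_of_nonneg_right h5 (abs_nonneg _)).trans_lt h6
  have h7 := abs_lt.1 h2
  have h8 := signedVal_ripple (a := π.accDigit m u x z t i) (b := π.shiftDigit u x z t i)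
    (c := rippleCarry (π.accDigit m u x z t i) (π.shiftDigit u x z t i))
    (s := π.candDigit m u x z t i) (D := π.top) rfl (fun _ _ => rfl) (fun _ _ => rfl)
    (by exact_mod_cast h7.1.le) (by exact_mod_cast h7.2)
  rw [h8]
  push_cast
  rw [hacc, h1]
  ring

theorem signedVal_accDigit (hu : π.IsSmall u) (hx : ∀ i, x i < 2 ^ π.fineBits)
    (hz : ∀ i, z i < 2 ^ π.coarseBits) (i : Fin n) (t : ℕ) (ht : t < π.steps) :
    (signedVal (π.accDigit m u x z ⟨t, ht⟩ i) π.top : ℝ) =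
      searchSum π m u x z t * signedVal (π.ptDigit u x z i) π.top := by
  induction t with
  | zero =>
    have h : ∀ j, π.accDigit m u x z ⟨0, ht⟩ i j = false := by
      intro j
      unfold accDigit searchState
      rw [search_eval_of_false _ _ rfl]
      rfl
    simp [signedVal, unsignedVal, searchSum, h]
  | succ t ih =>
    have ih' := ih (by omega)
    have hcand := signedVal_candDigit hu hx hz ⟨t, by omega⟩ i ih'
    have h : ∀ j ≤ π.top, π.accDigit m u x z ⟨t + 1, ht⟩ i j =
        if searchAnswer π m u x z t then π.candDigit m u x z ⟨t, by omega⟩ i j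
        else π.accDigit m u x z ⟨t, by omega⟩ i j := by
      intro j hj
      have h0 : searchAnswer π m u x z t = π.searchState m u x z (ans ⟨t, by omega⟩) :=
        dif_pos _
      have h1 := searchState_acc (m := m) (u := u) (x := x) (z := z) ⟨t, by omega⟩ i j
        (Nat.lt_succ_of_le hj)
      have h2 := searchState_cand (m := m) (u := u) (x := x) (z := z) ⟨t, by omega⟩ i
        ⟨j, Nat.lt_succ_of_le hj⟩
      rw [← searchState_acc _ _ _ (Nat.lt_succ_of_le hj), h0, ← h1, ← h2]
      unfold searchState
      rw [search_eval_of_false _ _ rfl]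
      simp only [searchTerms, termSum, Term.eval, List.map_cons, List.map_nil, List.foldr_cons,
        List.foldr_nil, Bool.xor_false]
      split_ifs with h3 <;> simp [h3]
    have h4 : searchSum π m u x z (t + 1) = searchSum π m u x z t +
        if searchAnswer π m u x z t then (1 / 2) ^ t else 0 := Finset.sum_range_succ _ _
    rw [signedVal_congr h, h4]
    split_ifs with h5
    · exact hcand
    · rw [add_zero]
      exact ih'

/-- The bridge from wires to geometry: the candidate registers hold exactly the scaled grid point,
so the answers are those of an ideal bisection along the ray. -/
theorem searchAnswer_eq (hu : π.IsSmall u) (hx : ∀ i, x i < 2 ^ π.fineBits)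
    (hz : ∀ i, z i < 2 ^ π.coarseBits) (t : ℕ) (ht : t < π.steps) :
    searchAnswer π m u x z t =
      m ((searchSum π m u x z t + (1 / 2) ^ t) • π.gridPoint u x z) := by
  have h0 : searchAnswer π m u x z t = π.searchState m u x z (ans ⟨t, ht⟩) := dif_pos _
  have h1 : π.searchState m u x z (ans ⟨t, ht⟩) = m (fixedPoint (π.gridFrac + π.steps) fun k =>
      π.searchState m u x z (cand ⟨t, ht⟩ k)) := by
    unfold searchState
    rw [search_eval_of_false _ _ rfl]
    simp [searchTerms, termSum, Term.eval]
    rfl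
  rw [h0, h1]
  congr 1
  ext i
  rw [fixedPoint_eq _ (fun i => π.candDigit m u x z ⟨t, ht⟩ i) fun i j => searchState_cand _ _ _,
    signedVal_candDigit hu hx hz _ _ (signedVal_accDigit hu hx hz i t ht),
    π.signedVal_ptDigit_eq hu hx hz]
  simp only [PiLp.smul_apply, smul_eq_mul]
  field_simp

theorem searchPhase_gridState :
    π.searchPhase m (π.gridState u x z) = π.scale * searchSum π m u x z π.steps := by
  unfold searchPhase searchSum
  rw [Finset.sum_range, Finset.mul_sum]
  refine Finset.sum_congr rfl fun t _ => ?_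
  have h0 : searchAnswer π m u x z t = π.searchState m u x z (ans t) := dif_pos _
  rw [h0]
  unfold searchState
  split_ifs <;> simp

end search

end Params

namespace Params

variable {n b : ℕ} {π : Params n b} {m : EuclideanSpace ℝ (Fin n) → Bool}
  {u : Fin n × Fin b → Bool} {z y : Fin n → ℕ}

open Wire

/-! ### The final computation -/

theorem outcome_inp (k : Fin n × Fin b) : π.outcome m u z y (inp k) = u k := by
  unfold outcome
  rw [final_eval_of_nil _ _ rfl]
  rfl

theorem outcome_agree (i : Fin n) (j : ℕ) (hj : j < b + 1) :
    π.outcome m u z y (agree (i, ⟨j, hj⟩)) = true ↔ ∀ l < j, π.inFrac + π.logBound ≤ l →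
      extDigit (fun k => u (i, k)) l = extDigit (fun k => u (i, k)) (b - 1) := by
  induction j with
  | zero =>
    unfold outcome
    rw [final_eval_of_false _ _ rfl]
    simp [finalTerms, termSum, Term.eval]
  | succ j ih =>
    have ih' := ih (by omega)
    have h1 : π.outcome m u z y (inp (i, ⟨j, by omega⟩)) = extDigit (fun k => u (i, k)) j := by
      rw [outcome_inp, extDigit, dif_pos (by omega)]
      congr 3
      omega
    have h2 : π.outcome m u z y (inp (i, ⟨b - 1, by omega⟩)) =
        extDigit (fun k => u (i, k)) (b - 1) := by
      rw [outcome_inp, extDigit, dif_pos (by omega)]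
      congr 3
      omega
    have h3 : π.outcome m u z y (agree (i, ⟨j + 1, hj⟩)) =
        (π.outcome m u z y (agree (i, ⟨j, by omega⟩)) && (!decide (π.inFrac + π.logBound ≤ j) ||
          (π.outcome m u z y (inp (i, ⟨j, by omega⟩)) ==
            π.outcome m u z y (inp (i, ⟨b - 1, by omega⟩))))) := by
      unfold outcome
      rw [final_eval_of_false _ _ rfl]
      by_cases h : π.inFrac + π.logBound ≤ j
      · simp only [finalTerms, h, if_true, termSum, Term.eval, List.map_cons, List.map_nil,
          List.foldr_cons, List.foldr_nil, decide_true, Bool.not_true, Bool.false_or]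
        generalize (π.finalProgram.eval _ m _ (agree _)) = a
        generalize (π.finalProgram.eval _ m _ (inp _)) = c
        generalize (π.finalProgram.eval _ m _ (inp _)) = d
        revert a c d
        decide
      · simp [finalTerms, termSum, Term.eval, h]
    rw [h3, h1, h2, Bool.and_eq_true, ih']
    simp only [Bool.or_eq_true, Bool.not_eq_true', decide_eq_false_iff_not, beq_iff_eq]
    constructor
    · rintro ⟨h4, h5⟩ l hl hfl
      rcases Nat.lt_succ_iff_lt_or_eq.1 hl with h | rfl
      · exact h4 l h hfl
      · exact h5.resolve_left (not_not.2 hfl)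
    · intro h
      refine ⟨fun l hl => h l (by omega), ?_⟩
      by_cases h6 : π.inFrac + π.logBound ≤ j
      · exact Or.inr (h j (by omega) h6)
      · exact Or.inl h6

theorem outcome_small (i : ℕ) (hi : i < n + 1) :
    π.outcome m u z y (small ⟨i, hi⟩) = true ↔ ∀ l : Fin n, l < i →
      π.outcome m u z y (agree (l, ⟨b, by omega⟩)) = true := by
  induction i with
  | zero =>
    unfold outcome
    rw [final_eval_of_false _ _ rfl]
    simp [finalTerms, termSum, Term.eval]
  | succ i ih =>
    have ih' := ih (by omega)
    have h3 : π.outcome m u z y (small ⟨i + 1, hi⟩) = (π.outcome m u z y (small ⟨i, by omega⟩) &&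
        π.outcome m u z y (agree (⟨i, by omega⟩, ⟨b, by omega⟩))) := by
      unfold outcome
      rw [final_eval_of_false _ _ rfl]
      simp [finalTerms, termSum, Term.eval]
    rw [h3, Bool.and_eq_true, ih']
    constructor
    · rintro ⟨h4, h5⟩ l hl
      rcases Nat.lt_succ_iff_lt_or_eq.1 hl with h | h
      · exact h4 l h
      · have : l = ⟨i, by omega⟩ := Fin.ext h
        rwa [this]
    · intro h
      exact ⟨fun l hl => h l (by omega), h _ (Nat.lt_succ_self i)⟩

theorem outcome_isSmall : π.outcome m u z y π.isSmall = true ↔ π.IsSmall u := by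
  unfold isSmall IsSmall
  rw [outcome_small]
  refine ⟨fun h i j hj => ?_, fun h l _ => (outcome_agree _ _ _).2 fun j _ => h l j⟩
  rcases lt_or_ge j b with hjb | hjb
  · exact (outcome_agree _ _ _).1 (h i i.2) j hjb hj
  · exact extDigit_of_le _ (by omega)

theorem outcome_memb (hu : π.IsSmall u) :
    π.outcome m u z y (memb 0) = m (π.gridPoint u (fun _ => 0) fun _ => 0) := by
  have h1 : π.outcome m u z y (memb 0) = m (fixedPoint (π.gridFrac + π.steps) fun k =>
      π.outcome m u z y (base k)) := by
    unfold outcome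
    rw [final_eval_of_false _ _ rfl]
    simp [finalTerms, termSum, Term.eval]
    rfl
  have h2 : ∀ i (j : Fin (π.top + 1)), π.outcome m u z y (base (i, j)) =
      π.ptDigit u (fun _ => 0) (fun _ => 0) i j := by
    intro i j
    unfold outcome
    rw [final_eval_of_false _ _ rfl]
    exact termSum_baseTerms (fun k => outcome_inp k) i j
  rw [h1]
  congr 1
  ext i
  rw [fixedPoint_eq _ _ h2, π.signedVal_ptDigit_eq hu (fun _ => by positivity) fun _ => by positivity]
  field_simp

theorem outcome_flag : π.outcome m u z y (flag 0) =
    (π.outcome m u z y (memb 0) && π.outcome m u z y π.isSmall) := by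
  unfold outcome
  rw [final_eval_of_false _ _ rfl]
  simp [finalTerms, termSum, Term.eval]

theorem outcome_flag_of_not (hu : ¬ π.IsSmall u) : π.outcome m u z y (flag 0) = false := by
  rw [← outcome_isSmall (m := m) (z := z) (y := y), Bool.not_eq_true] at hu
  rw [outcome_flag, hu, Bool.and_false]

theorem outcome_flag_of_isSmall (hu : π.IsSmall u) :
    π.outcome m u z y (flag 0) = m (π.gridPoint u (fun _ => 0) fun _ => 0) := by
  rw [outcome_flag, outcome_memb hu, outcome_isSmall.2 hu, Bool.and_true]

theorem outcome_out_zero (i : Fin n) (h : 0 < b + π.fineBits + 1) :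
    π.outcome m u z y (out (i, ⟨0, h⟩)) = true := by
  unfold outcome
  rw [final_eval_of_false _ _ rfl]
  simp [finalTerms, termSum, Term.eval]

theorem outcome_out_succ (i : Fin n) (j : ℕ) (h : j + 1 < b + π.fineBits + 1) :
    π.outcome m u z y (out (i, ⟨j + 1, h⟩)) = if π.outcome m u z y π.isSmall then
      (y i).testBit (min j (π.fineBits - 1)) else !extDigit (fun k => u (i, k)) j := by
  have hpos := π.fineBits_pos
  have h1 : π.outcome m u z y (fine (i, ⟨π.fineBits - 1 - min j (π.fineBits - 1), by omega⟩)) =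
      (y i).testBit (min j (π.fineBits - 1)) := by
    unfold outcome
    rw [final_eval_of_nil _ _ rfl, freqState_fine]
    congr 1
    simp only
    omega
  have h2 : termSum (π.gridFrac + π.steps) m (π.extTerms i j) (π.outcome m u z y) =
      extDigit (fun k => u (i, k)) j := termSum_extTerms outcome_inp i j
  rw [← h1, ← h2]
  unfold outcome extTerms
  rw [final_eval_of_false _ _ rfl]
  by_cases hb : 0 < b
  · simp only [finalTerms, dif_pos hb, termSum, Term.eval, List.map_cons, List.map_nil,
      List.foldr_cons, List.foldr_nil, List.cons_append, List.nil_append, Bool.xor_false]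
    generalize (π.finalProgram.eval _ m _ π.isSmall) = a
    generalize (π.finalProgram.eval _ m _ (fine _)) = c
    generalize (π.finalProgram.eval _ m _ (inp _)) = d
    revert a c d
    decide
  · simp only [finalTerms, dif_neg hb, termSum, Term.eval, List.map_cons, List.map_nil,
      List.foldr_cons, List.foldr_nil, List.append_nil, Bool.xor_false]
    generalize (π.finalProgram.eval _ m _ π.isSmall) = a
    generalize (π.finalProgram.eval _ m _ (fine _)) = c
    revert a c
    decide

theorem outcomeVector_apply (i : Fin n) (e : ℕ → Bool) (h : ∀ j (h : j + 1 < b + π.fineBits + 1),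
      π.outcome m u z y (out (i, ⟨j + 1, h⟩)) = e j) :
    π.outcomeVector m u z y i = 2 * (signedVal e (b + π.fineBits - 1) : ℝ) + 1 := by
  have hpos := π.fineBits_pos
  unfold outcomeVector fixedPoint
  simp only
  rw [twosComplement_eq_signedVal _ (fun j => Nat.casesOn j true e)]
  · obtain ⟨D, hD⟩ : ∃ D, b + π.fineBits = 1 + D := ⟨b + π.fineBits - 1, by omega⟩
    rw [hD, signedVal_add]
    simp [unsignedVal, add_comm 1]
    ring
  · rintro ⟨_ | j, hj⟩
    · exact outcome_out_zero _ _
    · exact h j hj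

/-- The frequency as a signed number. -/
def signedFreq (π : Params n b) (y : ℕ) : ℤ := signedVal (fun j => y.testBit j) (π.fineBits - 1)

/-- The signed value is the representative of the frequency centred at zero. Signs matter because
the subgradient has coordinates of both signs. -/
theorem signedFreq_cast (y : ZMod (2 ^ π.fineBits)) : (π.signedFreq y.val : ZMod (2 ^ π.fineBits)) = y := by
  obtain ⟨q, hq⟩ : ∃ q, π.fineBits = q + 1 := ⟨π.fineBits - 1, by have := π.fineBits_pos; omega⟩
  have h := signedVal_eq (fun j => y.val.testBit j) (π.fineBits - 1)
  rw [Nat.sub_add_cancel π.fineBits_pos, unsignedVal_testBit (ZMod.val_lt y)] at h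
  unfold signedFreq
  rw [h]
  have h2 : ((2 : ZMod (2 ^ π.fineBits)) ^ π.fineBits) = 0 := by
    have := ZMod.natCast_self (2 ^ π.fineBits)
    push_cast at this
    exact this
  push_cast
  rw [h2]
  simp

theorem abs_signedFreq_le (y : ℕ) : 2 * |(π.signedFreq y : ℝ)| ≤ 2 ^ π.fineBits := by
  obtain ⟨q, hq⟩ : ∃ q, π.fineBits = q + 1 := ⟨π.fineBits - 1, by have := π.fineBits_pos; omega⟩
  have h : |π.signedFreq y| ≤ 2 ^ (π.fineBits - 1) :=
    abs_le.2 ⟨le_signedVal _ _, (signedVal_lt _ _).le⟩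
  have h2 : |(π.signedFreq y : ℝ)| ≤ 2 ^ (π.fineBits - 1) := by exact_mod_cast h
  rw [hq] at h2 ⊢
  rw [pow_succ]
  rw [Nat.add_sub_cancel] at h2
  linarith

theorem outcomeVector_of_isSmall (hu : π.IsSmall u) (i : Fin n) :
    π.outcomeVector m u z y i = 2 * (π.signedFreq (y i) : ℝ) + 1 := by
  have hpos := π.fineBits_pos
  rw [outcomeVector_apply i fun j => (y i).testBit (min j (π.fineBits - 1))]
  · have h1 : signedVal (fun j => (y i).testBit (min j (π.fineBits - 1))) (b + π.fineBits - 1) =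
        signedVal (fun j => (y i).testBit (min j (π.fineBits - 1))) (π.fineBits - 1) :=
      signedVal_of_const (by omega) fun j hj _ => by simp [hj]
    rw [h1, signedFreq, signedVal_congr (e' := fun j => (y i).testBit j)]
    intro j hj
    simp [hj]
  · intro j hj
    rw [outcome_out_succ, if_pos (outcome_isSmall.2 hu)]

/-- Complementing digits sends v to -v - 1, and appending the digit one then gives 2(-v - 1) + 1 =
-(2v + 1). -/
theorem outcomeVector_of_not (hu : ¬ π.IsSmall u) (i : Fin n) :
    π.outcomeVector m u z y i = -(2 * (twosComplement fun k => u (i, k) : ℝ) + 1) := by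
  have hpos := π.fineBits_pos
  rw [outcomeVector_apply i fun j => !extDigit (fun k => u (i, k)) j]
  · rw [signedVal_not, signedVal_extDigit _ (by omega)]
    push_cast
    ring
  · intro j hj
    rw [outcome_out_succ, if_neg (mt outcome_isSmall.1 hu)]

theorem outcomeVector_apply_ne_zero (i : Fin n) : π.outcomeVector m u z y i ≠ 0 := by
  have key : ∀ k : ℤ, (2 * (k : ℝ) + 1) ≠ 0 := fun k h => by
    have : 2 * k + 1 = 0 := by exact_mod_cast h
    omega
  by_cases hu : π.IsSmall u
  · rw [outcomeVector_of_isSmall hu]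
    exact key _
  · rw [outcomeVector_of_not hu]
    exact neg_ne_zero.2 (key _)

end Params

theorem norm_le_mul_of_forall_abs_le {n : ℕ} {v : EuclideanSpace ℝ (Fin n)} {c : ℝ}
    (hv : ∀ i, |v i| ≤ c) : ‖v‖ ≤ n * c := by
  rcases Nat.eq_zero_or_pos n with rfl | hn
  · simp [Subsingleton.elim v 0]
  have hc : 0 ≤ c := (abs_nonneg _).trans (hv ⟨0, hn⟩)
  have hn' : (1 : ℝ) ≤ n := by exact_mod_cast hn
  refine abs_le_of_sq_le_sq' ?_ (by positivity) |>.2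
  rw [EuclideanSpace.norm_sq_eq]
  refine (Finset.sum_le_card_nsmul _ _ (c ^ 2) fun i _ => ?_).trans ?_
  · rw [Real.norm_eq_abs]
    exact pow_le_pow_left₀ (abs_nonneg _) (hv i) 2
  · rw [Finset.card_univ, Fintype.card_fin, nsmul_eq_mul, mul_pow]
    exact mul_le_mul_of_nonneg_right (by nlinarith) (sq_nonneg c)

namespace Params

variable {n b : ℕ} {π : Params n b} {m : EuclideanSpace ℝ (Fin n) → Bool}
  {u : Fin n × Fin b → Bool} {K : Set (EuclideanSpace ℝ (Fin n))} {r δ : ℝ}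

open Wire

/-! ### Differences of the phase function -/

theorem abs_searchSum_sub_le (hK : Convex ℝ K) (hr : 0 < r) (hrK : Metric.closedBall 0 r ⊆ K)
    (hδ : 0 ≤ δ) (hm : IsMembershipOracle K δ m) (hu : π.IsSmall u) {x z : Fin n → ℕ}
    (hx : ∀ i, x i < 2 ^ π.fineBits) (hz : ∀ i, z i < 2 ^ π.coarseBits)
    (hhalf : 1 / 2 ≤ gauge K (π.gridPoint u x z)) :
    |searchSum π m u x z π.steps - (gauge K (π.gridPoint u x z))⁻¹| ≤
      2 * (δ / r) + 2 * (1 / 2) ^ π.steps :=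
  abs_search_sub_inv_gauge_le hK hr hrK hδ hm _ hhalf (searchAnswer π m u x z)
    (searchSum π m u x z) (by simp [searchSum])
    (fun k => by rw [searchSum, Finset.sum_range_succ]; rfl) π.steps
    fun k hk => searchAnswer_eq hu hx hz k hk

/-- The side length of the fine grid. -/
def side (π : Params n b) : ℝ := 2 ^ π.fineBits / 2 ^ π.gridFrac

theorem gridPoint_eq_add (x z : Fin n → ℕ) :
    π.gridPoint u x z = π.gridPoint u 0 z + WithLp.toLp 2 fun i => (x i : ℝ) / 2 ^ π.gridFrac := by
  ext i
  simp only [gridPoint, PiLp.add_apply, Pi.zero_apply]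
  push_cast
  ring

theorem gridPoint_update (z : Fin n → ℕ) (i : Fin n) :
    π.gridPoint u 0 (Function.update z i (z i + n)) =
      π.gridPoint u 0 z + (n * π.side) • EuclideanSpace.single i 1 := by
  ext j
  simp only [gridPoint, PiLp.add_apply, Pi.zero_apply, PiLp.smul_apply, smul_eq_mul, side,
    PiLp.single_apply]
  by_cases h : j = i
  · subst h
    simp
    ring
  · simp [h]

/-- The change of the subgradients `F` near the grid point with coarse offset `z`. -/
def gradientChange (π : Params n b) (F : (Fin n → ℕ) → EuclideanSpace ℝ (Fin n) →ₗ[ℝ] ℝ)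
    (z : Fin n → ℕ) : ℝ :=
  π.side * ∑ i, (F (Function.update z i (z i + n)) (EuclideanSpace.single i 1) -
    F z (EuclideanSpace.single i 1))

theorem side_pos : 0 < π.side := by
  unfold side
  positivity

/-- The fine grid fills one box of the coarse grid, and the end points at distance n times its side
are themselves coarse grid points. So the bound involves subgradients at coarse points only, which
is what makes averaging possible. -/
theorem gauge_gridPoint_sub_le (hK : Convex ℝ K) (hr : 0 < r) (hrK : Metric.closedBall 0 r ⊆ K)
    (hn : 0 < n) {F : (Fin n → ℕ) → EuclideanSpace ℝ (Fin n) →ₗ[ℝ] ℝ}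
    (hF : ∀ z, IsSupporting K (π.gridPoint u 0 z) (F z)) {x : Fin n → ℕ} (z : Fin n → ℕ)
    (hx : ∀ i, x i < 2 ^ π.fineBits) :
    gauge K (π.gridPoint u x z) - gauge K (π.gridPoint u 0 z) -
      F z (WithLp.toLp 2 fun i => (x i : ℝ) / 2 ^ π.gridFrac) ≤ π.gradientChange F z := by
  rw [gridPoint_eq_add]
  refine (hF z).gauge_sub_le hK hr hrK hn π.side_pos
    (fun i => F (Function.update z i (z i + n))) (fun i => ?_) _ (fun i => by positivity) fun i => ?_
  · rw [← gridPoint_update]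
    exact hF _
  · unfold side
    have : (x i : ℝ) ≤ 2 ^ π.fineBits := by exact_mod_cast (hx i).le
    gcongr

theorem gradientChange_nonneg (hK : Convex ℝ K) (hr : 0 < r) (hrK : Metric.closedBall 0 r ⊆ K)
    (hn : 0 < n) {F : (Fin n → ℕ) → EuclideanSpace ℝ (Fin n) →ₗ[ℝ] ℝ}
    (hF : ∀ z, IsSupporting K (π.gridPoint u 0 z) (F z)) (z : Fin n → ℕ) :
    0 ≤ π.gradientChange F z := by
  have h1 := gauge_gridPoint_sub_le hK hr hrK hn hF (x := fun _ => 0) z fun _ => by positivity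
  have h2 := (hF z).sub_nonneg (WithLp.toLp 2 fun i => ((0 : ℕ) : ℝ) / 2 ^ π.gridFrac)
  rw [gridPoint_eq_add] at h1
  exact h2.trans h1

/-- Coordinates of subgradients are bounded by 1/r, so each coordinate direction telescopes. The
factor 1/M is the gain from the random offset. -/
theorem sum_gradientChange_le (hr : 0 < r) (hrK : Metric.closedBall 0 r ⊆ K)
    {F : (Fin n → ℕ) → EuclideanSpace ℝ (Fin n) →ₗ[ℝ] ℝ}
    (hF : ∀ z, IsSupporting K (π.gridPoint u 0 z) (F z)) {M : ℕ} (hM : 0 < M) :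
    ((M : ℝ) ^ n)⁻¹ * ∑ z : Fin n → Fin M, π.gradientChange F (fun i => z i) ≤
      π.side * (n * (2 * n * (1 / r) / M)) := by
  have hM' : (0 : ℝ) < M := by exact_mod_cast hM
  unfold gradientChange
  rw [← Finset.mul_sum, Finset.sum_comm, mul_left_comm]
  refine mul_le_mul_of_nonneg_left ?_ π.side_pos.le
  rw [Finset.mul_sum]
  refine (Finset.sum_le_card_nsmul _ _ (2 * n * (1 / r) / M) fun i _ => ?_).trans (le_of_eq ?_)
  · have h := sum_shift_sub_le (M := M) (fun z => F z (EuclideanSpace.single i 1)) (1 / r)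
      (fun z => by simpa using (hF z).abs_apply_le hr hrK (EuclideanSpace.single i 1)) i n
    rw [inv_mul_le_iff₀ (by positivity), ← mul_div_assoc, le_div_iff₀ hM', mul_comm _ (M : ℝ)]
    exact h
  · simp

theorem abs_gauge_gridPoint_sub_le (hK : Convex ℝ K) (hr : 0 < r)
    (hrK : Metric.closedBall 0 r ⊆ K) {x : Fin n → ℕ} (z : Fin n → ℕ)
    (hx : ∀ i, x i < 2 ^ π.fineBits) :
    |gauge K (π.gridPoint u x z) - gauge K (π.gridPoint u 0 z)| ≤ n * π.side / r := by
  have hnorm : ‖π.gridPoint u x z - π.gridPoint u 0 z‖ ≤ n * π.side := by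
    rw [gridPoint_eq_add, add_sub_cancel_left]
    refine norm_le_mul_of_forall_abs_le fun i => ?_
    simp only
    rw [abs_of_nonneg (by positivity)]
    unfold side
    have : (x i : ℝ) ≤ 2 ^ π.fineBits := by exact_mod_cast (hx i).le
    gcongr
  have h1 := gauge_le_add_norm_sub_div hK hr hrK (π.gridPoint u x z) (π.gridPoint u 0 z)
  have h2 := gauge_le_add_norm_sub_div hK hr hrK (π.gridPoint u 0 z) (π.gridPoint u x z)
  rw [norm_sub_rev] at h2
  have h3 : ‖π.gridPoint u x z - π.gridPoint u 0 z‖ / r ≤ n * π.side / r := by gcongr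
  rw [abs_le]
  constructor <;> linarith

/-- The search result equals an affine function of the fine offset, with slope -f/γ², up to one
common error bound. Subtracting two neighbouring points doubles that bound and leaves the slope. -/
theorem abs_searchPhase_sub_le (hK : Convex ℝ K) (hr : 0 < r) (hrK : Metric.closedBall 0 r ⊆ K)
    (hn : 0 < n) (hδ : 0 ≤ δ) (hm : IsMembershipOracle K δ m) (hu : π.IsSmall u)
    (hscale : 0 ≤ π.scale) {F : (Fin n → ℕ) → EuclideanSpace ℝ (Fin n) →ₗ[ℝ] ℝ}
    (hF : ∀ z, IsSupporting K (π.gridPoint u 0 z) (F z))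
    (hhalf : ∀ x z : Fin n → ℕ, (∀ i, x i < 2 ^ π.fineBits) → (∀ i, z i < 2 ^ π.coarseBits) →
      1 / 2 ≤ gauge K (π.gridPoint u x z))
    {x z : Fin n → ℕ} (hx : ∀ i, x i < 2 ^ π.fineBits) (hz : ∀ i, z i < 2 ^ π.coarseBits)
    (i : Fin n) (hxi : x i + 1 < 2 ^ π.fineBits) :
    |π.searchPhase m (π.gridState u (Function.update x i (x i + 1)) z) -
      π.searchPhase m (π.gridState u x z) -
      -(π.scale / 2 ^ π.gridFrac / gauge K (π.gridPoint u 0 z) ^ 2) *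
        F z (EuclideanSpace.single i 1)| ≤
      π.scale * (8 * π.gradientChange F z + 16 * (n * π.side / r) ^ 2 +
        2 * (2 * (δ / r) + 2 * (1 / 2) ^ π.steps)) := by
  have hx' : ∀ j, Function.update x i (x i + 1) j < 2 ^ π.fineBits := by
    intro j
    by_cases h : j = i
    · subst h
      simpa using hxi
    · simpa [h] using hx j
  have key : ∀ x : Fin n → ℕ, (∀ i, x i < 2 ^ π.fineBits) →
      |searchSum π m u x z π.steps - (gauge K (π.gridPoint u 0 z))⁻¹ +
        F z (WithLp.toLp 2 fun i => (x i : ℝ) / 2 ^ π.gridFrac) /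
          gauge K (π.gridPoint u 0 z) ^ 2| ≤
      4 * π.gradientChange F z + 8 * (n * π.side / r) ^ 2 +
        (2 * (δ / r) + 2 * (1 / 2) ^ π.steps) := by
    intro x hx
    have h0 : 0 ≤ gauge K (π.gridPoint u x z) - gauge K (π.gridPoint u 0 z) -
        F z (WithLp.toLp 2 fun i => (x i : ℝ) / 2 ^ π.gridFrac) := by
      rw [gridPoint_eq_add]
      exact (hF z).sub_nonneg _
    have h1 := abs_searchSum_sub_le hK hr hrK hδ hm hu hx hz (hhalf x z hx hz)
    have h2 := abs_inv_sub_inv_add_le (hhalf 0 z (fun _ => by simp) hz)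
      (hhalf x z hx hz) _ h0 (gauge_gridPoint_sub_le hK hr hrK hn hF z hx)
    have h3 : (gauge K (π.gridPoint u x z) - gauge K (π.gridPoint u 0 z)) ^ 2 ≤
        (n * π.side / r) ^ 2 :=
      sq_le_sq' (abs_le.1 (abs_gauge_gridPoint_sub_le hK hr hrK z hx)).1
        (abs_le.1 (abs_gauge_gridPoint_sub_le hK hr hrK z hx)).2
    rw [abs_le] at h1 h2 ⊢
    constructor <;> linarith
  have h1 := key x hx
  have h2 := key _ hx'
  have h3 : (WithLp.toLp 2 fun j => ((Function.update x i (x i + 1) j : ℕ) : ℝ) / 2 ^ π.gridFrac :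
      EuclideanSpace ℝ (Fin n)) = (WithLp.toLp 2 fun j => (x j : ℝ) / 2 ^ π.gridFrac) +
        (1 / 2 ^ π.gridFrac : ℝ) • EuclideanSpace.single i 1 := by
    ext j
    simp only [PiLp.add_apply, PiLp.smul_apply, smul_eq_mul, PiLp.single_apply]
    by_cases h : j = i
    · subst h
      simp
      ring
    · simp [h]
  rw [h3, map_add, map_smul, smul_eq_mul] at h2
  have h4 : π.searchPhase m (π.gridState u (Function.update x i (x i + 1)) z) -
      π.searchPhase m (π.gridState u x z) -
      -(π.scale / 2 ^ π.gridFrac / gauge K (π.gridPoint u 0 z) ^ 2) *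
        F z (EuclideanSpace.single i 1) = π.scale *
      ((searchSum π m u (Function.update x i (x i + 1)) z π.steps -
        (gauge K (π.gridPoint u 0 z))⁻¹ +
        (F z (WithLp.toLp 2 fun i => (x i : ℝ) / 2 ^ π.gridFrac) +
          1 / 2 ^ π.gridFrac * F z (EuclideanSpace.single i 1)) /
          gauge K (π.gridPoint u 0 z) ^ 2) -
      (searchSum π m u x z π.steps - (gauge K (π.gridPoint u 0 z))⁻¹ +
        F z (WithLp.toLp 2 fun i => (x i : ℝ) / 2 ^ π.gridFrac) /
          gauge K (π.gridPoint u 0 z) ^ 2)) := by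
    rw [searchPhase_gridState, searchPhase_gridState]
    ring
  rw [h4, abs_mul, abs_of_nonneg hscale]
  refine mul_le_mul_of_nonneg_left ?_ hscale
  rw [abs_le] at h1 h2 ⊢
  constructor <;> linarith

open Classical in
theorem one_le_prob_circuit {η : ℝ} {p : EuclideanSpace ℝ (Fin n)}
    (h : ∀ (z : Fin n → ℕ) (y : Fin n → ZMod (2 ^ π.fineBits)),
      CorrectAnswer K η p (π.outcome m u z (fun i => (y i).val) (flag 0))
        (π.outcomeVector m u z fun i => (y i).val)) :
    1 ≤ π.circuit.prob m u (π.circuit.correct K η p) := by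
  refine le_trans (le_of_eq ?_) (π.le_prob_circuit m u K η p)
  rw [← π.sum_weight m u]
  refine Finset.sum_congr rfl fun z _ => Finset.sum_congr rfl fun y _ => ?_
  rw [if_pos (h _ y)]

end Params

/-- A ball of radius η contains two points at distance 2η, whereas K has diameter at most 2R. -/
theorem deepInterior_eq_empty {n : ℕ} (hn : 0 < n) {K : Set (EuclideanSpace ℝ (Fin n))} {R η : ℝ}
    (hKR : K ⊆ Metric.closedBall 0 R) (hη : 0 < η) (hR : R < η) : deepInterior K η = ∅ := by
  refine Set.eq_empty_iff_forall_notMem.2 fun y hy => ?_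
  set e : EuclideanSpace ℝ (Fin n) := EuclideanSpace.single ⟨0, hn⟩ 1
  have he : ‖e‖ = 1 := by simp [e]
  have h1 : ∀ c : ℝ, |c| = η → ‖y + c • e‖ ≤ R := fun c hc => by
    have : y + c • e ∈ K := hy (by simp [norm_smul, he, hc])
    simpa using hKR this
  have h2 := h1 η (abs_of_pos hη)
  have h3 := h1 (-η) (by rw [abs_neg, abs_of_pos hη])
  have h4 := norm_sub_le (y + η • e) (y + (-η) • e)
  rw [show y + η • e - (y + (-η) • e) = (2 * η) • e by rw [neg_smul, two_mul, add_smul]; abel,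
    norm_smul, he, Real.norm_eq_abs, abs_of_pos (by linarith)] at h4
  linarith

theorem neighborhood_mono_of_norm_sub_le {n : ℕ} {K : Set (EuclideanSpace ℝ (Fin n))}
    {δ ε η : ℝ} {p x : EuclideanSpace ℝ (Fin n)} (hx : x ∈ neighborhood K δ) (hp : ‖p - x‖ ≤ ε)
    (h : δ + ε ≤ η) : p ∈ neighborhood K η := by
  obtain ⟨y, hy, hxy⟩ := hx
  refine ⟨y, hy, ?_⟩
  have := norm_sub_le_norm_sub_add_norm_sub p x y
  linarith

namespace Params

variable {n b : ℕ} {π : Params n b} {m : EuclideanSpace ℝ (Fin n) → Bool}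
  {u : Fin n × Fin b → Bool} {K : Set (EuclideanSpace ℝ (Fin n))} {r R δ η : ℝ}
  {p : EuclideanSpace ℝ (Fin n)} {x z : Fin n → ℕ}

open Wire

/-! ### Distances between the input and the grid points -/

theorem offset_bounds (hx : ∀ i, x i < 2 ^ π.fineBits) (hz : ∀ i, z i < 2 ^ π.coarseBits)
    (i : Fin n) : 0 ≤ (x i + 2 ^ π.fineBits * z i : ℝ) / 2 ^ π.gridFrac ∧
      (x i + 2 ^ π.fineBits * z i : ℝ) / 2 ^ π.gridFrac ≤ 1 / 2 ^ π.baseFrac := by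
  refine ⟨by positivity, ?_⟩
  have h1 : (x i : ℝ) + 1 ≤ 2 ^ π.fineBits := by exact_mod_cast hx i
  have h2 : (z i : ℝ) + 1 ≤ 2 ^ π.coarseBits := by exact_mod_cast hz i
  rw [div_le_div_iff₀ (by positivity) (by positivity), one_mul, gridFrac, pow_add, pow_add]
  have h3 : (2 : ℝ) ^ π.fineBits * (z i + 1) ≤ 2 ^ π.fineBits * 2 ^ π.coarseBits :=
    mul_le_mul_of_nonneg_left h2 (by positivity)
  have h4 : (x i + 2 ^ π.fineBits * z i : ℝ) ≤ 2 ^ π.fineBits * 2 ^ π.coarseBits := by linarith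
  have h5 := mul_le_mul_of_nonneg_right h4 (show (0 : ℝ) ≤ 2 ^ π.baseFrac by positivity)
  linarith

theorem norm_sub_gridPoint_le (hu : π.IsSmall u) (hp : ‖p - fixedPoint π.inFrac u‖ ≤ δ)
    (hx : ∀ i, x i < 2 ^ π.fineBits) (hz : ∀ i, z i < 2 ^ π.coarseBits) :
    ‖p - π.gridPoint u x z‖ ≤ δ + n * (1 / 2 ^ π.baseFrac) := by
  have h1 : ‖fixedPoint π.inFrac u - π.gridPoint u x z‖ ≤ n * (1 / 2 ^ π.baseFrac) := by
    refine norm_le_mul_of_forall_abs_le fun i => ?_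
    have h2 := π.baseVal_bounds hu i
    have h3 := π.offset_bounds hx hz i
    simp only [PiLp.sub_apply, gridPoint]
    rw [abs_le]
    constructor <;> linarith
  have := norm_sub_le_norm_sub_add_norm_sub p (fixedPoint π.inFrac u) (π.gridPoint u x z)
  linarith

theorem norm_gridPoint_sub_le (hx : ∀ i, x i < 2 ^ π.fineBits) (hz : ∀ i, z i < 2 ^ π.coarseBits) :
    ‖π.gridPoint u (fun _ => 0) (fun _ => 0) - π.gridPoint u x z‖ ≤ n * (1 / 2 ^ π.baseFrac) := by
  refine norm_le_mul_of_forall_abs_le fun i => ?_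
  have h3 := π.offset_bounds hx hz i
  simp only [PiLp.sub_apply, gridPoint]
  rw [abs_le]
  constructor <;> simp only [Nat.cast_zero, mul_zero, add_zero, zero_div, zero_add] <;> linarith

theorem norm_gridPoint_le (hx : ∀ i, x i < 2 ^ π.fineBits) (hz : ∀ i, z i < 2 ^ π.coarseBits) :
    ‖π.gridPoint u x z‖ ≤ n * (2 ^ π.logBound + 1 / 2 ^ π.baseFrac) := by
  refine norm_le_mul_of_forall_abs_le fun i => ?_
  have h3 := π.offset_bounds hx hz i
  have h4 : |(π.baseVal u i : ℝ)| ≤ 2 ^ (π.baseFrac + π.logBound) := by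
    exact_mod_cast π.abs_baseVal_le u i
  have h5 : |(π.baseVal u i : ℝ) / 2 ^ π.baseFrac| ≤ 2 ^ π.logBound := by
    rw [abs_div, abs_of_pos (show (0 : ℝ) < 2 ^ π.baseFrac by positivity),
      div_le_iff₀ (by positivity), ← pow_add, add_comm π.logBound]
    exact h4
  simp only [gridPoint]
  rw [abs_le] at h5 ⊢
  constructor <;> linarith

/-! ### Correctness of the answers -/

theorem outcomeVector_ne_zero (hn : 0 < n) {z y : Fin n → ℕ} : π.outcomeVector m u z y ≠ 0 :=
  fun h => outcomeVector_apply_ne_zero (m := m) (u := u) (z := z) (y := y) (π := π) ⟨0, hn⟩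
    (by rw [h]; rfl)

/-- Some coordinate of the input exceeds R + n + 1 in absolute value, so p is outside the ball that
contains K, with enough margin that the direction opposite to the rounded input separates it with no
error at all. -/
theorem correctAnswer_of_not_isSmall (hn : 0 < n) (hη : 0 ≤ η) (hKR : K ⊆ Metric.closedBall 0 R)
    (hp : ‖p - fixedPoint π.inFrac u‖ ≤ δ) (hδ : δ ≤ 1 / 2)
    (hR : R + n + 1 ≤ 2 ^ π.logBound) (hu : ¬ π.IsSmall u) (z y : Fin n → ℕ) :
    CorrectAnswer K η p (π.outcome m u z y (flag 0)) (π.outcomeVector m u z y) := by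
  have hn' : (1 : ℝ) ≤ n := by exact_mod_cast hn
  refine Or.inr ⟨outcome_flag_of_not hu, outcomeVector_ne_zero hn,
    isSeparatingDirection_of_forall (outcomeVector_ne_zero hn) fun y' hy' => ?_⟩
  refine le_trans ?_ (mul_nonneg hη (norm_nonneg _))
  have hyR : ‖y'‖ ≤ R := by simpa using hKR (deepInterior_subset K hη hy')
  -- The half unit in the last place accounts for the output digit that is always one; with it the
  -- output is exactly a negative multiple of q.
  set q : EuclideanSpace ℝ (Fin n) := WithLp.toLp 2 fun i =>
    fixedPoint π.inFrac u i + 1 / 2 ^ (π.inFrac + 1) with hq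
  have hc : π.outcomeVector m u z y = (-2 ^ (π.inFrac + 1) : ℝ) • q := by
    ext i
    rw [outcomeVector_of_not hu]
    simp only [PiLp.smul_apply, hq, smul_eq_mul, fixedPoint, pow_succ]
    field_simp
  have h1 : ‖fixedPoint π.inFrac u - q‖ ≤ n * (1 / 2) := by
    refine norm_le_mul_of_forall_abs_le fun i => ?_
    simp only [hq, PiLp.sub_apply]
    rw [sub_add_cancel_left, abs_neg, abs_of_nonneg (by positivity), pow_succ]
    have : (1 : ℝ) ≤ 2 ^ π.inFrac := one_le_pow₀ (by norm_num)
    rw [div_le_div_iff₀ (by positivity) (by norm_num)]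
    linarith
  have h2 : ‖p - q‖ ≤ n := by
    have := norm_sub_le_norm_sub_add_norm_sub p (fixedPoint π.inFrac u) q
    linarith
  have h3 : R + n ≤ ‖q‖ := by
    unfold IsSmall at hu
    push Not at hu
    obtain ⟨i, j, hj, hne⟩ := hu
    have hjb : j < b - 1 := by
      by_contra! h
      exact hne (extDigit_of_le _ h)
    have h4 := le_abs_signedVal_of_ne hjb hne
    rw [signedVal_extDigit _ le_rfl] at h4
    have h5 : (2 : ℝ) ^ (π.inFrac + π.logBound) ≤ |(twosComplement fun k => u (i, k) : ℝ)| := by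
      have : (2 : ℤ) ^ (π.inFrac + π.logBound) ≤ 2 ^ j := pow_le_pow_right₀ (by norm_num) hj
      exact_mod_cast this.trans h4
    have h6 : (2 : ℝ) ^ π.logBound ≤ |fixedPoint π.inFrac u i| := by
      simp only [fixedPoint]
      rw [abs_div, abs_of_pos (show (0 : ℝ) < 2 ^ π.inFrac by positivity),
        le_div_iff₀ (by positivity), ← pow_add, add_comm π.logBound]
      exact h5
    have h7 := PiLp.norm_apply_le q i
    have h8 : q i = fixedPoint π.inFrac u i + 1 / 2 ^ (π.inFrac + 1) := rfl
    have h9 : (1 : ℝ) / 2 ^ (π.inFrac + 1) ≤ 1 :=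
      (div_le_one (by positivity)).2 (one_le_pow₀ (by norm_num))
    have h10 : (0 : ℝ) ≤ 1 / 2 ^ (π.inFrac + 1) := by positivity
    rw [Real.norm_eq_abs, h8] at h7
    have h11 := abs_sub_abs_le_abs_sub (fixedPoint π.inFrac u i) (-(1 / 2 ^ (π.inFrac + 1)))
    rw [sub_neg_eq_add, abs_neg, abs_of_nonneg h10] at h11
    linarith
  have h4 : inner ℝ q (p - y') = ‖q‖ ^ 2 + inner ℝ q (p - q - y') := by
    rw [← real_inner_self_eq_norm_sq, ← inner_add_right]
    congr 1
    abel
  have h5 := abs_real_inner_le_norm q (p - q - y')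
  have h6 : ‖p - q - y'‖ ≤ n + R := (norm_sub_le _ _).trans (by linarith)
  have h7 : 0 ≤ inner ℝ q (p - y') := by
    rw [h4]
    have := (abs_le.1 h5).1
    nlinarith [norm_nonneg q]
  rw [hc, real_inner_smul_left]
  have : (0 : ℝ) < 2 ^ (π.inFrac + 1) := by positivity
  nlinarith

theorem correctAnswer_of_flag (hm : IsMembershipOracle K δ m) (hu : π.IsSmall u)
    (hp : ‖p - fixedPoint π.inFrac u‖ ≤ δ) (hη : 2 * δ + n * (1 / 2 ^ π.baseFrac) ≤ η)
    (hflag : m (π.gridPoint u (fun _ => 0) fun _ => 0) = true) (z y : Fin n → ℕ) :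
    CorrectAnswer K η p (π.outcome m u z y (flag 0)) (π.outcomeVector m u z y) := by
  refine Or.inl ⟨by rw [outcome_flag_of_isSmall hu, hflag], ?_⟩
  exact neighborhood_mono_of_norm_sub_le ((hm _).1 hflag) (norm_sub_gridPoint_le hu hp
    (fun _ => by positivity) fun _ => by positivity) (by linarith)

theorem correctAnswer_of_deepInterior_eq_empty (hn : 0 < n) (hK : deepInterior K η = ∅)
    {z y : Fin n → ℕ} (hflag : π.outcome m u z y (flag 0) = false) :
    CorrectAnswer K η p (π.outcome m u z y (flag 0)) (π.outcomeVector m u z y) := by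
  refine Or.inr ⟨hflag, outcomeVector_ne_zero hn,
    isSeparatingDirection_of_forall (outcomeVector_ne_zero hn) fun y' hy' => ?_⟩
  rw [hK] at hy'
  exact hy'.elim

/-- A frequency that is close to the scaled subgradient gives a separating direction. -/
theorem correctAnswer_of_close (hn : 0 < n) (hr : 0 < r) (hrK : Metric.closedBall 0 r ⊆ K)
    (hKR : K ⊆ Metric.closedBall 0 R) (hη : 0 ≤ η) (hu : π.IsSmall u)
    (hflag : m (π.gridPoint u (fun _ => 0) fun _ => 0) = false)
    {x : EuclideanSpace ℝ (Fin n)} {f : EuclideanSpace ℝ (Fin n) →ₗ[ℝ] ℝ}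
    (hf : IsSupporting K x f) (hx : 1 / 2 ≤ gauge K x) {z : Fin n → ℕ}
    {y : Fin n → ZMod (2 ^ π.fineBits)} {α β ε X P : ℝ} (hα : 0 < α) (hε : 0 ≤ ε)
    (hf4 : ∀ i, |-α * f (EuclideanSpace.single i 1)| ≤ 1 / 4)
    (hy : ∑ i, ‖(ZMod.stdAddChar (y i) : ℂ) - phase (-α * f (EuclideanSpace.single i 1))‖ ^ 2 <
      ε ^ 2)
    (hβ : 1 - gauge K x + ‖p - x‖ / r ≤ β) (hX : ‖x‖ ≤ X) (hX0 : 0 < X) (hP : ‖p‖ ≤ P)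
    (hmain : α * β + (ε + n * (1 / 2 ^ π.fineBits)) * (P + R + η) ≤ η * (α / (2 * X))) :
    CorrectAnswer K η p (π.outcome m u z (fun i => (y i).val) (flag 0))
      (π.outcomeVector m u z fun i => (y i).val) := by
  have hv := outcomeVector_ne_zero (m := m) (u := u) (z := z) (y := fun i => (y i).val) (π := π) hn
  refine Or.inr ⟨by rw [outcome_flag_of_isSmall hu, hflag], hv, ?_⟩
  set v := π.outcomeVector m u z fun i => (y i).val with hv_def
  have hN : (0 : ℝ) < (2 * 2 ^ π.fineBits)⁻¹ := by positivity
  set c : EuclideanSpace ℝ (Fin n) := (2 * 2 ^ π.fineBits : ℝ)⁻¹ • v with hc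
  have hcv : ‖v‖⁻¹ • v = ‖c‖⁻¹ • c := by
    rw [hc, norm_smul, smul_smul, Real.norm_eq_abs, abs_of_pos hN, mul_inv, mul_right_comm,
      inv_mul_cancel₀ hN.ne', one_mul]
  rw [hcv]
  set ω : EuclideanSpace ℝ (Fin n) :=
    WithLp.toLp 2 fun i => -α * f (EuclideanSpace.single i 1) with hω
  set w : EuclideanSpace ℝ (Fin n) :=
    WithLp.toLp 2 fun i => (π.signedFreq (y i).val : ℝ) / 2 ^ π.fineBits with hw
  have h1 : ‖w - ω‖ ≤ ε := by
    refine (abs_le_of_sq_le_sq' ?_ hε).2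
    refine le_trans ?_ hy.le
    rw [EuclideanSpace.norm_sq_eq]
    refine Finset.sum_le_sum fun i _ => ?_
    have h2 : (ZMod.stdAddChar (y i) : ℂ) =
        phase ((π.signedFreq (y i).val : ℝ) / 2 ^ π.fineBits) := by
      conv_lhs => rw [← signedFreq_cast (y i)]
      rw [stdAddChar_eq_phase]
      push_cast
      rfl
    rw [h2, Real.norm_eq_abs, sq_abs]
    refine sq_le_norm_phase_sub_phase_sq ?_
    -- The frequency is at most 1/2 and the target at most 1/4 in absolute value, so their
    -- difference stays below the wrap-around of the phase.
    have h3 : |(π.signedFreq (y i).val : ℝ) / 2 ^ π.fineBits| ≤ 1 / 2 := by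
      rw [abs_div, abs_of_pos (show (0 : ℝ) < 2 ^ π.fineBits by positivity),
        div_le_iff₀ (by positivity)]
      linarith [abs_signedFreq_le (π := π) (y i).val]
    exact ((abs_sub _ _).trans (add_le_add h3 (hf4 i))).trans (by norm_num)
  -- The output 2k + 1 in place of 2k moves each coordinate by half a frequency step.
  have h2 : ‖c - w‖ ≤ n * (1 / 2 ^ π.fineBits) := by
    refine norm_le_mul_of_forall_abs_le fun i => ?_
    have h3 : (c - w) i = 1 / 2 ^ π.fineBits / 2 := by
      simp only [hc, hw, hv_def, PiLp.sub_apply, PiLp.smul_apply, smul_eq_mul,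
        outcomeVector_of_isSmall hu]
      field_simp
      ring
    rw [h3, abs_of_nonneg (by positivity)]
    have : (0 : ℝ) ≤ 1 / 2 ^ π.fineBits := by positivity
    linarith
  refine hf.isSeparatingDirection hr hrK hKR hη hx (smul_ne_zero hN.ne' hv) hα
    (ε := ε + n * (1 / 2 ^ π.fineBits)) ?_ hβ hX hX0 hP hmain
  have := norm_sub_le_norm_sub_add_norm_sub c w ω
  linarith

end Params

/-! ### Inequalities between powers of a single small number -/

/-- The number `g` is small compared to the data of the problem. -/
structure IsScale (n : ℕ) (r R η g : ℝ) : Prop where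
  pos : 0 < g
  le : g ≤ 1 / 64
  dim : n * g ≤ 1
  outer : R * g ≤ 1
  inner : g ≤ r
  err : g ≤ η
  err_le : η ≤ 1

namespace IsScale

variable {n : ℕ} {r R η g : ℝ} (h : IsScale n r R η g)

include h

theorem anti {j k : ℕ} (hjk : j ≤ k) : g ^ k ≤ g ^ j :=
  pow_le_pow_of_le_one h.pos.le (by linarith [h.le]) hjk

theorem pow_succ_le (k : ℕ) : g ^ (k + 1) ≤ g ^ k / 64 := by
  rw [pow_succ]
  have := mul_le_mul_of_nonneg_left h.le (pow_pos h.pos k).le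
  linarith

/-- The accounting rule of all estimates below: one power of g pays for a factor n, and in `div_le`
for a factor 1/r. -/
theorem dim_mul_pow_le (k : ℕ) : n * g ^ (k + 1) ≤ g ^ k := by
  calc n * g ^ (k + 1) = n * g * g ^ k := by ring
    _ ≤ 1 * g ^ k := mul_le_mul_of_nonneg_right h.dim (pow_pos h.pos k).le
    _ = g ^ k := one_mul _

theorem inner_pos : 0 < r := h.pos.trans_le h.inner

theorem div_le {a : ℝ} {k : ℕ} (ha : a ≤ g ^ (k + 1)) : a / r ≤ g ^ k := by
  rw [div_le_iff₀ h.inner_pos]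
  refine ha.trans ?_
  rw [pow_succ]
  exact mul_le_mul_of_nonneg_left h.inner (pow_pos h.pos k).le

theorem le_inv : 64 ≤ g⁻¹ := by
  rw [← one_div, le_div_iff₀ h.pos]
  linarith [h.le]

theorem dim_le_inv : n ≤ g⁻¹ := by
  rw [← one_div, le_div_iff₀ h.pos]
  exact h.dim

theorem outer_le_inv : R ≤ g⁻¹ := by
  rw [← one_div, le_div_iff₀ h.pos]
  exact h.outer

theorem pow_le_one (k : ℕ) : g ^ k ≤ 1 := pow_le_one₀ h.pos.le (by linarith [h.le])

theorem dim_mul_le : n * (8 * g⁻¹ + g ^ 8) ≤ 9 * g⁻¹ ^ 2 := by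
  have h8 : g ^ 8 ≤ g⁻¹ := (h.pow_le_one 8).trans (by linarith [h.le_inv])
  have h9 : 8 * g⁻¹ + g ^ 8 ≤ 9 * g⁻¹ := by linarith
  have hg := h.pos
  calc (n : ℝ) * (8 * g⁻¹ + g ^ 8) ≤ g⁻¹ * (9 * g⁻¹) :=
        mul_le_mul h.dim_le_inv h9 (by positivity) (by positivity)
    _ = 9 * g⁻¹ ^ 2 := by ring

/-- After division by α, the right side is at least g³/18. The geometric error on the left is 4g⁶,
and the frequency error, of order g¹⁶ and divided by α ≥ g⁹, is of order g⁷. -/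
theorem separation_bound (hR : 0 ≤ R) {α : ℝ} (hα : g ^ 9 ≤ α) :
    α * (4 * g ^ 6) + (g ^ 18 + n * g ^ 40) * (10 * g⁻¹ ^ 2 + R + η) ≤
      η * (α / (2 * (9 * g⁻¹ ^ 2))) := by
  have hg := h.pos
  have hη := h.err
  have hα0 : 0 < α := (pow_pos hg 9).trans_le hα
  have h1 : n * g ^ 40 ≤ g ^ 18 := (h.dim_mul_pow_le 39).trans (h.anti (by norm_num))
  have hsq : g⁻¹ ≤ g⁻¹ ^ 2 := le_self_pow₀ (by linarith [h.le_inv]) two_ne_zero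
  have h2 : 10 * g⁻¹ ^ 2 + R + η ≤ 12 * g⁻¹ ^ 2 := by
    linarith [h.outer_le_inv, h.err_le, h.le_inv]
  have hP0 : 0 ≤ 10 * g⁻¹ ^ 2 + R + η := by
    have : 0 ≤ η := by linarith
    positivity
  have h3 : (g ^ 18 + n * g ^ 40) * (10 * g⁻¹ ^ 2 + R + η) ≤ 24 * g ^ 16 := by
    calc (g ^ 18 + n * g ^ 40) * (10 * g⁻¹ ^ 2 + R + η) ≤ (2 * g ^ 18) * (12 * g⁻¹ ^ 2) :=
          mul_le_mul (by linarith) h2 hP0 (by positivity)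
      _ = 24 * g ^ 16 := by
        field_simp
        ring
  have h4 : 24 * g ^ 16 ≤ α * (24 * g ^ 7) := by
    calc 24 * g ^ 16 = g ^ 9 * (24 * g ^ 7) := by ring
      _ ≤ _ := by gcongr
  have h5 : α * (g ^ 3 / 18) ≤ η * (α / (2 * (9 * g⁻¹ ^ 2))) := by
    have : α / (2 * (9 * g⁻¹ ^ 2)) = α * (g ^ 2 / 18) := by
      field_simp
      ring
    rw [this]
    calc α * (g ^ 3 / 18) = g * (α * (g ^ 2 / 18)) := by ring
      _ ≤ _ := by gcongr
  have h6 : 4 * g ^ 6 + 24 * g ^ 7 ≤ g ^ 3 / 18 := by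
    have a3 := h.pow_succ_le 3
    have a4 := h.pow_succ_le 4
    have a5 := h.pow_succ_le 5
    have a6 := h.pow_succ_le 6
    have := pow_pos hg 3
    norm_num at a3 a4 a5 a6
    linarith
  have h7 := mul_le_mul_of_nonneg_left h6 hα0.le
  linarith

/-- Each contribution in the inner bracket is at most of order g¹⁹⁹, so the phase error is at most
g⁵² and the wrap-around term 4g⁴⁰ dominates. With the factor n and the threshold g³⁶ of Markov's
inequality, 5g³ remains. -/
theorem error_bound {c : ℝ} (hc0 : 0 ≤ c) (hc : c ≤ g ^ 108 * (n * (2 * n * (1 / r) / (g ^ 100)⁻¹))) :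
    ((g ^ 18) ^ 2)⁻¹ * (n * (4 * Real.pi * (g / 16 * (g ^ 148)⁻¹ * (8 * c +
      16 * (n * g ^ 108 / r) ^ 2 + 2 * (2 * (g ^ 200 / r) + 2 * g ^ 200))) + 4 / (g ^ 40)⁻¹)) ≤
      η := by
  have hg := h.pos
  have hr := h.inner_pos
  have h1 : c ≤ 2 * g ^ 205 := by
    refine hc.trans ?_
    have h2 := h.dim_mul_pow_le 207
    have h3 := h.dim_mul_pow_le 206
    have h4 : n * (n * g ^ 208) ≤ g ^ 206 :=
      (mul_le_mul_of_nonneg_left h2 (by positivity)).trans h3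
    calc g ^ 108 * (n * (2 * n * (1 / r) / (g ^ 100)⁻¹)) = 2 * ((n * (n * g ^ 208)) / r) := by
          field_simp
      _ ≤ 2 * g ^ 205 := mul_le_mul_of_nonneg_left (h.div_le h4) (by norm_num)
  have h2 : (n * g ^ 108 / r) ^ 2 ≤ g ^ 212 := by
    have := pow_le_pow_left₀ (by positivity) (h.div_le (h.dim_mul_pow_le 107)) 2
    rwa [← pow_mul] at this
  have h3 : g ^ 200 / r ≤ g ^ 199 := h.div_le le_rfl
  have h4 : 8 * c + 16 * (n * g ^ 108 / r) ^ 2 + 2 * (2 * (g ^ 200 / r) + 2 * g ^ 200) ≤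
      16 * g ^ 199 := by
    have a1 := h.pow_succ_le 199
    have a2 := h.anti (show 200 ≤ 205 by norm_num)
    have a3 := h.anti (show 200 ≤ 212 by norm_num)
    norm_num at a1
    linarith [pow_pos hg 199]
  have h5 : g / 16 * (g ^ 148)⁻¹ * (8 * c + 16 * (n * g ^ 108 / r) ^ 2 +
      2 * (2 * (g ^ 200 / r) + 2 * g ^ 200)) ≤ g ^ 52 := by
    refine (mul_le_mul_of_nonneg_left h4 (by positivity)).trans (le_of_eq ?_)
    field_simp
  have h6 : 4 * Real.pi * (g / 16 * (g ^ 148)⁻¹ * (8 * c + 16 * (n * g ^ 108 / r) ^ 2 +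
      2 * (2 * (g ^ 200 / r) + 2 * g ^ 200))) + 4 / (g ^ 40)⁻¹ ≤ 5 * g ^ 40 := by
    have hpi : 4 * Real.pi ≤ 64 := by linarith [Real.pi_le_four]
    have a1 := mul_le_mul hpi h5 (by positivity) (by norm_num)
    have a2 := h.pow_succ_le 51
    have a3 := h.anti (show 40 ≤ 51 by norm_num)
    have a4 : 4 / (g ^ 40)⁻¹ = 4 * g ^ 40 := by rw [div_inv_eq_mul]
    norm_num at a2
    linarith
  have h7 : n * (4 * Real.pi * (g / 16 * (g ^ 148)⁻¹ * (8 * c + 16 * (n * g ^ 108 / r) ^ 2 +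
      2 * (2 * (g ^ 200 / r) + 2 * g ^ 200))) + 4 / (g ^ 40)⁻¹) ≤ 5 * g ^ 39 := by
    have a1 := h.dim_mul_pow_le 39
    have a2 := mul_le_mul_of_nonneg_left h6 (Nat.cast_nonneg n)
    norm_num at a1
    linarith
  refine (mul_le_mul_of_nonneg_left h7 (by positivity)).trans ?_
  have h8 : ((g ^ 18) ^ 2)⁻¹ * (5 * g ^ 39) = 5 * g ^ 3 := by
    field_simp
  rw [h8]
  have a1 := h.pow_succ_le 2
  have a2 := h.anti (show 1 ≤ 2 by norm_num)
  have := h.err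
  norm_num at a1 a2
  linarith

theorem half_le : 1 / 2 ≤ 1 - 2 * g ^ 6 := by
  have := h.anti (show 1 ≤ 6 by norm_num)
  have := h.le
  rw [pow_one] at *
  linarith

end IsScale

namespace Params

open Wire

/-! ### The choice of the parameters -/

/-- The parameters of the circuit for the size `2 ^ l`. -/
def ofSize (n b f l : ℕ) (hl : 0 < l) : Params n b where
  inFrac := f
  -- The boxes have side g¹⁰⁸, and the scale makes the phase advance per grid step g/16 times the
  -- slope of 1/γ, so that frequencies stay below 1/4. The coarse grid makes the change of
  -- subgradients small even after multiplication by g^(-147), and 200 l search steps match the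
  -- oracle error g²⁰⁰.
  fineBits := 40 * l
  coarseBits := 100 * l
  baseFrac := 8 * l
  steps := 200 * l
  logBound := l + 3
  scale := 2 ^ (148 * l) / 2 ^ (l + 4)
  fineBits_pos := by omega

section

variable (n b f : ℕ) {l : ℕ} (hl : 0 < l) {g : ℝ} (hg : g = (1 / 2) ^ l)

theorem ofSize_gridFrac : (ofSize n b f l hl).gridFrac = 148 * l := by
  simp only [gridFrac, ofSize]
  ring

include hg

theorem two_pow_mul_eq (k : ℕ) : (2 : ℝ) ^ (k * l) = (g ^ k)⁻¹ := by
  rw [hg, ← pow_mul, one_div, inv_pow, inv_inv, mul_comm]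

theorem two_pow_eq : (2 : ℝ) ^ l = g⁻¹ := by
  rw [hg, one_div, inv_pow, inv_inv]

theorem ofSize_fineBits : (2 : ℝ) ^ (ofSize n b f l hl).fineBits = (g ^ 40)⁻¹ :=
  two_pow_mul_eq hg 40

theorem ofSize_coarseBits : (2 : ℝ) ^ (ofSize n b f l hl).coarseBits = (g ^ 100)⁻¹ :=
  two_pow_mul_eq hg 100

theorem ofSize_baseFrac : (1 / 2 ^ (ofSize n b f l hl).baseFrac : ℝ) = g ^ 8 := by
  rw [one_div, ← inv_inv (g ^ 8)]
  exact congrArg _ (two_pow_mul_eq hg 8)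

theorem ofSize_two_pow_gridFrac : (2 : ℝ) ^ (ofSize n b f l hl).gridFrac = (g ^ 148)⁻¹ := by
  rw [ofSize_gridFrac]
  exact two_pow_mul_eq hg 148

theorem ofSize_steps : (1 / 2 : ℝ) ^ (ofSize n b f l hl).steps = g ^ 200 := by
  rw [one_div, inv_pow, ← inv_inv (g ^ 200)]
  exact congrArg _ (two_pow_mul_eq hg 200)

theorem ofSize_logBound : (2 : ℝ) ^ (ofSize n b f l hl).logBound = 8 * g⁻¹ := by
  change (2 : ℝ) ^ (l + 3) = _
  rw [pow_add, two_pow_eq hg]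
  ring

theorem ofSize_scale : (ofSize n b f l hl).scale = g / 16 * (g ^ 148)⁻¹ := by
  change (2 : ℝ) ^ (148 * l) / 2 ^ (l + 4) = _
  rw [pow_add, two_pow_eq hg, two_pow_mul_eq hg 148, div_eq_mul_inv, mul_inv, inv_inv]
  ring

theorem ofSize_scale_div (hg0 : 0 < g) :
    (ofSize n b f l hl).scale / 2 ^ (ofSize n b f l hl).gridFrac = g / 16 := by
  rw [ofSize_scale _ _ _ _ hg, ofSize_two_pow_gridFrac _ _ _ _ hg]
  field_simp

theorem ofSize_side (hg0 : 0 < g) : (ofSize n b f l hl).side = g ^ 108 := by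
  rw [side, ofSize_fineBits _ _ _ _ hg, ofSize_two_pow_gridFrac _ _ _ _ hg]
  field_simp

end

variable {n b f l : ℕ} {hl : 0 < l} {m : EuclideanSpace ℝ (Fin n) → Bool}
  {u : Fin n × Fin b → Bool} {K : Set (EuclideanSpace ℝ (Fin n))} {r R η g : ℝ}
  {p : EuclideanSpace ℝ (Fin n)}

/-- One rejection at the truncated input bounds the gauge below on the whole grid, since the grid
has diameter at most g⁷ and the gauge is (1/r)-Lipschitz. -/
theorem ofSize_le_gauge (hK : Convex ℝ K) (hrK : Metric.closedBall 0 r ⊆ K)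
    (hg : g = (1 / 2) ^ l) (h : IsScale n r R η g) (hm : IsMembershipOracle K (g ^ 200) m)
    (hflag : m ((ofSize n b f l hl).gridPoint u (fun _ => 0) fun _ => 0) = false)
    {x z : Fin n → ℕ} (hx : ∀ i, x i < 2 ^ (ofSize n b f l hl).fineBits)
    (hz : ∀ i, z i < 2 ^ (ofSize n b f l hl).coarseBits) :
    1 - 2 * g ^ 6 ≤ gauge K ((ofSize n b f l hl).gridPoint u x z) := by
  have hr := h.inner_pos
  have h0 := le_gauge_of_notMem_deepInterior hK hr hrK ((hm _).2 hflag)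
  have h1 := gauge_le_add_norm_sub_div hK hr hrK
    ((ofSize n b f l hl).gridPoint u (fun _ => 0) fun _ => 0) ((ofSize n b f l hl).gridPoint u x z)
  have h2 := norm_gridPoint_sub_le (u := u) hx hz
  rw [ofSize_baseFrac _ _ _ _ hg] at h2
  have h3 := h.div_le (h2.trans (h.dim_mul_pow_le 7))
  have h4 : g ^ 200 / r ≤ g ^ 199 := h.div_le le_rfl
  have h5 := h.anti (show 6 ≤ 199 by norm_num)
  linarith

theorem ofSize_correctAnswer (hn : 0 < n) (hK : Convex ℝ K)
    (hrK : Metric.closedBall 0 r ⊆ K) (hKR : K ⊆ Metric.closedBall 0 R)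
    (hg : g = (1 / 2) ^ l) (h : IsScale n r R η g)
    (hm : IsMembershipOracle K (g ^ 200) m) (hu : (ofSize n b f l hl).IsSmall u)
    (hp : ‖p - fixedPoint f u‖ ≤ g ^ 200)
    (hflag : m ((ofSize n b f l hl).gridPoint u (fun _ => 0) fun _ => 0) = false)
    {z : Fin n → ℕ} (hz : ∀ i, z i < 2 ^ (ofSize n b f l hl).coarseBits)
    {F : EuclideanSpace ℝ (Fin n) →ₗ[ℝ] ℝ}
    (hF : IsSupporting K ((ofSize n b f l hl).gridPoint u 0 z) F)
    {y : Fin n → ZMod (2 ^ (ofSize n b f l hl).fineBits)}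
    (hy : ∑ i, ‖(ZMod.stdAddChar (y i) : ℂ) -
      phase (-(g / 16 / gauge K ((ofSize n b f l hl).gridPoint u 0 z) ^ 2) *
        F (EuclideanSpace.single i 1))‖ ^ 2 < (g ^ 18) ^ 2) :
    CorrectAnswer K η p ((ofSize n b f l hl).outcome m u z (fun i => (y i).val) (flag 0))
      ((ofSize n b f l hl).outcomeVector m u z fun i => (y i).val) := by
  have hg0 := h.pos
  have hr := h.inner_pos
  have hx0 : ∀ i : Fin n, (0 : Fin n → ℕ) i < 2 ^ (ofSize n b f l hl).fineBits := fun _ => by simp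
  have hX0 := norm_gridPoint_le (u := u) hx0 hz
  have hpx0 := norm_sub_gridPoint_le hu hp hx0 hz
  have hγ1 := ofSize_le_gauge hK hrK hg h hm hflag hx0 hz
  rw [ofSize_baseFrac _ _ _ _ hg] at hX0 hpx0
  rw [ofSize_logBound _ _ _ _ hg] at hX0
  have hX := hX0.trans h.dim_mul_le
  have hpx := hpx0.trans (add_le_add le_rfl (h.dim_mul_pow_le 7))
  have hγn := gauge_le_norm_div h.inner_pos hrK ((ofSize n b f l hl).gridPoint u 0 z)
  set x := (ofSize n b f l hl).gridPoint u 0 z with hx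
  set γ := gauge K x with hγ
  have hγ2 : 1 / 2 ≤ γ := h.half_le.trans hγ1
  have hγ0 : 0 < γ := by linarith
  -- An upper bound for the gauge is needed too: dividing by γ² must not make the target frequency
  -- too small to be resolved.
  have hγ3 : γ * g ^ 3 ≤ 9 := by
    rw [le_div_iff₀ h.inner_pos] at hγn
    have h2 : γ * g ≤ 9 * g⁻¹ ^ 2 :=
      (mul_le_mul_of_nonneg_left h.inner hγ0.le).trans (hγn.trans hX)
    calc γ * g ^ 3 = γ * g * g ^ 2 := by ring
      _ ≤ 9 * g⁻¹ ^ 2 * g ^ 2 := by gcongr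
      _ = 9 := by field_simp
  set α := g / 16 / γ ^ 2 with hα
  have hα0 : 0 < α := by positivity
  have hγsq : (1 / 2) ^ 2 ≤ γ ^ 2 := pow_le_pow_left₀ (by norm_num) hγ2 2
  have hα1 : α ≤ g / 4 := by
    rw [hα, div_le_iff₀ (by positivity)]
    have := mul_le_mul_of_nonneg_left hγsq (show 0 ≤ g / 4 by positivity)
    linarith
  have hα2 : g ^ 9 ≤ α := by
    rw [hα, le_div_iff₀ (by positivity)]
    have h1 : (γ * g ^ 3) ^ 2 ≤ 9 ^ 2 := pow_le_pow_left₀ (by positivity) hγ3 2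
    have h2 : g ^ 2 ≤ (1 / 64) ^ 2 := pow_le_pow_left₀ hg0.le h.le 2
    calc g ^ 9 * γ ^ 2 = (γ * g ^ 3) ^ 2 * g ^ 2 * g := by ring
      _ ≤ 9 ^ 2 * (1 / 64) ^ 2 * g := by gcongr
      _ ≤ g / 16 := by linarith
  have hR : 0 ≤ R := by simpa using hKR (hrK (Metric.mem_closedBall_self hr.le))
  refine correctAnswer_of_close hn hr hrK hKR (hg0.le.trans h.err) hu hflag hF hγ2 hα0
    (pow_pos hg0 18).le (fun i => ?_) hy (β := 4 * g ^ 6) (X := 9 * g⁻¹ ^ 2) (P := 10 * g⁻¹ ^ 2)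
    ?_ hX (by positivity) ?_ ?_
  · have h1 := hF.abs_apply_le hr hrK (EuclideanSpace.single i 1)
    rw [show ‖(EuclideanSpace.single i 1 : EuclideanSpace ℝ (Fin n))‖ = 1 by simp] at h1
    rw [abs_mul, abs_neg, abs_of_pos hα0]
    have h3 : g * (1 / r) ≤ 1 := by
      rw [mul_one_div]
      exact (div_le_one hr).2 h.inner
    have h5 := (mul_le_mul_of_nonneg_left h1 hg0.le).trans h3
    have h6 := mul_le_mul_of_nonneg_right hα1 (abs_nonneg (F (EuclideanSpace.single i 1)))
    linarith
  · have h1 : ‖p - x‖ / r ≤ g ^ 199 + g ^ 6 := by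
      refine le_trans (div_le_div_of_nonneg_right hpx hr.le) ?_
      rw [add_div]
      exact add_le_add (h.div_le le_rfl) (h.div_le le_rfl)
    have h3 := h.anti (show 6 ≤ 199 by norm_num)
    linarith
  · have h1 := norm_sub_le_norm_sub_add_norm_sub p x 0
    rw [sub_zero, sub_zero] at h1
    have hsq : g⁻¹ ≤ g⁻¹ ^ 2 := le_self_pow₀ (by linarith [h.le_inv]) two_ne_zero
    linarith [h.pow_le_one 200, h.pow_le_one 7, h.le_inv]
  · have h1 : (1 / 2 ^ (ofSize n b f l hl).fineBits : ℝ) = g ^ 40 := by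
      rw [ofSize_fineBits _ _ _ _ hg, one_div, inv_inv]
    rw [h1]
    exact h.separation_bound hR hα2

/-- The circuit is correct with high probability if the input is small and the truncated input is
not asserted to be close to `K`. -/
theorem one_sub_le_prob_ofSize (hn : 0 < n) (hK : Convex ℝ K)
    (hrK : Metric.closedBall 0 r ⊆ K) (hKR : K ⊆ Metric.closedBall 0 R)
    (hg : g = (1 / 2) ^ l) (h : IsScale n r R η g)
    (hm : IsMembershipOracle K (g ^ 200) m) (hu : (ofSize n b f l hl).IsSmall u)
    (hp : ‖p - fixedPoint f u‖ ≤ g ^ 200)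
    (hflag : m ((ofSize n b f l hl).gridPoint u (fun _ => 0) fun _ => 0) = false) :
    1 - η ≤ (ofSize n b f l hl).circuit.prob m u ((ofSize n b f l hl).circuit.correct K η p) := by
  have hg0 := h.pos
  have hr := h.inner_pos
  -- One subgradient is fixed for every offset in ℕⁿ, because the shifts by n leave the coarse
  -- range.
  choose F hF using fun z : Fin n → ℕ =>
    exists_isSupporting hK hr hrK ((ofSize n b f l hl).gridPoint u 0 z)
  have hscale : 0 < (ofSize n b f l hl).scale := by
    rw [ofSize_scale _ _ _ _ hg]
    positivity
  have hprob := (ofSize n b f l hl).one_sub_le_prob_circuit m u K η p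
    (fun z i => -((ofSize n b f l hl).scale / 2 ^ (ofSize n b f l hl).gridFrac /
      gauge K ((ofSize n b f l hl).gridPoint u 0 z) ^ 2) * F z (EuclideanSpace.single i 1))
    (fun z => (ofSize n b f l hl).scale * (8 * (ofSize n b f l hl).gradientChange F z +
      16 * (n * (ofSize n b f l hl).side / r) ^ 2 +
      2 * (2 * (g ^ 200 / r) + 2 * (1 / 2) ^ (ofSize n b f l hl).steps)))
    (τ := (g ^ 18) ^ 2) (by positivity)
    (fun z _ => by
      have := gradientChange_nonneg hK hr hrK hn hF z
      positivity)
    (fun z hz i x hx hxi => abs_searchPhase_sub_le hK hr hrK hn (pow_pos hg0 200).le hm hu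
      hscale.le hF (fun x z hx hz => h.half_le.trans (ofSize_le_gauge hK hrK hg h hm hflag hx hz))
      hx hz i hxi)
    (fun z hz y hy => by
      rw [ofSize_scale_div _ _ _ _ hg hg0] at hy
      exact ofSize_correctAnswer hn hK hrK hKR hg h hm hu hp hflag hz (hF z) hy)
  refine le_trans (sub_le_sub_left ?_ 1) hprob
  have hM : 0 < 2 ^ (ofSize n b f l hl).coarseBits := by positivity
  have havg := sum_gradientChange_le hr hrK hF hM
  have hc0 : 0 ≤ (((2 ^ (ofSize n b f l hl).coarseBits : ℕ) : ℝ) ^ n)⁻¹ *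
      ∑ z : Fin n → Fin (2 ^ (ofSize n b f l hl).coarseBits),
        (ofSize n b f l hl).gradientChange F fun i => z i :=
    mul_nonneg (by positivity) (Finset.sum_nonneg fun z _ =>
      gradientChange_nonneg hK hr hrK hn hF _)
  have hfine : (((2 ^ (ofSize n b f l hl).fineBits : ℕ)) : ℝ) = (g ^ 40)⁻¹ := by
    rw [Nat.cast_pow]
    exact ofSize_fineBits _ _ _ _ hg
  have hcoarse : (((2 ^ (ofSize n b f l hl).coarseBits : ℕ)) : ℝ) = (g ^ 100)⁻¹ := by
    rw [Nat.cast_pow]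
    exact ofSize_coarseBits _ _ _ _ hg
  set c := (((2 ^ (ofSize n b f l hl).coarseBits : ℕ) : ℝ) ^ n)⁻¹ *
      ∑ z : Fin n → Fin (2 ^ (ofSize n b f l hl).coarseBits),
        (ofSize n b f l hl).gradientChange F fun i => z i with hc
  rw [ofSize_side _ _ _ _ hg hg0, hcoarse] at havg
  refine le_trans (le_of_eq ?_) (h.error_bound hc0 havg)
  congr 1
  rw [← Finset.mul_sum, mul_left_comm, Finset.sum_add_distrib, ← Finset.mul_sum, ← Finset.mul_sum,
    Finset.sum_add_distrib, Finset.sum_add_distrib, ← Finset.mul_sum]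
  simp only [Finset.sum_const, Finset.card_univ, Fintype.card_fun, Fintype.card_fin, nsmul_eq_mul]
  have hcard : ((((2 ^ (ofSize n b f l hl).coarseBits) ^ n : ℕ)) : ℝ) =
      ((2 ^ (ofSize n b f l hl).coarseBits : ℕ) : ℝ) ^ n := Nat.cast_pow _ _
  rw [hcard, hfine, ofSize_scale _ _ _ _ hg, ofSize_side _ _ _ _ hg hg0, ofSize_steps _ _ _ _ hg,
    hc]
  have hMn : ((2 ^ (ofSize n b f l hl).coarseBits : ℕ) : ℝ) ^ n ≠ 0 := by positivity
  generalize ((2 ^ (ofSize n b f l hl).coarseBits : ℕ) : ℝ) ^ n = A at *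
  field_simp

end Params

namespace Params

variable {n b f l : ℕ} {hl : 0 < l} {m : EuclideanSpace ℝ (Fin n) → Bool}
  {K : Set (EuclideanSpace ℝ (Fin n))} {r R η g : ℝ}

/-- The scale is only assumed with g in the place of r, and g ≤ r only if η ≤ R: for tiny r no bound
on 1/r is available, but then η > R, the deep interior is empty and any direction is correct. -/
theorem ofSize_implementsSeparation (hn : 0 < n) (hK : Convex ℝ K)
    (hrK : Metric.closedBall 0 r ⊆ K) (hKR : K ⊆ Metric.closedBall 0 R)
    (hg : g = (1 / 2) ^ l) (h : IsScale n g R η g) (hr : η ≤ R → g ≤ r)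
    (hm : IsMembershipOracle K (g ^ 200) m) :
    (ofSize n b f l hl).circuit.ImplementsSeparation f (g ^ 200) K η m := by
  have hη0 : 0 < η := h.pos.trans_le h.err
  intro p u hp
  by_cases hu : (ofSize n b f l hl).IsSmall u
  · have hmain : m ((ofSize n b f l hl).gridPoint u (fun _ => 0) fun _ => 0) = false → η ≤ R →
        1 - η ≤ (ofSize n b f l hl).circuit.prob m u
          ((ofSize n b f l hl).circuit.correct K η p) := fun hflag hηR =>
      one_sub_le_prob_ofSize hn hK hrK hKR hg
        ⟨h.pos, h.le, h.dim, h.outer, hr hηR, h.err, h.err_le⟩ hm hu hp hflag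
    rcases hflag : m ((ofSize n b f l hl).gridPoint u (fun _ => 0) fun _ => 0) with _ | _
    · rcases le_or_gt η R with hηR | hηR
      · exact hmain hflag hηR
      · exact (sub_le_self 1 hη0.le).trans (one_le_prob_circuit fun z y =>
          correctAnswer_of_deepInterior_eq_empty hn (deepInterior_eq_empty hn hKR hη0 hηR)
            (by rw [outcome_flag_of_isSmall hu, hflag]))
    · refine (sub_le_self 1 hη0.le).trans (one_le_prob_circuit fun z y =>
        correctAnswer_of_flag hm hu hp ?_ hflag _ _)
      rw [ofSize_baseFrac _ _ _ _ hg]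
      have h1 := h.dim_mul_pow_le 7
      have h2 := h.anti (show 2 ≤ 200 by norm_num)
      have h3 := h.anti (show 2 ≤ 7 by norm_num)
      have h4 := h.pow_succ_le 1
      have := h.err
      have := h.pos
      norm_num at h1 h4
      linarith
  · refine (sub_le_self 1 hη0.le).trans (one_le_prob_circuit fun z y =>
      correctAnswer_of_not_isSmall (π := ofSize n b f l hl) hn hη0.le hKR hp ?_ ?_ hu _ _)
    · have h1 := h.anti (show 1 ≤ 200 by norm_num)
      have := h.le
      rw [pow_one] at h1
      linarith
    · rw [ofSize_logBound _ _ _ _ hg]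
      linarith [h.dim_le_inv, h.outer_le_inv, h.le_inv]

theorem queryCount_ofSize : (ofSize n b f l hl).circuit.queryCount = 400 * l + 1 := by
  rw [queryCount_circuit]
  simp only [ofSize]
  ring

theorem gateCount_ofSize_le (hn : 0 < n) :
    (ofSize n b f l hl).circuit.gateCount ≤ 4000000 * (n * (l + b) ^ 2) := by
  refine (gateCount_circuit_le _).trans ?_
  rw [Wire.card_eq]
  have htop : (ofSize n b f l hl).top + 1 = 349 * l + 7 := by
    simp only [top, ofSize]
    ring
  rw [htop]
  simp only [ofSize]
  have h1 : n * b ≤ n * (l + b) ^ 2 := Nat.mul_le_mul_left n (by nlinarith)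
  have h2 : n * l ≤ n * (l + b) ^ 2 := Nat.mul_le_mul_left n (by nlinarith)
  have h3 : n * (l * l) ≤ n * (l + b) ^ 2 := Nat.mul_le_mul_left n (by nlinarith)
  have h4 : n ≤ n * l := Nat.le_mul_of_pos_right n hl
  have h5 : l ≤ n * l := Nat.le_mul_of_pos_left l hn
  have h6 : 1 ≤ n * l := Nat.mul_pos hn hl
  generalize n * (l + b) ^ 2 = Q at *
  nlinarith

end Params

/-! ### The choice of the scale and the assembly -/

/-- The circuit that does nothing. -/
def trivialCircuit (n b : ℕ) : SeparationCircuit n b where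
  width := n * b + 1
  queryBits := 0
  queryFrac := 0
  outBits := 0
  input := finProdFinEquiv.toEmbedding.trans Fin.castSuccEmb
  flag := Fin.last _
  output := ⟨fun k => k.2.elim0, fun k => k.2.elim0⟩
  gates := []

/-- A power of two between a number and its double. -/
theorem exists_two_pow_near {x : ℝ} (hx : 1 ≤ x) :
    ∃ l : ℕ, 0 < l ∧ x ≤ 2 ^ l ∧ (2 : ℝ) ^ l ≤ 2 * x ∧ (l : ℝ) ≤ 2 * Real.log x + 1 := by
  obtain ⟨k, hk, hk'⟩ := exists_nat_pow_near hx (one_lt_two (α := ℝ))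
  refine ⟨k + 1, k.succ_pos, hk'.le, by rw [pow_succ]; linarith, ?_⟩
  have h1 := Real.log_le_log (by positivity) hk
  rw [Real.log_pow] at h1
  have h2 := Real.log_two_gt_d9
  have h3 : (0 : ℝ) ≤ k := Nat.cast_nonneg k
  push_cast
  nlinarith

/-- The size bound that is needed for data bounded by powers of `Λ`. -/
theorem exists_size {a n : ℕ} {r R η Λ : ℝ} (hn : 0 < n) (hr : 0 < r) (hrR : r < R)
    (hη : 0 < η) (hη1 : η < 1) (hΛ : Λ = 2 + n / η)
    (hR : R ≤ a * (n : ℝ) ^ a) (hκ : R / r ≤ a * (n : ℝ) ^ a) :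
    ∃ l : ℕ, 0 < l ∧ IsScale n ((1 / 2) ^ l) R η ((1 / 2) ^ l) ∧ (η ≤ R → (1 / 2) ^ l ≤ r) ∧
      (2 : ℝ) ^ l ≤ Λ ^ (2 * a + 8) ∧ (l : ℝ) ≤ (4 * a + 15) * Real.log Λ := by
  have hn1 : (1 : ℝ) ≤ n := by exact_mod_cast hn
  have hηinv : 1 < 1 / η := by rwa [lt_div_iff₀ hη, one_mul]
  have hnη : 1 / η ≤ n / η := div_le_div_of_nonneg_right hn1 hη.le
  have hnn : n ≤ n / η := by
    rw [le_div_iff₀ hη]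
    nlinarith
  have hΛ3 : 3 ≤ Λ := by linarith
  have hΛ1 : 1 ≤ Λ := by linarith
  have hlog : 1 ≤ Real.log Λ := by
    rw [Real.le_log_iff_exp_le (by linarith)]
    linarith [Real.exp_one_lt_d9]
  -- The power Λ^(2a) dominates a nᵃ, one more factor is needed for 1/r, and Λ⁶ dominates 64; the
  -- exponent 2a + 7 covers all of these.
  obtain ⟨l, hl, h1, h2, h3⟩ := exists_two_pow_near (one_le_pow₀ hΛ1 : 1 ≤ Λ ^ (2 * a + 7))
  have hmono : ∀ {j k : ℕ}, j ≤ k → Λ ^ j ≤ Λ ^ k := fun h => pow_le_pow_right₀ hΛ1 h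
  have ha : (a : ℝ) ≤ Λ ^ a := by
    have : (a : ℝ) ≤ 2 ^ a := by exact_mod_cast Nat.lt_two_pow_self.le
    exact this.trans (pow_le_pow_left₀ (by norm_num) (by linarith) a)
  have han : (a : ℝ) * (n : ℝ) ^ a ≤ Λ ^ (2 * a) := by
    rw [two_mul, pow_add]
    exact mul_le_mul ha (pow_le_pow_left₀ (by linarith) (by linarith) a) (by positivity)
      (by positivity)
  have hinv : ∀ {t : ℝ}, t ≤ Λ ^ (2 * a + 7) → t * (1 / 2) ^ l ≤ 1 := by
    intro t ht
    rw [one_div, inv_pow, ← div_eq_mul_inv]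
    exact (div_le_one (by positivity)).2 (ht.trans h1)
  have hpos : (0 : ℝ) < (1 / 2) ^ l := by positivity
  have hsmall : ∀ {t : ℝ}, 0 < t → 1 / t ≤ Λ ^ (2 * a + 7) → (1 / 2) ^ l ≤ t := by
    intro t ht ht'
    have := hinv ht'
    rwa [one_div_mul_eq_div, div_le_one ht] at this
  have hΛ1' : Λ ≤ Λ ^ (2 * a + 7) := le_self_pow₀ hΛ1 (by omega)
  refine ⟨l, hl, ⟨hpos, hsmall (by norm_num) ?_, hinv (by linarith), hinv ?_, le_rfl,
    hsmall hη (by linarith), hη1.le⟩, fun hηR => hsmall hr ?_, ?_, ?_⟩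
  · have h4 : (2 : ℝ) ^ 6 ≤ Λ ^ 6 := pow_le_pow_left₀ (by norm_num) (by linarith) 6
    have h5 := hmono (show 6 ≤ 2 * a + 7 by omega)
    norm_num at h4 ⊢
    linarith
  · exact hR.trans (han.trans (hmono (by omega)))
  · have h4 : 1 / r = R / r * (1 / R) := by
      have : R ≠ 0 := by linarith
      field_simp
    have h5 : 1 / R ≤ Λ := (one_div_le_one_div_of_le hη hηR).trans (by linarith)
    calc 1 / r ≤ Λ ^ (2 * a) * Λ := by
          rw [h4]
          exact mul_le_mul (hκ.trans han) h5 (by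
            have : 0 < R := by linarith
            positivity) (by positivity)
      _ = Λ ^ (2 * a + 1) := (pow_succ _ _).symm
      _ ≤ _ := hmono (by omega)
  · refine h2.trans ?_
    rw [pow_succ Λ (2 * a + 7)]
    have : 0 < Λ ^ (2 * a + 7) := by positivity
    nlinarith
  · rw [Real.log_pow] at h3
    push_cast at h3
    nlinarith

end QuantumSeparation

end

theorem mainTheorem9 (a : ℕ) :
    ∃ C k : ℕ, ∀ (n : ℕ) (r R η : ℝ), 0 < n → 0 < r → r < R →
      R ≤ a * (n : ℝ) ^ a → R / r ≤ a * (n : ℝ) ^ a → 0 < η →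
      ∃ δ : ℝ, 0 < δ ∧ 1 / δ ≤ C * (2 + n / η) ^ k ∧
        ∀ b f : ℕ, ∃ 𝒞 : QuantumSeparation.SeparationCircuit n b,
          (𝒞.queryCount : ℝ) ≤ C * Real.log (2 + n / η) ^ k ∧
          (𝒞.gateCount : ℝ) ≤ C * n * (Real.log (2 + n / η) + b) ^ k ∧
          ∀ (K : Set (EuclideanSpace ℝ (Fin n))) (m : EuclideanSpace ℝ (Fin n) → Bool),
            Convex ℝ K → Metric.closedBall 0 r ⊆ K → K ⊆ Metric.closedBall 0 R →
            QuantumSeparation.IsMembershipOracle K δ m →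
            𝒞.ImplementsSeparation f δ K η m := by
  -- C comes from the gate count, quadratic in l + b with l ≤ (4a + 15) log Λ. The exponent k comes
  -- from δ = g²⁰⁰ with 1/g ≤ Λ^(2a+8).
  refine ⟨4000000 * (4 * a + 15) ^ 2, 200 * (2 * a + 8), fun n r R η hn hr hrR hR hκ hη => ?_⟩
  have hn1 : (1 : ℝ) ≤ n := by exact_mod_cast hn
  have hC : (1 : ℝ) ≤ ((4000000 * (4 * a + 15) ^ 2 : ℕ) : ℝ) := by
    have : 0 < 4000000 * (4 * a + 15) ^ 2 := by positivity
    exact_mod_cast this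
  have hnη : 0 < n / η := by positivity
  set Λ := 2 + n / η with hΛ
  have hΛ1 : 1 ≤ Λ := by linarith
  have hL0 : 0 ≤ Real.log Λ := Real.log_nonneg hΛ1
  rcases le_or_gt 1 η with hη1 | hη1
  -- For η ≥ 1 the required probability is at most zero, so the empty circuit serves.
  · refine ⟨1, one_pos, ?_, fun b f => ⟨QuantumSeparation.trivialCircuit n b, ?_, ?_, ?_⟩⟩
    · rw [div_one]
      exact one_le_mul_of_one_le_of_one_le hC (one_le_pow₀ hΛ1)
    · rw [show (QuantumSeparation.trivialCircuit n b).queryCount = 0 from rfl, Nat.cast_zero]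
      positivity
    · rw [show (QuantumSeparation.trivialCircuit n b).gateCount = 0 from rfl, Nat.cast_zero]
      positivity
    · intro K m _ _ _ _ p u _
      exact (sub_nonpos.2 hη1).trans
        (QuantumSeparation.prob_nonneg _ _ _ _)
  · obtain ⟨l, hl, hscale, hinner, hpow, hlog⟩ :=
      QuantumSeparation.exists_size hn hr hrR hη hη1 hΛ hR hκ
    have hL1 : 1 ≤ Real.log Λ := by
      have : 1 ≤ n / η := by
        rw [le_div_iff₀ hη]
        linarith
      rw [Real.le_log_iff_exp_le (by linarith)]
      linarith [Real.exp_one_lt_d9]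
    have ha : (0 : ℝ) ≤ a := Nat.cast_nonneg a
    have hCval : ((4000000 * (4 * a + 15) ^ 2 : ℕ) : ℝ) = 4000000 * (4 * a + 15) ^ 2 := by
      push_cast
      rfl
    refine ⟨((1 / 2) ^ l) ^ 200, by positivity, ?_, fun b f =>
      ⟨(QuantumSeparation.Params.ofSize n b f l hl).circuit, ?_, ?_, ?_⟩⟩
    · rw [one_div, one_div, inv_pow, inv_pow, inv_inv, mul_comm 200, pow_mul Λ]
      have h1 := pow_le_pow_left₀ (by positivity) hpow 200
      exact h1.trans (le_mul_of_one_le_left (by positivity) hC)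
    · rw [QuantumSeparation.Params.queryCount_ofSize, hCval]
      push_cast
      have h1 : Real.log Λ ≤ Real.log Λ ^ (200 * (2 * a + 8)) := le_self_pow₀ hL1 (by omega)
      have h2 : 400 * (l : ℝ) + 1 ≤ 401 * (4 * a + 15) * Real.log Λ := by
        have : 1 * 1 ≤ (4 * (a : ℝ) + 15) * Real.log Λ :=
          mul_le_mul (by linarith) hL1 (by norm_num) (by linarith)
        linarith
      have h3 : 401 * (4 * (a : ℝ) + 15) ≤ 4000000 * (4 * a + 15) ^ 2 := by nlinarith
      refine h2.trans (mul_le_mul h3 h1 hL0 (by positivity))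
    · have h0 := QuantumSeparation.Params.gateCount_ofSize_le (b := b) (f := f) (hl := hl) hn
      have h1 : ((QuantumSeparation.Params.ofSize n b f l hl).circuit.gateCount : ℝ) ≤
          4000000 * (n * (l + b) ^ 2) := by exact_mod_cast h0
      have hb : (0 : ℝ) ≤ b := Nat.cast_nonneg b
      have h2 : (l + b : ℝ) ≤ (4 * a + 15) * (Real.log Λ + b) := by
        have : (b : ℝ) ≤ (4 * a + 15) * b := le_mul_of_one_le_left hb (by linarith)
        linarith
      have h3 := pow_le_pow_left₀ (by positivity) h2 2
      have h4 : (Real.log Λ + b) ^ 2 ≤ (Real.log Λ + b) ^ (200 * (2 * a + 8)) :=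
        pow_le_pow_right₀ (by linarith) (by omega)
      refine h1.trans ?_
      rw [hCval]
      calc 4000000 * (n * (l + b : ℝ) ^ 2) ≤
            4000000 * (n * ((4 * a + 15) * (Real.log Λ + b)) ^ 2) := by gcongr
        _ = 4000000 * (4 * a + 15) ^ 2 * n * (Real.log Λ + b) ^ 2 := by ring
        _ ≤ _ := by gcongr
    · intro K m hK hrK hKR hm
      exact QuantumSeparation.Params.ofSize_implementsSeparation hn hK hrK hKR rfl hscale hinner hm
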